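/- **Setting.** Let $M$ be a smooth $(2n+1)$-dimensional manifold with a CR structure $\mathcal H\subset\mathbb CTM$ of hypersurface type (a smooth involutive complex subbundle of rank $n$ with $\mathcal H\cap\overline{\mathcal H}=0$) which is uniformly $k$-nondegenerate for some $k\ge 1$: the Freeman filtration $\mathcal K_1=\mathcal H\supset\mathcal K_2\supset\cdots$ (where $\mathcal K_{j+1}$ consists of the values of sections $X$ of $\mathcal K_j$ with $[\ldots[X,\overline{X_1}],\ldots,\overline{X_j}]\in\mathcal H\oplus\overline{\mathcal H}$ for all sections $X_i$ of $\mathcal H$) has constant ranks and $\mathcal K_k\ne\mathcal K_{k+1}=0$. Let $\pi:M\to N$ be a submersion onto the space of leaves of the foliation tangent to $TM\cap(\mathcal K_2\oplus\overline{\mathcal K_2})$, and let $r=n-s$ be the rank of $\mathcal K_2$. **Frames.** $\mathcal F\to M$ is the bundle of bigraded Lie algebra isomorphisms $\tilde\phi$ from $\mathbb CTM/(\mathcal H\oplus\overline{\mathcal H})\oplus\mathcal H/\mathcal K_2\oplus\overline{\mathcal H}/\overline{\mathcal K_2}$ to the Heisenberg algebra $\mathbb C\mathfrak g_-=\mathbb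 C\oplus\mathbb C^s\oplus\mathbb C^s$; its points correspond to bases $(g,f_1,\dots,f_s)$ of the first two summands. Let $\phi=(g,f_j,\overline{f_j},e_\alpha,\overline{e_\alpha})$ be a local adapted frame around $p\in M$ (so $(e_\alpha)$ is a frame of $\mathcal K_2$), with corresponding section $\tilde\phi$ of $\mathcal F$. Define matrices $A=e^{ih}H$ and $\Xi_\alpha$ by $$\tfrac1{2i}[f_j,\overline{f_k}]\equiv A_{jk}\,g \pmod{\mathcal H\oplus\overline{\mathcal H}},\qquad [e_\alpha,\overline{f_k}]\equiv\textstyle\sum_l(\Xi_\alpha)_{lk}f_l\pmod{\mathcal K_2\oplus\overline{\mathcal H}},$$ and $S^{0,2}_\alpha=\Xi_\alpha A^{-1}$, $S^{0,-2}_\alpha=A\overline{\Xi_\alpha}$. Let $\mathfrak{csp}$ be the Lie algebra of grading-preserving derivations of $\mathbb C\mathfrak g_-$; its elements act on $\mathbb C\mathfrak g_{-1}=\mathbb C^s\oplus\mathbb C^s$ as $\begin{pmatrix}L-c&S\\S'&-L^T-c\end{pmatrix}$ with $S,S'$ symmetric, and $\mathfrak{csp}_{0,0}$, $\mathfrak{csp}_{0,2}$,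 $\mathfrak{csp}_{0,-2}$ denote the parts with parameters $(c,L)$, $S$, $S'$ respectively. Let $\mathfrak g_{0,\pm2}\subset\mathfrak{csp}_{0,\pm2}$ be the spans of the $S^{0,\pm2}_\alpha(p)$, and let $\mathfrak g_{0,0}\subset\mathfrak{csp}_{0,0}$ be the subalgebra preserving $\mathfrak g_{0,2}$ and $\mathfrak g_{0,-2}$. Let $\sigma_{\tilde\phi}$ be the antilinear involution of $\mathfrak{csp}$ induced by complex conjugation through $\tilde\phi(p)$. **Modified symbol.** With $\tau(x)=(\pi_*\circ\tilde\phi(x)^{-1})^{-1}$ for $x$ in the fibre of $\pi$ through $p$, let $\iota_{\tilde\phi}(v)\in\mathfrak{csp}$ be the derivative at $p$ of $x\mapsto\tau(p)\tau(x)^{-1}$ along $v\in\mathcal K_2(p)\oplus\overline{\mathcal K_2}(p)$. The modified symbol at $p$ along $\tilde\phi$ is $\mathbb C\mathfrak g_-\oplus(\mathfrak g_{0,+}+\mathfrak g_{0,-}+\mathfrak g_{0,0})$ with $\mathfrak g_{0,+}=\iota_{\tilde\phi}(\mathcal K_2(p))$ and $\mathfrak g_{0,-}=\sigma_{\tilde\phi}(\mathfrak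 g_{0,+})$. Let $\Omega_\alpha$ be the component $L$ of $\iota_{\tilde\phi}(e_\alpha)$. A modified symbol is *given by the matrices* $(A,\Xi_\alpha,\Omega_\alpha)$ if it is the space of the above form in which $\mathfrak g_{0,+}$ is replaced by the span of the $\begin{pmatrix}\Omega_\alpha&\Xi_\alpha A^{-1}\\0&-\Omega_\alpha^T\end{pmatrix}$ and $\mathfrak g_{0,-}$ by its image under $\sigma$. **Normalization.** For a local section $\tilde\phi'$ of $\mathcal F$ with $\tilde\phi'(p)=\tilde\phi(p)$ let $O_{0,\pm2}(\tilde\phi'):\mathcal K_2(p)\otimes\mathfrak g_{0,\pm2}\to\mathfrak{csp}_{0,\pm2}/\mathfrak g_{0,\pm2}$ be the bilinear maps $(X,S^{0,\pm2}_e(p))\mapsto X(S^{0,\pm2}_e(\tilde\phi'))(p)$, $e$ a section of $\mathcal K_2$. Fix a normalization condition, i.e. a pair $(O^N_{0,-2},O^N_{0,2})$ in the set of all pairs $(O_{0,-2}(\tilde\phi'),O_{0,2}(\tilde\phi'))$; those $\tilde\phi'$ that attain this pair are called normalized sections extending $\tilde\phi(p)$. **Theorem.** For $\alpha=1,\dots,r$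 one has $\iota_{\tilde\phi}(e_\alpha)=\begin{pmatrix}\Omega_\alpha&\Xi_\alpha A^{-1}\\0&-\Omega_\alpha^T\end{pmatrix}$ at $p$ up to a multiple of the identity, and the modified symbol along $\tilde\phi$ at $p$ is given by $(A,\Xi_\alpha,\Omega_\alpha)$. There are unique classes $B_1,\dots,B_r\in\mathfrak{csp}_{0,0}/\mathfrak g_{0,0}$ such that for all $\alpha,\beta$ $$e_\alpha(S^{0,\pm2}_\beta(\tilde\phi))(p)-[B_\alpha,S^{0,\pm2}_\beta(p)]=O^N_{0,\pm2}(e_\alpha,S^{0,\pm2}_\beta(p))\quad\text{in }\mathfrak{csp}_{0,\pm2}/\mathfrak g_{0,\pm2}.$$ For every normalized section $\tilde\phi'$ extending $\tilde\phi(p)$, $\iota_{\tilde\phi'}(e_\alpha)\equiv\begin{pmatrix}\Omega_\alpha+L_\alpha&\Xi_\alpha A^{-1}\\0&-(\Omega_\alpha+L_\alpha)^T\end{pmatrix}\pmod{\mathfrak g_{0,0}}$, and the modified symbol along $\tilde\phi'$ at $p$ is given by the matrices $(A,\Xi_\alpha,\Omega_\alpha+L_\alpha)$, where $L_\alpha$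 is the component $L$ of any representative of $B_\alpha$. In particular it does not depend on the normalized section extending $\tilde\phi(p)$. Moreover, there are normalized sections $\tilde\phi'$ extending $\tilde\phi(p)$ for which $A(\tilde\phi')$ is constant to first order at $p$ along the leaf, and for each of these the modified symbol equals $\mathbb C\mathfrak g_-\oplus(\iota_{\tilde\phi'}(\mathcal K_2(p)\oplus\overline{\mathcal K_2}(p))+\mathfrak g_{0,0})$. -/

import Mathlib

open scoped Manifold ContDiff TensorProduct Topology
open Matrix

noncomputable section

namespace CRSymbol

/-! ### Complexified vectors -/

section Complexification

variable {V : Type*} [AddCommGroup V] [Module ℝ V]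

/-- Real part of a complexified vector. -/
def re : ℂ ⊗[ℝ] V →ₗ[ℝ] V := (TensorProduct.lid ℝ V).toLinearMap ∘ₗ Complex.reLm.rTensor V

/-- Imaginary part of a complexified vector. -/
def im : ℂ ⊗[ℝ] V →ₗ[ℝ] V := (TensorProduct.lid ℝ V).toLinearMap ∘ₗ Complex.imLm.rTensor V

/-- The complexified vector `a + i b`. -/
def ofReIm (a b : V) : ℂ ⊗[ℝ] V := (1 : ℂ) ⊗ₜ[ℝ] a + Complex.I ⊗ₜ[ℝ] b

/-- Complex conjugation of complexified vectors. -/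
def conj : ℂ ⊗[ℝ] V →ₗ[ℝ] ℂ ⊗[ℝ] V := Complex.conjAe.toLinearMap.rTensor V

theorem conj_smul (c : ℂ) (v : ℂ ⊗[ℝ] V) : conj (c • v) = (starRingEnd ℂ) c • conj v := by
  induction v using TensorProduct.induction_on with
  | zero => simp
  | tmul a w => simp [conj, TensorProduct.smul_tmul']
  | add a b ha hb => rw [smul_add, map_add, ha, hb, map_add, smul_add]

/-- The complex conjugate of a complex subspace (`conj` is an involution). -/
def conjSub (W : Submodule ℂ (ℂ ⊗[ℝ] V)) : Submodule ℂ (ℂ ⊗[ℝ] V) where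
  carrier := {v | conj v ∈ W}
  add_mem' := fun {a b} ha hb => by
    change conj (a + b) ∈ W
    rw [map_add]
    exact W.add_mem ha hb
  zero_mem' := by
    change conj 0 ∈ W
    rw [map_zero]
    exact W.zero_mem
  smul_mem' := fun c v hv => by
    change conj (c • v) ∈ W
    rw [conj_smul]
    exact W.smul_mem _ hv

end Complexification

/-- The coefficients `c` with `w ≡ ∑ i, c i • b i` modulo `W`; they are uniquely determined whenever
`b` is linearly independent modulo `W` and `w` lies in `span b + W`, the only case that is used. -/
def coords {ι X : Type*} [Fintype ι] [AddCommGroup X] [Module ℂ X] (b : ι → X)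
    (W : Submodule ℂ X) (w : X) : ι → ℂ :=
  Classical.epsilon fun c : ι → ℂ => w - ∑ i, c i • b i ∈ W

/-- `q` is the class of `X` in `C / G`. -/
def IsClassOf {X : Type*} [AddCommGroup X] [Module ℂ X] {C G : Submodule ℂ X}
    (q : C ⧸ G.submoduleOf C) (x : X) : Prop :=
  ∃ h : x ∈ C, (Submodule.Quotient.mk ⟨x, h⟩ : C ⧸ G.submoduleOf C) = q

/-! ### Complex vector fields on a manifold -/

section Fields

variable {E : Type*} [NormedAddCommGroup E] [NormedSpace ℝ E]
  {M : Type*} [TopologicalSpace M] [ChartedSpace E M] [IsManifold 𝓘(ℝ, E) ∞ M]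

variable (E) in
/-- The complexified tangent space. -/
abbrev CTangent (x : M) : Type _ := ℂ ⊗[ℝ] (TangentSpace 𝓘(ℝ, E) x)

variable (E M) in
/-- (Not necessarily smooth) complex vector fields. -/
abbrev CField : Type _ := (x : M) → CTangent E x

/-- A complex vector field is smooth at `x` if its real and imaginary parts are. -/
def SmoothFieldAt (X : CField E M) (x : M) : Prop :=
  ContMDiffAt 𝓘(ℝ, E) 𝓘(ℝ, E).tangent ∞
    (fun y => (⟨y, re (X y)⟩ : TangentBundle 𝓘(ℝ, E) M)) x ∧
  ContMDiffAt 𝓘(ℝ, E) 𝓘(ℝ, E).tangent ∞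
    (fun y => (⟨y, im (X y)⟩ : TangentBundle 𝓘(ℝ, E) M)) x

/-- The conjugate vector field. -/
def conjField (X : CField E M) : CField E M := fun x => conj (X x)

/-- The complex-bilinear extension of the Lie bracket of vector fields. -/
def bracket (X Y : CField E M) : CField E M := fun x =>
  ofReIm
    (VectorField.mlieBracket 𝓘(ℝ, E) (fun y => re (X y)) (fun y => re (Y y)) x
      - VectorField.mlieBracket 𝓘(ℝ, E) (fun y => im (X y)) (fun y => im (Y y)) x)
    (VectorField.mlieBracket 𝓘(ℝ, E) (fun y => re (X y)) (fun y => im (Y y)) x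
      + VectorField.mlieBracket 𝓘(ℝ, E) (fun y => im (X y)) (fun y => re (Y y)) x)

/-- The derivative at `p` of a function with values in a fixed real vector space along a real
tangent vector. -/
def realDeriv {F : Type*} [NormedAddCommGroup F] [NormedSpace ℝ F] (p : M)
    (v : TangentSpace 𝓘(ℝ, E) p) (u : M → F) : F :=
  mfderiv 𝓘(ℝ, E) 𝓘(ℝ, F) u p v

/-- The derivative `v(u)` at `p` of a complex function along a complex tangent vector. -/
def deriv (p : M) (v : CTangent E p) (u : M → ℂ) : ℂ :=
  realDeriv p (re v) u + Complex.I * realDeriv p (im v) u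

/-- The entrywise derivative `v(Z)` at `p` of a matrix-valued function. -/
def derivMatrix {ι : Type*} (p : M) (v : CTangent E p) (Z : M → Matrix ι ι ℂ) : Matrix ι ι ℂ :=
  Matrix.of fun i j => deriv p v fun x => Z x i j

/-- The derivative `v(u)` at `p` of a function with values in the complexification of a fixed
real vector space. -/
def derivVec {F : Type*} [NormedAddCommGroup F] [NormedSpace ℝ F] (p : M) (v : CTangent E p)
    (u : M → ℂ ⊗[ℝ] F) : ℂ ⊗[ℝ] F :=
  ofReIm
    (realDeriv p (re v) (fun x => re (u x)) - realDeriv p (im v) fun x => im (u x))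
    (realDeriv p (re v) (fun x => im (u x)) + realDeriv p (im v) fun x => re (u x))

variable (E M) in
/-- Families of subspaces of the complexified tangent spaces. -/
abbrev Distribution : Type _ := (x : M) → Submodule ℂ (CTangent E x)

/-- `X` is a smooth section of `D` on a neighbourhood of `x`. -/
def IsLocalSection (D : Distribution E M) (X : CField E M) (x : M) : Prop :=
  ∀ᶠ y in 𝓝 x, SmoothFieldAt X y ∧ X y ∈ D y

/-! ### CR hypersurfaces and the Freeman filtration -/

/-- `H` is a CR structure of hypersurface type on the `(2n+1)`-dimensional manifold `M`: a smooth
complex rank `n` subbundle of the complexified tangent bundle, involutive, with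
`H ∩ conj H = 0`. -/
structure IsCRHypersurface (n : ℕ) (H : Distribution E M) : Prop where
  dim : Module.finrank ℝ E = 2 * n + 1
  subbundle : ∀ x, ∃ X : Fin n → CField E M, ∀ᶠ y in 𝓝 x,
    (∀ i, SmoothFieldAt (X i) y) ∧ LinearIndependent ℂ (fun i => X i y) ∧
      Submodule.span ℂ (Set.range fun i => X i y) = H y
  disjoint : ∀ x, H x ⊓ conjSub (H x) = ⊥
  involutive : ∀ (x : M) (X Y : CField E M), IsLocalSection H X x → IsLocalSection H Y x →
    bracket X Y x ∈ H x

/-- `[…[[X, conj Y₁], conj Y₂], …, conj Yⱼ]`. -/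
def iterBracket (X : CField E M) (Y : List (CField E M)) : CField E M :=
  Y.foldl (fun Z W => bracket Z (conjField W)) X

/-- The Freeman filtration `K₀ = ℂTM ⊇ K₁ = H ⊇ K₂ ⊇ …`; `K₂` is the Levi kernel. For `j ≥ 1` the
space `Kⱼ₊₁` consists of the values of those sections `X` of `Kⱼ` for which the iterated bracket
with any `j` conjugated sections of `H` lies in `H ⊕ conj H` at the given point. (Where `Kⱼ` is a
subbundle this is a tensorial condition on the value of `X`, so these values already form a linear
subspace, and `span` only makes this part of the definition.) -/
def freeman (H : Distribution E M) : ℕ → Distribution E M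
  | 0 => fun _ => ⊤
  | 1 => H
  | j + 2 => fun x => Submodule.span ℂ
      {v | ∃ X : CField E M, IsLocalSection (freeman H (j + 1)) X x ∧ X x = v ∧
        ∀ Y : List (CField E M), Y.length = j + 1 → (∀ W ∈ Y, IsLocalSection H W x) →
          iterBracket X Y x ∈ H x ⊔ conjSub (H x)}

/-- Uniform `k`-nondegeneracy: all `Kⱼ` have constant rank and `K_k ≠ K_{k+1} = 0`. -/
structure IsUniformlyNondegenerate (H : Distribution E M) (k : ℕ) : Prop where
  constRank : ∀ j, ∃ d, ∀ x, Module.finrank ℂ (freeman H j x) = d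
  ne : ∀ x, freeman H k x ≠ freeman H (k + 1) x
  eq_bot : ∀ x, freeman H (k + 1) x = ⊥

/-! ### Sections of the bundle of graded frames -/

variable (E M) in
/-- The fields `(g, f₁, …, f_s)`. At each point `x` where they are adapted (`IsGradedFrameAt`) their
classes modulo `H ⊕ conj H` and modulo `K₂` are bases of `𝔤_{-2,0}(x)` and `𝔤_{-1,1}(x)`, which is
the same as a bigraded Lie algebra isomorphism from the nondegenerate part of the bigraded symbol
at `x` onto the Heisenberg algebra `ℂ ⊕ ℂˢ ⊕ ℂˢ`, i.e. a point `φ̃(x)` of the bundle `𝓕`. -/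
structure GradedFrame (s : ℕ) where
  g : CField E M
  f : Fin s → CField E M

variable {s : ℕ}

/-- `(g, f₁, …, f_s)` is adapted at `x`. -/
structure IsGradedFrameAt (H : Distribution E M) (φ : GradedFrame E M s) (x : M) : Prop where
  g_notMem : φ.g x ∉ H x ⊔ conjSub (H x)
  g_span : Submodule.span ℂ {φ.g x} ⊔ (H x ⊔ conjSub (H x)) = ⊤
  f_indep : LinearIndependent ℂ fun j => (freeman H 2 x).mkQ (φ.f j x)
  f_span : Submodule.span ℂ (Set.range fun j => φ.f j x) ⊔ freeman H 2 x = H x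

/-- A local smooth section of `𝓕` around `p`. Sections over the leaf of the Levi foliation through
`p` are the restrictions to this leaf of sections over a neighbourhood of `p` in `M`, and all
notions below depend on the restriction to the leaf only. -/
def IsSectionNear (H : Distribution E M) (p : M) (φ : GradedFrame E M s) : Prop :=
  ∀ᶠ x in 𝓝 p, SmoothFieldAt φ.g x ∧ (∀ j, SmoothFieldAt (φ.f j) x) ∧ IsGradedFrameAt H φ x

/-- `e` is a local smooth frame of `K₂` around `p`. Together with a section `(g, f)` of `𝓕` this is
a local adapted frame `(g, f, conj f, e, conj e)` of `ℂTM`. -/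
def IsKernelFrameNear {r : ℕ} (H : Distribution E M) (p : M) (e : Fin r → CField E M) : Prop :=
  ∀ᶠ x in 𝓝 p, (∀ α, SmoothFieldAt (e α) x) ∧ LinearIndependent ℂ (fun α => e α x) ∧
    Submodule.span ℂ (Set.range fun α => e α x) = freeman H 2 x

/-- Two sections have the same value in `𝓕` at `p`. -/
def SameValueAt (H : Distribution E M) (p : M) (φ φ' : GradedFrame E M s) : Prop :=
  φ'.g p - φ.g p ∈ H p ⊔ conjSub (H p) ∧ ∀ j, φ'.f j p - φ.f j p ∈ freeman H 2 p

/-- The matrix `A = e^{ih} H` of the Levi form `(X, Y) ↦ (1/2i) [X, conj Y]` in the frame: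
`(1/2i) [f_j, conj f_k] ≡ A_{jk} g` modulo `H ⊕ conj H`. -/
def leviMatrix (H : Distribution E M) (φ : GradedFrame E M s) (x : M) :
    Matrix (Fin s) (Fin s) ℂ :=
  Matrix.of fun j k => coords (fun _ : Unit => φ.g x) (H x ⊔ conjSub (H x))
    ((1 / (2 * Complex.I)) • bracket (φ.f j) (conjField (φ.f k)) x) ()

/-- The matrix `Ξ` of `ι(e)` for a section `e` of `K₂`:
`[e, conj f_k] ≡ ∑ l, Ξ_{lk} f_l` modulo `K₂ ⊕ conj H`. -/
def xiMatrix (H : Distribution E M) (φ : GradedFrame E M s) (e : CField E M) (x : M) :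
    Matrix (Fin s) (Fin s) ℂ :=
  Matrix.of fun l k => coords (fun i => φ.f i x) (freeman H 2 x ⊔ conjSub (H x))
    (bracket e (conjField (φ.f k)) x) l

/-- The vectors `h₁, …, h_s` of `conj H` which, together with `g, f₁, …, f_s`, form the basis that
`φ̃` maps to the standard basis of the Heisenberg algebra; `conj f_j ≡ ∑ k, A_{kj} h_k`. -/
def hField (H : Distribution E M) (φ : GradedFrame E M s) (k : Fin s) : CField E M :=
  fun x => ∑ j, (leviMatrix H φ x)⁻¹ j k • conj (φ.f j x)

/-- The basis `(f₁, …, f_s, h₁, …, h_s)` of the part of degree `-1`. -/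
def degOneFrame (H : Distribution E M) (φ : GradedFrame E M s) : Fin s ⊕ Fin s → CField E M :=
  Sum.elim φ.f (hField H φ)

end Fields

/-! ### The Lie algebra `csp` of degree zero derivations

The elements of `csp` are represented by their action on `ℂ𝔤_{-1} = 𝔤_{-1,1} ⊕ 𝔤_{-1,-1} = ℂˢ ⊕ ℂˢ`.
The element with parameters `c, L, S^{0,2}, S^{0,-2}` acts as the block matrix
`[[L - c, S^{0,2}], [S^{0,-2}, -Lᵀ - c]]`. -/

section Algebra

variable {s : ℕ}

/-- Endomorphisms of `ℂ𝔤_{-1}`. -/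
abbrev End1 (s : ℕ) : Type := Matrix (Fin s ⊕ Fin s) (Fin s ⊕ Fin s) ℂ

/-- The Heisenberg algebra `ℂ𝔤_- = 𝔤_{-2,0} ⊕ 𝔤_{-1,1} ⊕ 𝔤_{-1,-1}` as a vector space. -/
abbrev Heis (s : ℕ) : Type := ℂ × (Fin s → ℂ) × (Fin s → ℂ)

/-- The element of `csp_{0,0}` with parameters `c` (conformal scaling) and `L`. -/
def diagElt (c : ℂ) (L : Matrix (Fin s) (Fin s) ℂ) : End1 s :=
  Matrix.fromBlocks (L - c • 1) 0 0 (-Lᵀ - c • 1)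

/-- The element of `csp_{0,2}` with parameter `S`. -/
def upElt (S : Matrix (Fin s) (Fin s) ℂ) : End1 s := Matrix.fromBlocks 0 S 0 0

/-- The element of `csp_{0,-2}` with parameter `S`. -/
def downElt (S : Matrix (Fin s) (Fin s) ℂ) : End1 s := Matrix.fromBlocks 0 0 S 0

variable (s) in
/-- `csp_{0,0}`. -/
def csp00 : Submodule ℂ (End1 s) where
  carrier := {Z | ∃ c L, Z = diagElt c L}
  add_mem' := by
    rintro _ _ ⟨c, L, rfl⟩ ⟨c', L', rfl⟩
    refine ⟨c + c', L + L', ?_⟩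
    rw [diagElt, diagElt, diagElt, Matrix.fromBlocks_add]
    congr 1
    · rw [add_smul]; abel
    · simp
    · simp
    · rw [add_smul, Matrix.transpose_add]; abel
  zero_mem' := ⟨0, 0, by simp [diagElt]⟩
  smul_mem' := by
    rintro a _ ⟨c, L, rfl⟩
    refine ⟨a * c, a • L, ?_⟩
    rw [diagElt, diagElt, Matrix.fromBlocks_smul]
    congr 1
    · rw [smul_sub, mul_smul]
    · simp
    · simp
    · rw [smul_sub, mul_smul, Matrix.transpose_smul, smul_neg]

variable (s) in
/-- `csp_{0,2}`. -/
def csp02 : Submodule ℂ (End1 s) where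
  carrier := {Z | ∃ S : Matrix (Fin s) (Fin s) ℂ, S.IsSymm ∧ Z = upElt S}
  add_mem' := by
    rintro _ _ ⟨S, hS, rfl⟩ ⟨S', hS', rfl⟩
    exact ⟨S + S', hS.add hS', by simp [upElt, Matrix.fromBlocks_add]⟩
  zero_mem' := ⟨0, Matrix.isSymm_zero, by simp [upElt]⟩
  smul_mem' := by
    rintro a _ ⟨S, hS, rfl⟩
    exact ⟨a • S, hS.smul a, by simp [upElt, Matrix.fromBlocks_smul]⟩

variable (s) in
/-- `csp_{0,-2}`. -/
def csp0m2 : Submodule ℂ (End1 s) where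
  carrier := {Z | ∃ S : Matrix (Fin s) (Fin s) ℂ, S.IsSymm ∧ Z = downElt S}
  add_mem' := by
    rintro _ _ ⟨S, hS, rfl⟩ ⟨S', hS', rfl⟩
    exact ⟨S + S', hS.add hS', by simp [downElt, Matrix.fromBlocks_add]⟩
  zero_mem' := ⟨0, Matrix.isSymm_zero, by simp [downElt]⟩
  smul_mem' := by
    rintro a _ ⟨S, hS, rfl⟩
    exact ⟨a • S, hS.smul a, by simp [downElt, Matrix.fromBlocks_smul]⟩

/-- The subspace of those elements of `csp_{0,0}` which preserve, by the bracket, both `P` and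
`Q`. -/
def stabilizer (P Q : Submodule ℂ (End1 s)) : Submodule ℂ (End1 s) where
  carrier := {Z | Z ∈ csp00 s ∧ (∀ W ∈ P, ⁅Z, W⁆ ∈ P) ∧ ∀ W ∈ Q, ⁅Z, W⁆ ∈ Q}
  add_mem' := by
    rintro a b ⟨ha, ha1, ha2⟩ ⟨hb, hb1, hb2⟩
    have key : ∀ W : End1 s, ⁅a + b, W⁆ = ⁅a, W⁆ + ⁅b, W⁆ := fun W => by
      simp only [Ring.lie_def]; noncomm_ring
    exact ⟨(csp00 s).add_mem ha hb,
      fun W hW => by rw [key]; exact P.add_mem (ha1 W hW) (hb1 W hW),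
      fun W hW => by rw [key]; exact Q.add_mem (ha2 W hW) (hb2 W hW)⟩
  zero_mem' := by
    have key : ∀ W : End1 s, ⁅(0 : End1 s), W⁆ = 0 := fun W => by simp [Ring.lie_def]
    exact ⟨(csp00 s).zero_mem, fun W _ => by rw [key]; exact P.zero_mem,
      fun W _ => by rw [key]; exact Q.zero_mem⟩
  smul_mem' := by
    rintro c a ⟨ha, ha1, ha2⟩
    have key : ∀ W : End1 s, ⁅c • a, W⁆ = c • ⁅a, W⁆ := fun W => by
      simp only [Ring.lie_def, smul_mul_assoc, mul_smul_comm, smul_sub]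
    exact ⟨(csp00 s).smul_mem c ha,
      fun W hW => by rw [key]; exact P.smul_mem c (ha1 W hW),
      fun W hW => by rw [key]; exact Q.smul_mem c (ha2 W hW)⟩

/-- `S^{0,2} = e^{-ih} Ξ H⁻¹ = Ξ A⁻¹`, where `A = e^{ih} H`. -/
def sUp (A Ξ : Matrix (Fin s) (Fin s) ℂ) : Matrix (Fin s) (Fin s) ℂ := Ξ * A⁻¹

/-- `S^{0,-2} = e^{ih} H conj(Ξ) = A conj(Ξ)`. -/
def sDown (A Ξ : Matrix (Fin s) (Fin s) ℂ) : Matrix (Fin s) (Fin s) ℂ :=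
  A * Ξ.map (starRingEnd ℂ)

/-- The element `[[Ω, S^{0,2}], [0, -Ωᵀ]]` of `csp` determined by `A = e^{ih} H`, `Ξ` and `Ω`. -/
def modElt (A Ξ Ω : Matrix (Fin s) (Fin s) ℂ) : End1 s :=
  Matrix.fromBlocks Ω (sUp A Ξ) 0 (-Ωᵀ)

/-- The matrix `C` such that complex conjugation is `v ↦ C conj(v)` in the basis `(f, h)`, i.e.
`(v₁, v₂) ↦ (conj(A)⁻¹ conj(v₂), A conj(v₁))`. -/
def conjMatrix (A : Matrix (Fin s) (Fin s) ℂ) : End1 s :=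
  Matrix.fromBlocks 0 (A.map (starRingEnd ℂ))⁻¹ A 0

/-- The antilinear involution `σ` induced on `csp`: `Z ↦ σ ∘ Z ∘ σ`, as a matrix
`C conj(Z) conj(C)`. -/
def sigma (A : Matrix (Fin s) (Fin s) ℂ) (Z : End1 s) : End1 s :=
  conjMatrix A * Z.map (starRingEnd ℂ) * (conjMatrix A).map (starRingEnd ℂ)

/-- The modified symbol given by the matrices `(A, Ξ₁, …, Ξ_r, Ω₁, …, Ω_r)`, where `A = e^{ih} H`:
the graded subspace `ℂ𝔤_- ⊕ (𝔤_{0,+} + 𝔤_{0,-} + 𝔤_{0,0})` with `𝔤_{0,+}` spanned by the elements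
`[[Ω_α, S^{0,2}_α], [0, -Ω_αᵀ]]`, with `𝔤_{0,-} = σ(𝔤_{0,+})`, and with `𝔤_{0,0}` the subspace of
`csp_{0,0}` preserving the spans of the `S^{0,2}_α` and of the `S^{0,-2}_α`. -/
def symbolOfMatrices {r : ℕ} (A : Matrix (Fin s) (Fin s) ℂ)
    (Ξ Ω : Fin r → Matrix (Fin s) (Fin s) ℂ) : Submodule ℂ (Heis s × End1 s) :=
  (⊤ : Submodule ℂ (Heis s)).prod
    (Submodule.span ℂ (Set.range fun α => modElt A (Ξ α) (Ω α)) ⊔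
      Submodule.span ℂ (Set.range fun α => sigma A (modElt A (Ξ α) (Ω α))) ⊔
      stabilizer (Submodule.span ℂ (Set.range fun α => upElt (sUp A (Ξ α))))
        (Submodule.span ℂ (Set.range fun α => downElt (sDown A (Ξ α)))))

end Algebra

/-! ### Bigraded symbols in a frame -/

section Symbols

variable {E : Type*} [NormedAddCommGroup E] [NormedSpace ℝ E]
  {M : Type*} [TopologicalSpace M] [ChartedSpace E M] [IsManifold 𝓘(ℝ, E) ∞ M] {s : ℕ}

/-- The function `S^{0,2}_e(φ̃)`, with values in `csp_{0,2}`, for a section `e` of `K₂`. -/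
def upField (H : Distribution E M) (φ : GradedFrame E M s) (e : CField E M) (x : M) : End1 s :=
  upElt (sUp (leviMatrix H φ x) (xiMatrix H φ e x))

/-- The function `S^{0,-2}_e(φ̃)`, with values in `csp_{0,-2}`, for a section `e` of `K₂`. -/
def downField (H : Distribution E M) (φ : GradedFrame E M s) (e : CField E M) (x : M) : End1 s :=
  downElt (sDown (leviMatrix H φ x) (xiMatrix H φ e x))

/-- `φ̃(𝔤_{0,2}(p))`. -/
def g02 (H : Distribution E M) (φ : GradedFrame E M s) (p : M) : Submodule ℂ (End1 s) :=
  Submodule.span ℂ {Z | ∃ e, IsLocalSection (freeman H 2) e p ∧ upField H φ e p = Z}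

/-- `φ̃(𝔤_{0,-2}(p))`. -/
def g0m2 (H : Distribution E M) (φ : GradedFrame E M s) (p : M) : Submodule ℂ (End1 s) :=
  Submodule.span ℂ {Z | ∃ e, IsLocalSection (freeman H 2) e p ∧ downField H φ e p = Z}

/-- `𝔤_{0,0}(φ̃; p) = φ̃(𝔤_{0,0}(p))`. -/
def g00 (H : Distribution E M) (φ : GradedFrame E M s) (p : M) : Submodule ℂ (End1 s) :=
  stabilizer (g02 H φ p) (g0m2 H φ p)

/-- `S^{0,2}_e(φ̃(p))` as an element of `φ̃(𝔤_{0,2}(p))`. -/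
def upAt (H : Distribution E M) (φ : GradedFrame E M s) (p : M) (e : CField E M)
    (he : IsLocalSection (freeman H 2) e p) : g02 H φ p :=
  ⟨upField H φ e p, Submodule.subset_span ⟨e, he, rfl⟩⟩

/-- `S^{0,-2}_e(φ̃(p))` as an element of `φ̃(𝔤_{0,-2}(p))`. -/
def downAt (H : Distribution E M) (φ : GradedFrame E M s) (p : M) (e : CField E M)
    (he : IsLocalSection (freeman H 2) e p) : g0m2 H φ p :=
  ⟨downField H φ e p, Submodule.subset_span ⟨e, he, rfl⟩⟩

/-- The bilinear maps `K₂(p) ⊗ φ̃(𝔤_{0,2}(p)) → csp_{0,2} / φ̃(𝔤_{0,2}(p))`. -/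
abbrev UpMap (H : Distribution E M) (φ : GradedFrame E M s) (p : M) : Type _ :=
  freeman H 2 p →ₗ[ℂ] g02 H φ p →ₗ[ℂ] (csp02 s ⧸ (g02 H φ p).submoduleOf (csp02 s))

/-- The bilinear maps `K₂(p) ⊗ φ̃(𝔤_{0,-2}(p)) → csp_{0,-2} / φ̃(𝔤_{0,-2}(p))`. -/
abbrev DownMap (H : Distribution E M) (φ : GradedFrame E M s) (p : M) : Type _ :=
  freeman H 2 p →ₗ[ℂ] g0m2 H φ p →ₗ[ℂ] (csp0m2 s ⧸ (g0m2 H φ p).submoduleOf (csp0m2 s))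

/-- `φ'` is a local section of `𝓕` around `p` which extends `φ̃(p)`, and
`(O_{0,-2}(φ')(p), O_{0,2}(φ')(p)) = (Nm, Np)`, that is, `Nm (X, S^{0,-2}_e)` and `Np (X, S^{0,2}_e)`
are the classes of `X(S^{0,-2}_e(φ'))(p)` and `X(S^{0,2}_e(φ'))(p)`. For fixed `(Nm, Np)` this says
that `φ'` is a section extending `φ̃(p)` which is normalized with respect to `(Nm, Np)`. -/
structure IsNormalized (H : Distribution E M) (φ : GradedFrame E M s) (p : M)
    (Nm : DownMap H φ p) (Np : UpMap H φ p) (φ' : GradedFrame E M s) : Prop where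
  isSection : IsSectionNear H p φ'
  sameValue : SameValueAt H p φ φ'
  down : ∀ (X : freeman H 2 p) (e : CField E M) (he : IsLocalSection (freeman H 2) e p),
    IsClassOf (Nm X (downAt H φ p e he)) (derivMatrix p X.1 (downField H φ' e))
  up : ∀ (X : freeman H 2 p) (e : CField E M) (he : IsLocalSection (freeman H 2) e p),
    IsClassOf (Np X (upAt H φ p e he)) (derivMatrix p X.1 (upField H φ' e))

/-- `(Nm, Np)` is a possible normalization condition at `φ̃(p)`: a member of the class of all pairs
`(O_{0,-2}(φ')(p), O_{0,2}(φ')(p))` for local sections `φ'` extending `φ̃(p)`. -/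
def IsNormalization (H : Distribution E M) (φ : GradedFrame E M s) (p : M)
    (Nm : DownMap H φ p) (Np : UpMap H φ p) : Prop :=
  ∃ φ' : GradedFrame E M s, IsNormalized H φ p Nm Np φ'

/-- The equations `e_α(S^{0,∓2}_β(φ̃))(p) - [B_α, S^{0,∓2}_β(φ̃(p))] = N_{∓}(e_α, S^{0,∓2}_β(φ̃(p)))`
for classes `B_α` in `csp_{0,0} / 𝔤_{0,0}(φ̃; p)`. -/
def NormalizationEquations {r : ℕ} (H : Distribution E M) (φ : GradedFrame E M s) (p : M)
    (Nm : DownMap H φ p) (Np : UpMap H φ p) (e : Fin r → CField E M)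
    (B : Fin r → (csp00 s ⧸ (g00 H φ p).submoduleOf (csp00 s))) : Prop :=
  ∀ (b : Fin r → End1 s), (∀ α, IsClassOf (B α) (b α)) →
  ∀ (α β : Fin r) (hα : e α p ∈ freeman H 2 p) (hβ : IsLocalSection (freeman H 2) (e β) p),
    IsClassOf (Nm ⟨e α p, hα⟩ (downAt H φ p (e β) hβ))
      (derivMatrix p (e α p) (downField H φ (e β)) - ⁅b α, downField H φ (e β) p⁆) ∧
    IsClassOf (Np ⟨e α p, hα⟩ (upAt H φ p (e β) hβ))
      (derivMatrix p (e α p) (upField H φ (e β)) - ⁅b α, upField H φ (e β) p⁆)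

/-! ### The leaf space and modified symbols -/

variable {F : Type*} [NormedAddCommGroup F] [NormedSpace ℝ F]
  {N : Type*} [TopologicalSpace N] [ChartedSpace F N]

variable (F) in
/-- `π : M → N` is a smooth submersion whose fibres are tangent to `TM ∩ (K₂ ⊕ conj K₂)`: near each
point, `N` is the space of leaves of the Levi foliation. -/
structure IsLeafSpace (H : Distribution E M) (π : M → N) : Prop where
  smooth : ContMDiff 𝓘(ℝ, E) 𝓘(ℝ, F) ∞ π
  submersion : ∀ x, Function.Surjective (mfderiv 𝓘(ℝ, E) 𝓘(ℝ, F) π x)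
  kernel : ∀ (x : M) (v : TangentSpace 𝓘(ℝ, E) x), mfderiv 𝓘(ℝ, E) 𝓘(ℝ, F) π x v = 0 ↔
    ofReIm v 0 ∈ freeman H 2 x ⊔ conjSub (freeman H 2 x)

variable (F) in
/-- The complexified differential of `π` at `x`, where the tangent spaces of `N` near `π p` are
identified with `F` by the chart of `N` at `π p`. On the fibre of `π` through `p` this is the
differential `π_*` with values in the fixed tangent space of `N` at `π p`. -/
def push (π : M → N) (p x : M) (w : CTangent E x) : ℂ ⊗[ℝ] F :=
  ofReIm (realDeriv x (re w) fun y => extChartAt 𝓘(ℝ, F) (π p) (π y))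
    (realDeriv x (im w) fun y => extChartAt 𝓘(ℝ, F) (π p) (π y))

variable (F) in
/-- `ι_φ̃(v)` for `v` in `K₂(p) ⊕ conj K₂(p)`, as an endomorphism of `ℂ𝔤_{-1}`. With
`τ(x) = (π_* ∘ φ̃(x)⁻¹)⁻¹` for `x` in the fibre of `π` through `p`, the value of the (inverse of
the) fundamental vector field map on the derivative of `τ` along `v` is the derivative at `p` along
`v` of `x ↦ τ(p) ∘ τ(x)⁻¹`. Since `τ(x)⁻¹` maps the `k`-th standard basis vector to
`π_*(F_k(x))`, where `(F_k) = (f, h)`, and `τ(p)` gives the coordinates with respect to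
`π_*(F_j(p))`, column `k` of this endomorphism consists of the coordinates of
`v(π_* F_k)` with respect to the vectors `π_*(F_j(p))`. -/
def iotaLeaf (H : Distribution E M) (π : M → N) (φ : GradedFrame E M s) (p : M)
    (v : CTangent E p) : End1 s :=
  Matrix.of fun j k => coords (fun i => push F π p p (degOneFrame H φ i p)) ⊥
    (derivVec p v fun x => push F π p x (degOneFrame H φ k x)) j

variable (F) in
/-- The matrix `Ω_α(φ̃)(p)`: the component `L` of `ι_φ̃(v) = [[L - c, S], [S', -Lᵀ - c]]`. -/
def omegaMatrix (H : Distribution E M) (π : M → N) (φ : GradedFrame E M s) (p : M)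
    (v : CTangent E p) : Matrix (Fin s) (Fin s) ℂ :=
  (1 / 2 : ℂ) • ((iotaLeaf F H π φ p v).toBlocks₁₁ - (iotaLeaf F H π φ p v).toBlocks₂₂ᵀ)

variable (F) in
/-- The modified symbol at `p` along `φ̃`, with
`𝔤_{0,+} = ι_φ̃(K₂(p))`, `𝔤_{0,-} = σ_φ̃(𝔤_{0,+})` and `𝔤_{0,0} = φ̃(𝔤_{0,0}(p))`. -/
def modifiedSymbol (H : Distribution E M) (π : M → N) (φ : GradedFrame E M s) (p : M) :
    Submodule ℂ (Heis s × End1 s) :=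
  (⊤ : Submodule ℂ (Heis s)).prod
    (Submodule.span ℂ {Z | ∃ v ∈ freeman H 2 p, iotaLeaf F H π φ p v = Z} ⊔
      Submodule.span ℂ
        {Z | ∃ v ∈ freeman H 2 p, sigma (leviMatrix H φ p) (iotaLeaf F H π φ p v) = Z} ⊔
      g00 H φ p)

variable (F) in
/-- The space `ℂ𝔤_- ⊕ (ι_φ̃(K₂(p) ⊕ conj K₂(p)) + 𝔤_{0,0}(φ̃; p))`. -/
def leafSymbol (H : Distribution E M) (π : M → N) (φ : GradedFrame E M s) (p : M) :
    Submodule ℂ (Heis s × End1 s) :=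
  (⊤ : Submodule ℂ (Heis s)).prod
    (Submodule.span ℂ
        {Z | ∃ v ∈ freeman H 2 p ⊔ conjSub (freeman H 2 p), iotaLeaf F H π φ p v = Z} ⊔
      g00 H φ p)

/-- `e^{ih} H`, equivalently the involution `σ_φ̃`, is constant to first order at `p` along the
leaf. -/
def IsInvolutionConstAt (H : Distribution E M) (φ : GradedFrame E M s) (p : M) : Prop :=
  ∀ v ∈ freeman H 2 p ⊔ conjSub (freeman H 2 p), derivMatrix p v (leviMatrix H φ) = 0

end Symbols

end CRSymbol

end

noncomputable section

namespace CRSymbol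

open Filter

set_option linter.unusedSectionVars false

open Filter

/-! ### Real and imaginary parts of complexified vectors -/

section Complexification

variable {V : Type*} [AddCommGroup V] [Module ℝ V]

/-! The theorem compares two effects of a change of section with fixed value at `p`: it shifts `ι`
by an element of `csp_{0,0}`, and it shifts the derivatives of `S^{0,±2}` by the bracket with that
same element. Prescribing the second shift modulo `𝔤_{0,±2}` therefore determines the first modulo
`𝔤_{0,0}`, and the modified symbol sees `ι` only modulo `𝔤_{0,0}`.

Shape of `ι`. A section `X` of `K₂` is annihilated by `π_*`, so the derivative of `π_* Y` along `X`
is `π_* [X, Y]` (`IsLeafSpace.deriv_deriv`). Hence `ι(X)` is the matrix of `ad X` on `(H ⊕ conj H) /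
(K₂ ⊕ conj K₂)` in the frame `(f, h)`. By the Jacobi identity `ad X` is a derivation, up to scale,
of the symplectic form given by the bracket into the line of `g`. Involutivity of `H` kills the
lower left block, and the definition of `Ξ` gives `Ξ A⁻¹` in the upper right block
(`exists_ad_eq_modElt`). What remains is `L`, which is `Ω` by definition, and a multiple of the
identity, which lies in `𝔤_{0,0}`.

Change of section. Two sections with the same value at `p` differ by a pair `(u, U)` with `u(p) = 1`
and `U(p) = 1`. The frame `(f, h)` is multiplied, modulo the leaf directions, by `V = diag(U, W)`
with `Uᵀ W = u`. Write `Z_v` for the derivative of `V` along `v`; this is `gaugeElt`, an element of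
`csp_{0,0}`. Then `ι(v)` becomes `ι(v) + Z_v` (`IsGauge.isIota`). Moreover `U S' Uᵀ = u S` for
`S^{0,2}`, with a conjugate law for `S^{0,-2}`, so `v(S^{0,±2})` becomes `v(S^{0,±2}) - [Z_v,
S^{0,±2}]` (`IsGauge.deriv_up`, `IsGauge.deriv_down`). Thus the gauge leading to any normalized
section solves the equations for `B`. Two solutions differ by an element whose bracket preserves
both spans `𝔤_{0,±2}`, that is, by an element of `𝔤_{0,0}`. Since `A` is Hermitian up to a factor,
`𝔤_{0,0}` is stable under `σ`; so replacing `ι` by a representative modulo `𝔤_{0,0}` changes neither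
`𝔤_{0,+} + 𝔤_{0,0}` nor `𝔤_{0,-} + 𝔤_{0,0}`.

Constant involution. Normalization only tests derivatives along `K₂`, so the derivatives of `(u, U)`
along `conj K₂` are free. Those of `U` are used to kill the derivative of `A` along `K₂`, and those
of `u` then kill it along `conj K₂` (`exists_gauge_involutionConst`). When `A` is constant to first
order, differentiation of the frame commutes with conjugation. Hence `ι(conj v) = σ(ι(v))`, which
identifies the two descriptions of the symbol (`leafSymbol_eq`). -/

@[simp] theorem re_ofReIm (a b : V) : re (ofReIm a b) = a := by simp [re, ofReIm]

@[simp] theorem im_ofReIm (a b : V) : im (ofReIm a b) = b := by simp [im, ofReIm]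

theorem ofReIm_re_im (v : ℂ ⊗[ℝ] V) : ofReIm (re v) (im v) = v := by
  induction v using TensorProduct.induction_on with
  | zero => simp [ofReIm]
  | tmul a w =>
    simp only [ofReIm, re, im, LinearMap.comp_apply, LinearMap.rTensor_tmul,
      LinearEquiv.coe_coe, TensorProduct.lid_tmul, Complex.reLm_coe, Complex.imLm_coe]
    rw [← TensorProduct.smul_tmul, ← TensorProduct.smul_tmul, ← TensorProduct.add_tmul]
    congr 1
    apply Complex.ext <;> simp
  | add a b ha hb =>
    have h : ofReIm (re (a + b)) (im (a + b)) = ofReIm (re a) (im a) + ofReIm (re b) (im b) := by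
      simp only [ofReIm, map_add, TensorProduct.tmul_add]
      abel
    rw [h, ha, hb]

theorem reIm_ext {v w : ℂ ⊗[ℝ] V} (h₁ : re v = re w) (h₂ : im v = im w) : v = w := by
  rw [← ofReIm_re_im v, ← ofReIm_re_im w, h₁, h₂]

@[simp] theorem re_smul (c : ℂ) (v : ℂ ⊗[ℝ] V) : re (c • v) = c.re • re v - c.im • im v := by
  induction v using TensorProduct.induction_on with
  | zero => simp
  | tmul a w => simp [re, im, TensorProduct.smul_tmul', sub_smul, mul_smul]
  | add a b ha hb => rw [smul_add, map_add, ha, hb, map_add, map_add, smul_add, smul_add]; abel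

@[simp] theorem im_smul (c : ℂ) (v : ℂ ⊗[ℝ] V) : im (c • v) = c.re • im v + c.im • re v := by
  induction v using TensorProduct.induction_on with
  | zero => simp
  | tmul a w => simp [re, im, TensorProduct.smul_tmul', add_smul, mul_smul]
  | add a b ha hb => rw [smul_add, map_add, ha, hb, map_add, map_add, smul_add, smul_add]; abel

@[simp] theorem re_conj (v : ℂ ⊗[ℝ] V) : re (conj v) = re v := by
  induction v using TensorProduct.induction_on with
  | zero => simp
  | tmul a w => simp [re, conj]
  | add a b ha hb => rw [map_add, map_add, ha, hb, map_add]

@[simp] theorem im_conj (v : ℂ ⊗[ℝ] V) : im (conj v) = - im v := by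
  induction v using TensorProduct.induction_on with
  | zero => simp
  | tmul a w => simp [im, conj]
  | add a b ha hb => rw [map_add, map_add, ha, hb, map_add]; abel

@[simp] theorem conj_conj (v : ℂ ⊗[ℝ] V) : conj (conj v) = v := by
  apply reIm_ext <;> simp

theorem mem_conjSub {W : Submodule ℂ (ℂ ⊗[ℝ] V)} {v : ℂ ⊗[ℝ] V} :
    v ∈ conjSub W ↔ conj v ∈ W := Iff.rfl

theorem conj_mem_conjSub {W : Submodule ℂ (ℂ ⊗[ℝ] V)} {v : ℂ ⊗[ℝ] V} (h : v ∈ W) :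
    conj v ∈ conjSub W := by
  rw [mem_conjSub, conj_conj]; exact h

theorem conj_mem_sup {W : Submodule ℂ (ℂ ⊗[ℝ] V)} {v : ℂ ⊗[ℝ] V} (h : v ∈ W ⊔ conjSub W) :
    conj v ∈ W ⊔ conjSub W := by
  obtain ⟨a, ha, b, hb, rfl⟩ := Submodule.mem_sup.1 h
  rw [map_add, add_comm]
  exact Submodule.add_mem_sup hb (conj_mem_conjSub ha)

theorem conj_sum {ι : Type*} (t : Finset ι) (f : ι → ℂ ⊗[ℝ] V) :
    conj (∑ i ∈ t, f i) = ∑ i ∈ t, conj (f i) := map_sum _ _ _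

end Complexification

/-! ### Real derivatives and Lie brackets, read in charts -/

section Calculus

variable {E : Type*} [NormedAddCommGroup E] [NormedSpace ℝ E]
  {M : Type*} [TopologicalSpace M] [ChartedSpace E M] [IsManifold 𝓘(ℝ, E) ∞ M]

variable (E) in
/-- `u` is smooth on a neighbourhood of `x`. -/
def SmoothNear {G : Type*} [NormedAddCommGroup G] [NormedSpace ℝ G] (u : M → G) (x : M) : Prop :=
  ∀ᶠ y in 𝓝 x, ContMDiffAt 𝓘(ℝ, E) 𝓘(ℝ, G) ∞ u y

/-- The complex vector field `X` is smooth on a neighbourhood of `x`. -/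
def SmoothFieldNear (X : CField E M) (x : M) : Prop := ∀ᶠ y in 𝓝 x, SmoothFieldAt X y

theorem SmoothNear.eventually {G : Type*} [NormedAddCommGroup G] [NormedSpace ℝ G] {u : M → G}
    {x : M} (h : SmoothNear E u x) : ∀ᶠ y in 𝓝 x, SmoothNear E u y :=
  eventually_eventually_nhds.2 h

theorem SmoothFieldNear.eventually {X : CField E M} {x : M} (h : SmoothFieldNear X x) :
    ∀ᶠ y in 𝓝 x, SmoothFieldNear X y :=
  eventually_eventually_nhds.2 h

/-- Derivative along a smooth vector field is smooth. -/
theorem contMDiffAt_realDeriv {G : Type*} [NormedAddCommGroup G] [NormedSpace ℝ G]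
    {V : (x : M) → TangentSpace 𝓘(ℝ, E) x} {x : M}
    (hV : ContMDiffAt 𝓘(ℝ, E) 𝓘(ℝ, E).tangent ∞
      (fun y => (⟨y, V y⟩ : TangentBundle 𝓘(ℝ, E) M)) x)
    {u : M → G} (hu : ContMDiffAt 𝓘(ℝ, E) 𝓘(ℝ, G) ∞ u x) :
    ContMDiffAt 𝓘(ℝ, E) 𝓘(ℝ, G) ∞ (fun y => realDeriv y (V y) u) x := by
  have h1 := hu.mfderiv_const (m := ∞) (by simp)
  have h2 := ContMDiffAt.clm_apply_of_inCoordinates (b₁ := id) (b₂ := u) h1 hV hu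
  rw [Bundle.contMDiffAt_totalSpace] at h2
  have h3 := h2.2
  simp at h3
  exact h3

/-- A derivative along a vector field, read in the chart at `x`. -/
theorem realDeriv_eq_fderiv {G : Type*} [NormedAddCommGroup G] [NormedSpace ℝ G]
    (V : (x : M) → TangentSpace 𝓘(ℝ, E) x) {x : M} {y : E} (hy : y ∈ (extChartAt 𝓘(ℝ, E) x).target)
    {u : M → G}
    (hu : MDifferentiableAt 𝓘(ℝ, E) 𝓘(ℝ, G) u ((extChartAt 𝓘(ℝ, E) x).symm y)) :
    fderiv ℝ (u ∘ (extChartAt 𝓘(ℝ, E) x).symm) y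
      (VectorField.mpullbackWithin 𝓘(ℝ, E) 𝓘(ℝ, E) (extChartAt 𝓘(ℝ, E) x).symm V
        (Set.range 𝓘(ℝ, E)) y) =
      realDeriv ((extChartAt 𝓘(ℝ, E) x).symm y) (V ((extChartAt 𝓘(ℝ, E) x).symm y)) u := by
  have hinv := isInvertible_mfderivWithin_extChartAt_symm (I := 𝓘(ℝ, E)) (x := x) hy
  have hd : MDifferentiableAt 𝓘(ℝ, E) 𝓘(ℝ, E) (extChartAt 𝓘(ℝ, E) x).symm y := by
    have := mdifferentiableWithinAt_extChartAt_symm (I := 𝓘(ℝ, E)) (x := x) hy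
    rwa [ModelWithCorners.range_eq_univ, mdifferentiableWithinAt_univ] at this
  rw [VectorField.mpullbackWithin_apply, realDeriv]
  rw [ModelWithCorners.range_eq_univ, mfderivWithin_univ] at hinv ⊢
  rw [← mfderiv_eq_fderiv, mfderiv_comp y hu hd]
  change mfderiv _ _ u _ (mfderiv _ _ _ y ((mfderiv _ _ _ y).inverse _)) = _
  obtain ⟨L, hL⟩ := hinv
  rw [← hL, ContinuousLinearMap.inverse_equiv]
  exact congrArg _ (L.apply_symm_apply _)

/-- In the chart at `x` this is the identity for brackets in a vector space, which rests on the
symmetry of second derivatives. The algebraic identities for brackets below follow from it formally.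
-/
theorem realDeriv_lieBracket [CompleteSpace E] {G : Type*} [NormedAddCommGroup G] [NormedSpace ℝ G]
    {V W : (x : M) → TangentSpace 𝓘(ℝ, E) x} {x : M}
    (hV : ContMDiffAt 𝓘(ℝ, E) 𝓘(ℝ, E).tangent ∞
      (fun y => (⟨y, V y⟩ : TangentBundle 𝓘(ℝ, E) M)) x)
    (hW : ContMDiffAt 𝓘(ℝ, E) 𝓘(ℝ, E).tangent ∞
      (fun y => (⟨y, W y⟩ : TangentBundle 𝓘(ℝ, E) M)) x)
    {u : M → G} (hu : SmoothNear E u x) :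
    realDeriv x (VectorField.mlieBracket 𝓘(ℝ, E) V W x) u =
      realDeriv x (V x) (fun y => realDeriv y (W y) u) -
        realDeriv x (W x) (fun y => realDeriv y (V y) u) := by
  have hI : IsManifold 𝓘(ℝ, E) 2 M := IsManifold.of_le (n := ∞) (by norm_cast)
  have h2 : minSmoothness ℝ 2 ≤ (∞ : WithTop ℕ∞) := by
    rw [minSmoothness_of_isRCLikeNormedField]; norm_cast
  set φ := extChartAt 𝓘(ℝ, E) x with hφ
  have hx : φ x ∈ φ.target := mem_extChartAt_target x
  have hsx : φ.symm (φ x) = x := extChartAt_to_inv x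
  have hcont : ContinuousAt φ.symm (φ x) := continuousAt_extChartAt_symm x
  have hnear : ∀ᶠ y in 𝓝 (φ x), y ∈ φ.target ∧ ContMDiffAt 𝓘(ℝ, E) 𝓘(ℝ, G) ∞ u (φ.symm y) := by
    refine Filter.Eventually.and (extChartAt_target_mem_nhds (I := 𝓘(ℝ, E)) x) ?_
    have h := hcont.tendsto
    rw [hsx] at h
    exact h.eventually hu
  have hux : ContMDiffAt 𝓘(ℝ, E) 𝓘(ℝ, G) ∞ u x := hu.self_of_nhds
  set V' := VectorField.mpullbackWithin 𝓘(ℝ, E) 𝓘(ℝ, E) φ.symm V (Set.range 𝓘(ℝ, E)) with hV'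
  set W' := VectorField.mpullbackWithin 𝓘(ℝ, E) 𝓘(ℝ, E) φ.symm W (Set.range 𝓘(ℝ, E)) with hW'
  have hdiff : ∀ {V : (x : M) → TangentSpace 𝓘(ℝ, E) x},
      ContMDiffAt 𝓘(ℝ, E) 𝓘(ℝ, E).tangent ∞
      (fun y => (⟨y, V y⟩ : TangentBundle 𝓘(ℝ, E) M)) x →
      DifferentiableAt ℝ (VectorField.mpullbackWithin 𝓘(ℝ, E) 𝓘(ℝ, E) φ.symm V
        (Set.range 𝓘(ℝ, E)) : E → E) (φ x) := by
    intro V hV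
    have := (MDifferentiableWithinAt.differentiableWithinAt_mpullbackWithin_vectorField
      (s := Set.univ) (hV.mdifferentiableAt (by simp)).mdifferentiableWithinAt)
    exact this.differentiableAt (by simp)
  have hv : ContDiffAt ℝ ∞ (u ∘ φ.symm) (φ x) := by
    rw [← contMDiffAt_iff_contDiffAt]
    refine ContMDiffAt.comp (φ x) (I' := 𝓘(ℝ, E)) (by rw [hsx]; exact hux) ?_
    have := contMDiffWithinAt_extChartAt_symm_range (I := 𝓘(ℝ, E)) (n := ∞) x hx
    rwa [ModelWithCorners.range_eq_univ, contMDiffWithinAt_univ] at this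
  -- first derivatives at `x`
  have key : ∀ (V : (x : M) → TangentSpace 𝓘(ℝ, E) x) {w : M → G},
      MDifferentiableAt 𝓘(ℝ, E) 𝓘(ℝ, G) w x →
      fderiv ℝ (w ∘ φ.symm) (φ x) (VectorField.mpullbackWithin 𝓘(ℝ, E) 𝓘(ℝ, E) φ.symm V
        (Set.range 𝓘(ℝ, E)) (φ x)) = realDeriv x (V x) w := by
    intro V w hw
    rw [realDeriv_eq_fderiv V hx (by rw [hsx]; exact hw)]
    exact congrArg (fun z => realDeriv z (V z) w) hsx
  -- The inner derivative is differentiated again, so its chart expression is needed on a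
  -- neighbourhood and not only at `x`.
  have hfun : ∀ (V : (x : M) → TangentSpace 𝓘(ℝ, E) x),
      (fun y => realDeriv y (V y) u) ∘ φ.symm =ᶠ[𝓝 (φ x)]
      fun y => fderiv ℝ (u ∘ φ.symm) y (VectorField.mpullbackWithin 𝓘(ℝ, E) 𝓘(ℝ, E) φ.symm V
        (Set.range 𝓘(ℝ, E)) y) := by
    intro V
    filter_upwards [hnear] with y hy
    exact (realDeriv_eq_fderiv V hy.1 (hy.2.mdifferentiableAt (by simp))).symm
  rw [← key V ((contMDiffAt_realDeriv hW hux).mdifferentiableAt (by simp)),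
    ← key W ((contMDiffAt_realDeriv hV hux).mdifferentiableAt (by simp)),
    (hfun V).fderiv_eq, (hfun W).fderiv_eq]
  rw [← VectorField.fderiv_apply_lieBracket hv h2 (hdiff hW) (hdiff hV)]
  have hinv := isInvertible_mfderiv_extChartAt (I := 𝓘(ℝ, E)) (mem_extChartAt_source (I := 𝓘(ℝ, E)) x)
  have hu' : u =ᶠ[𝓝 x] (u ∘ φ.symm) ∘ φ := by
    filter_upwards [extChartAt_source_mem_nhds (I := 𝓘(ℝ, E)) x] with y hy
    simp [φ.left_inv hy]
  rw [realDeriv, hu'.mfderiv_eq, mfderiv_comp x (I' := 𝓘(ℝ, E))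
    (mdifferentiableAt_iff_differentiableAt.2 (hv.differentiableAt (by simp)))
    ((contMDiffAt_extChartAt (n := ∞)).mdifferentiableAt (by simp)), mfderiv_eq_fderiv,
    ← VectorField.mlieBracketWithin_univ, VectorField.mlieBracketWithin_apply]
  obtain ⟨L, hL⟩ := hinv
  rw [← hφ, ← hL, ContinuousLinearMap.inverse_equiv]
  refine (congrArg (fderiv ℝ (u ∘ φ.symm) (φ x)) (L.apply_symm_apply _)).trans ?_
  -- The manifold bracket is defined through a bracket within this set; as it is the whole space,
  -- the restriction disappears.
  have huniv : φ.symm ⁻¹' Set.univ ∩ Set.range 𝓘(ℝ, E) = Set.univ := by simp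
  have h := congrFun (VectorField.lieBracketWithin_univ (𝕜 := ℝ) (V := V') (W := W')) (φ x)
  rw [← huniv] at h
  exact congrArg _ h

end Calculus

/-! ### Smooth complex functions, matrices and vector fields -/

section Calculus

variable {E : Type*} [NormedAddCommGroup E] [NormedSpace ℝ E]
  {M : Type*} [TopologicalSpace M] [ChartedSpace E M] [IsManifold 𝓘(ℝ, E) ∞ M]

section functions

variable {x : M} {u v : M → ℂ}

theorem SmoothNear.mdiff {G : Type*} [NormedAddCommGroup G] [NormedSpace ℝ G] {u : M → G}
    (h : SmoothNear E u x) : MDifferentiableAt 𝓘(ℝ, E) 𝓘(ℝ, G) u x :=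
  h.self_of_nhds.mdifferentiableAt (by simp)

theorem smoothNear_const (c : ℂ) : SmoothNear E (fun _ : M => c) x :=
  Eventually.of_forall fun _ => contMDiffAt_const

theorem SmoothNear.add (hu : SmoothNear E u x) (hv : SmoothNear E v x) :
    SmoothNear E (fun y => u y + v y) x := by
  filter_upwards [hu, hv] with y h₁ h₂ using h₁.add h₂

theorem SmoothNear.mul (hu : SmoothNear E u x) (hv : SmoothNear E v x) :
    SmoothNear E (fun y => u y * v y) x := by
  filter_upwards [hu, hv] with y h₁ h₂
  exact (contDiff_mul (𝕜 := ℝ) (𝔸 := ℂ) (n := ∞)).contMDiff.contMDiffAt.comp y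
    (h₁.prodMk_space h₂)

theorem SmoothNear.neg (hu : SmoothNear E u x) : SmoothNear E (fun y => - u y) x := by
  filter_upwards [hu] with y h₁ using h₁.neg

theorem SmoothNear.sum {ι : Type*} {t : Finset ι} {u : ι → M → ℂ}
    (hu : ∀ i ∈ t, SmoothNear E (u i) x) : SmoothNear E (fun y => ∑ i ∈ t, u i y) x := by
  classical
  induction t using Finset.induction_on with
  | empty => simpa using smoothNear_const 0
  | insert i t hi ih =>
    simp only [Finset.sum_insert hi]
    exact (hu i (by simp)).add (ih fun j hj => hu j (by simp [hj]))

theorem SmoothNear.prod {ι : Type*} {t : Finset ι} {u : ι → M → ℂ}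
    (hu : ∀ i ∈ t, SmoothNear E (u i) x) : SmoothNear E (fun y => ∏ i ∈ t, u i y) x := by
  classical
  induction t using Finset.induction_on with
  | empty => simpa using smoothNear_const 1
  | insert i t hi ih =>
    simp only [Finset.prod_insert hi]
    exact (hu i (by simp)).mul (ih fun j hj => hu j (by simp [hj]))

theorem SmoothNear.clm_comp {G G' : Type*} [NormedAddCommGroup G] [NormedSpace ℝ G]
    [NormedAddCommGroup G'] [NormedSpace ℝ G'] {u : M → G} (L : G →L[ℝ] G')
    (hu : SmoothNear E u x) : SmoothNear E (fun y => L (u y)) x := by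
  filter_upwards [hu] with y h₁ using L.contMDiff.contMDiffAt.comp y h₁

theorem SmoothNear.star (hu : SmoothNear E u x) :
    SmoothNear E (fun y => (starRingEnd ℂ) (u y)) x :=
  hu.clm_comp (Complex.conjCLE : ℂ →L[ℝ] ℂ)

theorem SmoothNear.inv (hu : SmoothNear E u x) (h0 : u x ≠ 0) :
    SmoothNear E (fun y => (u y)⁻¹) x := by
  filter_upwards [hu, hu.self_of_nhds.continuousAt.eventually_ne h0] with y h₁ h₂
  have h : ContDiffAt ℝ ∞ (fun z : ℂ => z⁻¹) (u y) := contDiffAt_inv ℝ h₂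
  exact h.contMDiffAt.comp y h₁

theorem SmoothNear.congr {G : Type*} [NormedAddCommGroup G] [NormedSpace ℝ G] {u v : M → G}
    (hu : SmoothNear E u x) (h : u =ᶠ[𝓝 x] v) :
    SmoothNear E v x := by
  filter_upwards [hu, eventually_eventually_nhds.2 h] with y h₁ h₂
  exact h₁.congr_of_eventuallyEq (EventuallyEq.symm h₂)

theorem SmoothNear.det {ι : Type*} [Fintype ι] [DecidableEq ι] {Z : M → Matrix ι ι ℂ}
    (hZ : ∀ i j, SmoothNear E (fun y => Z y i j) x) : SmoothNear E (fun y => (Z y).det) x := by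
  simp only [Matrix.det_apply']
  exact .sum fun σ _ => (smoothNear_const _).mul (.prod fun i _ => hZ _ _)

theorem SmoothNear.adjugate {ι : Type*} [Fintype ι] [DecidableEq ι] {Z : M → Matrix ι ι ℂ}
    (hZ : ∀ i j, SmoothNear E (fun y => Z y i j) x) (i j : ι) :
    SmoothNear E (fun y => (Z y).adjugate i j) x := by
  simp only [Matrix.adjugate_apply]
  refine .det fun k l => ?_
  by_cases hk : k = j
  · subst hk; simpa using smoothNear_const _
  · simpa [Matrix.updateRow_ne hk] using hZ k l

theorem SmoothNear.matrix_inv {ι : Type*} [Fintype ι] [DecidableEq ι] {Z : M → Matrix ι ι ℂ}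
    (hZ : ∀ i j, SmoothNear E (fun y => Z y i j) x) (h0 : IsUnit (Z x).det) (i j : ι) :
    SmoothNear E (fun y => (Z y)⁻¹ i j) x := by
  simp only [Matrix.inv_def, Ring.inverse_eq_inv', Matrix.smul_apply, smul_eq_mul]
  exact ((SmoothNear.det hZ).inv h0.ne_zero).mul (.adjugate hZ i j)

theorem SmoothNear.matrix_mul {ι : Type*} [Fintype ι] {Y Z : M → Matrix ι ι ℂ}
    (hY : ∀ i j, SmoothNear E (fun y => Y y i j) x)
    (hZ : ∀ i j, SmoothNear E (fun y => Z y i j) x) (i j : ι) :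
    SmoothNear E (fun y => (Y y * Z y) i j) x := by
  simp only [Matrix.mul_apply]
  exact .sum fun k _ => (hY _ _).mul (hZ _ _)

end functions

section fields

variable {x : M} {X Y : CField E M} {u : M → ℂ}

theorem SmoothFieldNear.congr (hX : SmoothFieldNear X x) (h : ∀ᶠ y in 𝓝 x, X y = Y y) :
    SmoothFieldNear Y x := by
  filter_upwards [hX, eventually_eventually_nhds.2 h] with y h₁ h₂
  exact ⟨h₁.1.congr_of_eventuallyEq (by filter_upwards [h₂] with z hz; rw [hz]),
    h₁.2.congr_of_eventuallyEq (by filter_upwards [h₂] with z hz; rw [hz])⟩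

theorem smoothFieldNear_zero : SmoothFieldNear (0 : CField E M) x := by
  have h : ∀ y, ContMDiffAt 𝓘(ℝ, E) 𝓘(ℝ, E).tangent ∞
      (fun z : M => (⟨z, 0⟩ : TangentBundle 𝓘(ℝ, E) M)) y := fun y =>
    (Bundle.contMDiff_zeroSection ℝ (TangentSpace 𝓘(ℝ, E) (M := M))) y
  exact Eventually.of_forall fun y => ⟨by simpa using h y, by simpa using h y⟩

theorem SmoothFieldNear.add (hX : SmoothFieldNear X x) (hY : SmoothFieldNear Y x) :
    SmoothFieldNear (fun y => X y + Y y) x := by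
  filter_upwards [hX, hY] with y h₁ h₂
  constructor
  · simp only [map_add]
    exact h₁.1.add_section h₂.1
  · simp only [map_add]
    exact h₁.2.add_section h₂.2

theorem SmoothFieldNear.smul (hu : SmoothNear E u x) (hX : SmoothFieldNear X x) :
    SmoothFieldNear (fun y => u y • X y) x := by
  filter_upwards [hu.clm_comp Complex.reCLM, hu.clm_comp Complex.imCLM, hX] with y h₁ h₂ h₃
  constructor
  · simp only [re_smul]
    exact (h₁.smul_section h₃.1).sub_section (h₂.smul_section h₃.2)
  · simp only [im_smul]
    exact (h₁.smul_section h₃.2).add_section (h₂.smul_section h₃.1)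

theorem SmoothFieldNear.sum {ι : Type*} {t : Finset ι} {X : ι → CField E M}
    (hX : ∀ i ∈ t, SmoothFieldNear (X i) x) : SmoothFieldNear (fun y => ∑ i ∈ t, X i y) x := by
  classical
  induction t using Finset.induction_on with
  | empty => simpa using! smoothFieldNear_zero
  | insert i t hi ih =>
    simp only [Finset.sum_insert hi]
    exact (hX i (by simp)).add (ih fun j hj => hX j (by simp [hj]))

theorem SmoothFieldNear.const_smul (c : ℂ) (hX : SmoothFieldNear X x) :
    SmoothFieldNear (fun y => c • X y) x := .smul (smoothNear_const c) hX

theorem SmoothFieldNear.sub (hX : SmoothFieldNear X x) (hY : SmoothFieldNear Y x) :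
    SmoothFieldNear (fun y => X y - Y y) x := by
  simpa [sub_eq_add_neg] using hX.add (hY.const_smul (-1))

theorem SmoothFieldNear.conj (hX : SmoothFieldNear X x) : SmoothFieldNear (conjField X) x := by
  filter_upwards [hX] with y h₁
  constructor
  · simpa only [conjField, re_conj] using h₁.1
  · simp only [conjField, im_conj]
    exact h₁.2.neg_section

theorem SmoothFieldNear.bracket [CompleteSpace E] (hX : SmoothFieldNear X x)
    (hY : SmoothFieldNear Y x) : SmoothFieldNear (bracket X Y) x := by
  have hI : IsManifold 𝓘(ℝ, E) (∞ + 1) M := IsManifold.of_le (n := ∞) (by norm_cast)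
  have hI' : IsManifold 𝓘(ℝ, E) (minSmoothness ℝ 2) M := by
    rw [minSmoothness_of_isRCLikeNormedField]
    exact IsManifold.of_le (n := ∞) (by norm_cast)
  filter_upwards [hX, hY] with y h₁ h₂
  have h : minSmoothness ℝ (((⊤ : ℕ∞) : WithTop ℕ∞) + 1) ≤ ((⊤ : ℕ∞) : WithTop ℕ∞) := by
    rw [minSmoothness_of_isRCLikeNormedField]; norm_cast
  have key : ∀ {V W : (x : M) → TangentSpace 𝓘(ℝ, E) x},
      ContMDiffAt 𝓘(ℝ, E) 𝓘(ℝ, E).tangent ∞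
        (fun y => (⟨y, V y⟩ : TangentBundle 𝓘(ℝ, E) M)) y →
      ContMDiffAt 𝓘(ℝ, E) 𝓘(ℝ, E).tangent ∞
        (fun y => (⟨y, W y⟩ : TangentBundle 𝓘(ℝ, E) M)) y →
      ContMDiffAt 𝓘(ℝ, E) 𝓘(ℝ, E).tangent ∞
        (fun y => (⟨y, VectorField.mlieBracket 𝓘(ℝ, E) V W y⟩ : TangentBundle 𝓘(ℝ, E) M)) y :=
    fun hV hW => ContMDiffAt.mlieBracket_vectorField (m := ⊤) (n := ⊤) hV hW h
  constructor
  · simp only [CRSymbol.bracket, re_ofReIm]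
    exact (key h₁.1 h₂.1).sub_section (key h₁.2 h₂.2)
  · simp only [CRSymbol.bracket, im_ofReIm]
    exact (key h₁.1 h₂.2).add_section (key h₁.2 h₂.1)

end fields

end Calculus

/-! ### Complex derivatives along complexified vectors -/

section Calculus

variable {E : Type*} [NormedAddCommGroup E] [NormedSpace ℝ E]
  {M : Type*} [TopologicalSpace M] [ChartedSpace E M] [IsManifold 𝓘(ℝ, E) ∞ M]
  {x : M} {u v : M → ℂ}

section realDeriv

variable {G : Type*} [NormedAddCommGroup G] [NormedSpace ℝ G]

theorem realDeriv_congr (w : TangentSpace 𝓘(ℝ, E) x) {u v : M → G} (h : u =ᶠ[𝓝 x] v) :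
    realDeriv x w u = realDeriv x w v := by
  simp only [realDeriv]
  rw [h.mfderiv_eq]
  rfl

theorem realDeriv_add_vec (w w' : TangentSpace 𝓘(ℝ, E) x) (u : M → G) :
    realDeriv x (w + w') u = realDeriv x w u + realDeriv x w' u := map_add _ _ _

theorem realDeriv_sub_vec (w w' : TangentSpace 𝓘(ℝ, E) x) (u : M → G) :
    realDeriv x (w - w') u = realDeriv x w u - realDeriv x w' u := map_sub _ _ _

theorem realDeriv_neg_vec (w : TangentSpace 𝓘(ℝ, E) x) (u : M → G) :
    realDeriv x (-w) u = - realDeriv x w u := map_neg _ _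

theorem realDeriv_smul_vec (a : ℝ) (w : TangentSpace 𝓘(ℝ, E) x) (u : M → G) :
    realDeriv x (a • w) u = a • realDeriv x w u := map_smul _ _ _

theorem realDeriv_clm {G' : Type*} [NormedAddCommGroup G'] [NormedSpace ℝ G'] (L : G →L[ℝ] G')
    (w : TangentSpace 𝓘(ℝ, E) x) {u : M → G} (hu : MDifferentiableAt 𝓘(ℝ, E) 𝓘(ℝ, G) u x) :
    realDeriv x w (fun y => L (u y)) = L (realDeriv x w u) := by
  have h := mfderiv_comp x (L.mdifferentiableAt (x := u x)) hu
  rw [L.mfderiv_eq] at h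
  simp only [realDeriv]
  exact congrArg (fun T => T w) h

theorem realDeriv_add (w : TangentSpace 𝓘(ℝ, E) x) {u v : M → G}
    (hu : MDifferentiableAt 𝓘(ℝ, E) 𝓘(ℝ, G) u x) (hv : MDifferentiableAt 𝓘(ℝ, E) 𝓘(ℝ, G) v x) :
    realDeriv x w (fun y => u y + v y) = realDeriv x w u + realDeriv x w v :=
  congrArg (fun T => T w) (hu.hasMFDerivAt.add hv.hasMFDerivAt).mfderiv

theorem realDeriv_mul (w : TangentSpace 𝓘(ℝ, E) x) {u v : M → ℂ}
    (hu : MDifferentiableAt 𝓘(ℝ, E) 𝓘(ℝ, ℂ) u x) (hv : MDifferentiableAt 𝓘(ℝ, E) 𝓘(ℝ, ℂ) v x) :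
    realDeriv x w (fun y => u y * v y) = u x * realDeriv x w v + v x * realDeriv x w u := by
  have h := (hu.hasMFDerivAt.mul hv.hasMFDerivAt).mfderiv
  exact congrArg (fun T => T w) h

theorem realDeriv_const (w : TangentSpace 𝓘(ℝ, E) x) (c : G) :
    realDeriv x w (fun _ => c) = 0 := by
  simp only [realDeriv]
  rw [mfderiv_const]
  rfl

end realDeriv

section deriv

variable (w w' : CTangent E x)

theorem deriv_congr (h : u =ᶠ[𝓝 x] v) : deriv x w u = deriv x w v := by
  simp only [deriv, realDeriv_congr _ h]

theorem deriv_add_vec (u : M → ℂ) : deriv x (w + w') u = deriv x w u + deriv x w' u := by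
  simp only [deriv, map_add, realDeriv_add_vec]; ring

theorem deriv_smul_vec (c : ℂ) (u : M → ℂ) : deriv x (c • w) u = c * deriv x w u := by
  simp only [deriv, re_smul, im_smul, realDeriv_add_vec, realDeriv_sub_vec, realDeriv_smul_vec,
    Complex.real_smul]
  conv_rhs => rw [← Complex.re_add_im c]
  linear_combination (- c.im * realDeriv x (im w) u) * Complex.I_sq

/-- The derivative of `u` at `x` as a linear functional. -/
def derivHom (x : M) (u : M → ℂ) : CTangent E x →ₗ[ℂ] ℂ where
  toFun w := deriv x w u
  map_add' w w' := deriv_add_vec w w' u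
  map_smul' c w := deriv_smul_vec w c u

theorem derivHom_apply (u : M → ℂ) : derivHom x u w = deriv x w u := rfl

theorem deriv_zero_vec (u : M → ℂ) : deriv x (0 : CTangent E x) u = 0 := map_zero (derivHom x u)

theorem deriv_sub_vec (u : M → ℂ) : deriv x (w - w') u = deriv x w u - deriv x w' u :=
  map_sub (derivHom x u) w w'

theorem deriv_neg_vec (u : M → ℂ) : deriv x (-w) u = - deriv x w u :=
  map_neg (derivHom x u) w

theorem deriv_sum_vec {ι : Type*} (t : Finset ι) (w : ι → CTangent E x) (u : M → ℂ) :
    deriv x (∑ i ∈ t, w i) u = ∑ i ∈ t, deriv x (w i) u :=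
  map_sum (derivHom x u) w t

theorem deriv_const (c : ℂ) : deriv x w (fun _ => c) = 0 := by
  simp [deriv, realDeriv_const]

theorem deriv_add (hu : SmoothNear E u x) (hv : SmoothNear E v x) :
    deriv x w (fun y => u y + v y) = deriv x w u + deriv x w v := by
  simp only [deriv, realDeriv_add _ hu.mdiff hv.mdiff]; ring

theorem deriv_mul (hu : SmoothNear E u x) (hv : SmoothNear E v x) :
    deriv x w (fun y => u y * v y) = u x * deriv x w v + v x * deriv x w u := by
  simp only [deriv, realDeriv_mul _ hu.mdiff hv.mdiff]; ring

theorem deriv_const_mul (c : ℂ) (hu : SmoothNear E u x) :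
    deriv x w (fun y => c * u y) = c * deriv x w u := by
  rw [deriv_mul w (smoothNear_const c) hu, deriv_const]; ring

theorem deriv_neg (hu : SmoothNear E u x) :
    deriv x w (fun y => - u y) = - deriv x w u := by
  simpa using deriv_const_mul w (-1) hu

theorem deriv_sub (hu : SmoothNear E u x) (hv : SmoothNear E v x) :
    deriv x w (fun y => u y - v y) = deriv x w u - deriv x w v := by
  simp only [sub_eq_add_neg]
  rw [deriv_add w hu hv.neg, deriv_neg w hv]

theorem deriv_sum {ι : Type*} {t : Finset ι} {u : ι → M → ℂ}
    (hu : ∀ i ∈ t, SmoothNear E (u i) x) :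
    deriv x w (fun y => ∑ i ∈ t, u i y) = ∑ i ∈ t, deriv x w (u i) := by
  classical
  induction t using Finset.induction_on with
  | empty => simpa using deriv_const w 0
  | insert i t hi ih =>
    simp only [Finset.sum_insert hi]
    rw [deriv_add w (hu i (by simp)) (.sum fun j hj => hu j (by simp [hj])),
      ih fun j hj => hu j (by simp [hj])]

theorem deriv_star (hu : SmoothNear E u x) :
    deriv x w (fun y => (starRingEnd ℂ) (u y)) = (starRingEnd ℂ) (deriv x (conj w) u) := by
  have h : ∀ w : TangentSpace 𝓘(ℝ, E) x, realDeriv x w (fun y => (starRingEnd ℂ) (u y)) =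
      (starRingEnd ℂ) (realDeriv x w u) := fun w =>
    realDeriv_clm (Complex.conjCLE : ℂ →L[ℝ] ℂ) w hu.mdiff
  simp only [deriv, h, re_conj, im_conj, realDeriv_neg_vec]
  simp

theorem deriv_star_of_real (hu : SmoothNear E u x) (hr : ∀ y, (starRingEnd ℂ) (u y) = u y) :
    deriv x (conj w) u = (starRingEnd ℂ) (deriv x w u) := by
  have h := deriv_star w hu
  simp only [hr] at h
  rw [h, Complex.conj_conj]

end deriv

section fields

variable {X Y Z : CField E M}

theorem SmoothNear.deriv (hu : SmoothNear E u x) (hX : SmoothFieldNear X x) :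
    SmoothNear E (fun y => deriv y (X y) u) x := by
  have h₁ : SmoothNear E (fun y => realDeriv y (re (X y)) u) x := by
    filter_upwards [hu, hX] with y h₁ h₂ using contMDiffAt_realDeriv h₂.1 h₁
  have h₂ : SmoothNear E (fun y => realDeriv y (im (X y)) u) x := by
    filter_upwards [hu, hX] with y h₁ h₂ using contMDiffAt_realDeriv h₂.2 h₁
  exact h₁.add ((smoothNear_const _).mul h₂)

/-- Splitting both fields into real and imaginary parts reduces this to four real brackets,
recombined by `I² = -1`. -/
theorem deriv_bracket [CompleteSpace E] (hX : SmoothFieldNear X x) (hY : SmoothFieldNear Y x)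
    (hu : SmoothNear E u x) :
    deriv x (bracket X Y x) u =
      deriv x (X x) (fun y => deriv y (Y y) u) - deriv x (Y x) (fun y => deriv y (X y) u) := by
  have hs : ∀ {X : CField E M}, SmoothFieldNear X x →
      SmoothNear E (fun y => realDeriv y (re (X y)) u) x ∧
      SmoothNear E (fun y => realDeriv y (im (X y)) u) x := by
    intro X hX
    constructor
    · filter_upwards [hu, hX] with y h₁ h₂ using contMDiffAt_realDeriv h₂.1 h₁
    · filter_upwards [hu, hX] with y h₁ h₂ using contMDiffAt_realDeriv h₂.2 h₁
  have key : ∀ {X : CField E M} (w : CTangent E x), SmoothFieldNear X x →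
      deriv x w (fun y => deriv y (X y) u) =
        deriv x w (fun y => realDeriv y (re (X y)) u) +
          Complex.I * deriv x w (fun y => realDeriv y (im (X y)) u) := by
    intro X w hX
    obtain ⟨h₁, h₂⟩ := hs hX
    rw [← deriv_const_mul w _ h₂, ← deriv_add w h₁ ((smoothNear_const _).mul h₂)]
    rfl
  rw [key _ hX, key _ hY]
  have hX' := hX.self_of_nhds
  have hY' := hY.self_of_nhds
  simp only [deriv, bracket, re_ofReIm, im_ofReIm, realDeriv_add_vec, realDeriv_sub_vec]
  rw [realDeriv_lieBracket hX'.1 hY'.1 hu, realDeriv_lieBracket hX'.1 hY'.2 hu,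
    realDeriv_lieBracket hX'.2 hY'.1 hu, realDeriv_lieBracket hX'.2 hY'.2 hu]
  linear_combination (realDeriv x (im (X x)) (fun y => realDeriv y (im (Y y)) u) -
    realDeriv x (im (Y x)) (fun y => realDeriv y (im (X y)) u)) * -Complex.I_sq

end fields

end Calculus

/-! ### Bracket identities from commutators of derivations -/

section Bracket

variable {E : Type*} [NormedAddCommGroup E] [NormedSpace ℝ E] [FiniteDimensional ℝ E]
  {M : Type*} [TopologicalSpace M] [ChartedSpace E M] [IsManifold 𝓘(ℝ, E) ∞ M]
  {x : M} {u v : M → ℂ}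

/-- Every covector at `x` is the differential of a smooth function with prescribed value. -/
theorem exists_smoothNear_deriv_eq (ℓ : CTangent E x →ₗ[ℂ] ℂ) (c : ℂ) :
    ∃ u : M → ℂ, SmoothNear E u x ∧ u x = c ∧ ∀ w : CTangent E x, deriv x w u = ℓ w := by
  obtain ⟨D, hD⟩ := isInvertible_mfderiv_extChartAt (I := 𝓘(ℝ, E))
    (mem_extChartAt_source (I := 𝓘(ℝ, E)) x)
  let L : TangentSpace 𝓘(ℝ, E) x →ₗ[ℝ] ℂ :=
    (ℓ.restrictScalars ℝ) ∘ₗ (TensorProduct.mk ℝ ℂ (TangentSpace 𝓘(ℝ, E) x) 1)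
  let K : E →L[ℝ] ℂ := LinearMap.toContinuousLinearMap (L ∘ₗ
    (D.symm.toLinearEquiv.toLinearMap : E →ₗ[ℝ] TangentSpace 𝓘(ℝ, E) x))
  have hφ : SmoothNear E (extChartAt 𝓘(ℝ, E) x) x := by
    filter_upwards [chart_source_mem_nhds E x] with y hy using contMDiffAt_extChartAt' hy
  have hK := hφ.clm_comp K
  have hr : ∀ w : TangentSpace 𝓘(ℝ, E) x,
      realDeriv x w (fun y => K (extChartAt 𝓘(ℝ, E) x y)) = L w := by
    intro w
    rw [realDeriv_clm K w hφ.mdiff, realDeriv, ← hD]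
    exact congrArg L (D.symm_apply_apply w)
  refine ⟨fun y => K (extChartAt 𝓘(ℝ, E) x y) + (c - K (extChartAt 𝓘(ℝ, E) x x)),
    hK.add (smoothNear_const _), by ring, fun w => ?_⟩
  rw [deriv_add w hK (smoothNear_const _), deriv_const, add_zero, deriv, hr, hr]
  conv_rhs => rw [← ofReIm_re_im w]
  have h : (Complex.I : ℂ) ⊗ₜ[ℝ] im w = Complex.I • ((1 : ℂ) ⊗ₜ[ℝ] im w) := by
    rw [TensorProduct.smul_tmul', smul_eq_mul, mul_one]
  rw [ofReIm, h, map_add, map_smul]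
  rfl

/-- Every covector is a differential, so derivations separate vectors. With `deriv_bracket`, each
bracket identity below becomes a computation with commutators. -/
theorem eq_of_deriv_eq {w w' : CTangent E x}
    (h : ∀ u : M → ℂ, SmoothNear E u x → deriv x w u = deriv x w' u) : w = w' := by
  rw [← sub_eq_zero]
  refine (Module.forall_dual_apply_eq_zero_iff ℂ (w - w')).1 fun ℓ => ?_
  obtain ⟨u, hu, -, hd⟩ := exists_smoothNear_deriv_eq ℓ 0
  rw [← hd, deriv_sub_vec, h u hu, sub_self]

variable {X Y Z X' Y' : CField E M}

theorem bracket_congr (hX : SmoothFieldNear X x) (hY : SmoothFieldNear Y x)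
    (h₁ : ∀ᶠ y in 𝓝 x, X y = X' y) (h₂ : ∀ᶠ y in 𝓝 x, Y y = Y' y) :
    bracket X Y x = bracket X' Y' x := by
  refine eq_of_deriv_eq fun u hu => ?_
  rw [deriv_bracket hX hY hu, deriv_bracket (hX.congr h₁) (hY.congr h₂) hu, h₁.self_of_nhds,
    h₂.self_of_nhds]
  congr 1
  · exact deriv_congr _ (by filter_upwards [h₂] with y hy; rw [hy])
  · exact deriv_congr _ (by filter_upwards [h₁] with y hy; rw [hy])

theorem bracket_swap (hX : SmoothFieldNear X x) (hY : SmoothFieldNear Y x) :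
    bracket X Y x = - bracket Y X x := by
  refine eq_of_deriv_eq fun u hu => ?_
  rw [deriv_neg_vec, deriv_bracket hX hY hu, deriv_bracket hY hX hu]
  ring

theorem bracket_add_right (hX : SmoothFieldNear X x) (hY : SmoothFieldNear Y x)
    (hZ : SmoothFieldNear Z x) :
    bracket X (fun y => Y y + Z y) x = bracket X Y x + bracket X Z x := by
  refine eq_of_deriv_eq fun u hu => ?_
  rw [deriv_add_vec, deriv_bracket hX (hY.add hZ) hu, deriv_bracket hX hY hu,
    deriv_bracket hX hZ hu, deriv_add_vec]
  simp only [deriv_add_vec]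
  rw [deriv_add _ (hu.deriv hY) (hu.deriv hZ)]
  ring

theorem bracket_add_left (hX : SmoothFieldNear X x) (hY : SmoothFieldNear Y x)
    (hZ : SmoothFieldNear Z x) :
    bracket (fun y => X y + Y y) Z x = bracket X Z x + bracket Y Z x := by
  rw [bracket_swap (hX.add hY) hZ, bracket_add_right hZ hX hY, bracket_swap hX hZ,
    bracket_swap hY hZ]
  abel

theorem bracket_smul_right (hX : SmoothFieldNear X x) (hY : SmoothFieldNear Y x)
    (hv : SmoothNear E v x) :
    bracket X (fun y => v y • Y y) x = v x • bracket X Y x + deriv x (X x) v • Y x := by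
  refine eq_of_deriv_eq fun u hu => ?_
  rw [deriv_add_vec, deriv_smul_vec, deriv_smul_vec, deriv_bracket hX (.smul hv hY) hu,
    deriv_bracket hX hY hu, deriv_smul_vec]
  simp only [deriv_smul_vec]
  rw [deriv_mul _ hv (hu.deriv hY)]
  ring

theorem bracket_smul_left (hX : SmoothFieldNear X x) (hY : SmoothFieldNear Y x)
    (hv : SmoothNear E v x) :
    bracket (fun y => v y • X y) Y x = v x • bracket X Y x - deriv x (Y x) v • X x := by
  rw [bracket_swap (.smul hv hX) hY, bracket_smul_right hY hX hv, bracket_swap hX hY, smul_neg]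
  abel

theorem bracket_zero_right (hX : SmoothFieldNear X x) : bracket X (fun _ => 0) x = 0 := by
  refine eq_of_deriv_eq fun u hu => ?_
  have h0 : SmoothFieldNear (fun _ => 0 : CField E M) x := smoothFieldNear_zero
  rw [deriv_bracket hX h0 hu]
  simp only [deriv_zero_vec, deriv_const, sub_zero]

theorem bracket_sum_right {ι : Type*} {t : Finset ι} {v : ι → M → ℂ} {Y : ι → CField E M}
    (hX : SmoothFieldNear X x) (hY : ∀ i ∈ t, SmoothFieldNear (Y i) x)
    (hv : ∀ i ∈ t, SmoothNear E (v i) x) :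
    bracket X (fun y => ∑ i ∈ t, v i y • Y i y) x =
      ∑ i ∈ t, (v i x • bracket X (Y i) x + deriv x (X x) (v i) • Y i x) := by
  classical
  induction t using Finset.induction_on with
  | empty => simpa using bracket_zero_right hX
  | insert i t hi ih =>
    simp only [Finset.sum_insert hi]
    rw [bracket_add_right hX (.smul (hv i (by simp)) (hY i (by simp)))
      (.sum fun j hj => .smul (hv j (by simp [hj])) (hY j (by simp [hj]))),
      ih (fun j hj => hY j (by simp [hj])) (fun j hj => hv j (by simp [hj])),
      bracket_smul_right hX (hY i (by simp)) (hv i (by simp))]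

theorem bracket_sum_left {ι : Type*} {t : Finset ι} {v : ι → M → ℂ} {Y : ι → CField E M}
    (hX : SmoothFieldNear X x) (hY : ∀ i ∈ t, SmoothFieldNear (Y i) x)
    (hv : ∀ i ∈ t, SmoothNear E (v i) x) :
    bracket (fun y => ∑ i ∈ t, v i y • Y i y) X x =
      ∑ i ∈ t, (v i x • bracket (Y i) X x - deriv x (X x) (v i) • Y i x) := by
  rw [bracket_swap (.sum fun i hi => .smul (hv i hi) (hY i hi)) hX, bracket_sum_right hX hY hv,
    ← Finset.sum_neg_distrib]
  refine Finset.sum_congr rfl fun i hi => ?_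
  rw [bracket_swap (hY i hi) hX, smul_neg]
  abel

theorem deriv_conj_vec (w : CTangent E x) (hu : SmoothNear E u x) :
    deriv x (conj w) u = (starRingEnd ℂ) (deriv x w fun y => (starRingEnd ℂ) (u y)) := by
  rw [deriv_star w hu, Complex.conj_conj]

theorem bracket_conj (hX : SmoothFieldNear X x) (hY : SmoothFieldNear Y x) :
    bracket (conjField X) (conjField Y) x = conj (bracket X Y x) := by
  refine eq_of_deriv_eq fun u hu => ?_
  have key : ∀ {X Y : CField E M}, SmoothFieldNear X x → SmoothFieldNear Y x →
      deriv x (conj (X x)) (fun y => deriv y (conj (Y y)) u) =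
      (starRingEnd ℂ) (deriv x (X x) fun y => deriv y (Y y) fun z => (starRingEnd ℂ) (u z)) := by
    intro X Y hX hY
    have h : SmoothNear E (fun y => CRSymbol.deriv y (conj (Y y)) u) x := hu.deriv hY.conj
    rw [deriv_conj_vec _ h]
    congr 1
    refine deriv_congr _ ?_
    filter_upwards [hu.eventually] with y hy
    rw [deriv_conj_vec _ hy, Complex.conj_conj]
  rw [deriv_conj_vec _ hu, deriv_bracket hX.conj hY.conj hu, deriv_bracket hX hY hu.star, map_sub,
    ← key hX hY, ← key hY hX]
  rfl

/-- Written out on a test function, both sides are sums of threefold iterated derivatives, which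
cancel. -/
theorem bracket_jacobi (hX : SmoothFieldNear X x) (hY : SmoothFieldNear Y x)
    (hZ : SmoothFieldNear Z x) :
    bracket X (bracket Y Z) x = bracket (bracket X Y) Z x + bracket Y (bracket X Z) x := by
  refine eq_of_deriv_eq fun u hu => ?_
  have key : ∀ {X Y : CField E M} (w : CTangent E x), SmoothFieldNear X x → SmoothFieldNear Y x →
      deriv x w (fun y => deriv y (bracket X Y y) u) =
        deriv x w (fun y => deriv y (X y) fun z => deriv z (Y z) u) -
        deriv x w (fun y => deriv y (Y y) fun z => deriv z (X z) u) := by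
    intro X Y w hX hY
    rw [← deriv_sub w ((hu.deriv hY).deriv hX) ((hu.deriv hX).deriv hY)]
    refine deriv_congr _ ?_
    filter_upwards [hX.eventually, hY.eventually, hu.eventually] with y h₁ h₂ h₃
    exact deriv_bracket h₁ h₂ h₃
  rw [deriv_add_vec, deriv_bracket hX (hY.bracket hZ) hu, deriv_bracket (hX.bracket hY) hZ hu,
    deriv_bracket hY (hX.bracket hZ) hu, key _ hY hZ, key _ hX hY, key _ hX hZ,
    deriv_bracket hY hZ (hu.deriv hX), deriv_bracket hX hY (hu.deriv hZ),
    deriv_bracket hX hZ (hu.deriv hY)]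
  ring

end Bracket

/-! ### Smoothness of coefficients -/

section Frames

variable {E : Type*} [NormedAddCommGroup E] [NormedSpace ℝ E] [FiniteDimensional ℝ E]
  {M : Type*} [TopologicalSpace M] [ChartedSpace E M] [IsManifold 𝓘(ℝ, E) ∞ M]
  {x : M}

/-- Coefficients with respect to linearly independent smooth fields are smooth. -/
theorem exists_smooth_coeff {ι : Type*} [Fintype ι] {b : ι → CField E M}
    (hb : ∀ i, SmoothFieldNear (b i) x) (hli : LinearIndependent ℂ fun i => b i x)
    {X : CField E M} (hX : SmoothFieldNear X x)
    (hmem : ∀ᶠ y in 𝓝 x, X y ∈ Submodule.span ℂ (Set.range fun i => b i y)) :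
    ∃ c : ι → M → ℂ, (∀ i, SmoothNear E (c i) x) ∧ ∀ᶠ y in 𝓝 x, X y = ∑ i, c i y • b i y := by
  classical
  have hfun : ∀ i, ∃ u : M → ℂ, SmoothNear E u x ∧
      ∀ j, deriv x (b j x) u = if j = i then 1 else 0 := by
    intro i
    obtain ⟨ℓ, hℓ⟩ := LinearMap.exists_extend (p := Submodule.span ℂ (Set.range fun i => b i x))
      ((Module.Basis.span hli).coord i)
    obtain ⟨u, hu, -, hd⟩ := exists_smoothNear_deriv_eq ℓ 0
    refine ⟨u, hu, fun j => ?_⟩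
    have hj : b j x ∈ Submodule.span ℂ (Set.range fun i => b i x) :=
      Submodule.subset_span ⟨j, rfl⟩
    have h1 : ℓ (b j x) = (Module.Basis.span hli).coord i ⟨b j x, hj⟩ := by rw [← hℓ]; rfl
    have h2 : (⟨b j x, hj⟩ : Submodule.span ℂ (Set.range fun i => b i x)) =
        Module.Basis.span hli j := by
      apply Subtype.ext
      rw [Module.Basis.span_apply]
    rw [hd, h1, h2, Module.Basis.coord_apply, Module.Basis.repr_self, Finsupp.single_apply]
  choose u hu hd using hfun
  -- The functions `u j` are dual to the fields at `x`, so this matrix is the identity at `x` and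
  -- invertible nearby. Solving the linear system it defines expresses the coefficients through the
  -- smooth functions `X(u j)`.
  let Gm : M → Matrix ι ι ℂ := fun y => Matrix.of fun i j => deriv y (b i y) (u j)
  have hG : ∀ i j, SmoothNear E (fun y => Gm y i j) x := fun i j => (hu j).deriv (hb i)
  have hGx : Gm x = 1 := by
    ext i j
    simp only [Gm, Matrix.of_apply, hd, Matrix.one_apply]
  have hdet : IsUnit (Gm x).det := by rw [hGx]; simp
  have hinv : ∀ i j, SmoothNear E (fun y => (Gm y)⁻¹ i j) x := fun i j => .matrix_inv hG hdet i j
  refine ⟨fun i y => ∑ j, deriv y (X y) (u j) * (Gm y)⁻¹ j i,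
    fun i => .sum fun j _ => ((hu j).deriv hX).mul (hinv j i), ?_⟩
  have hdet' : ∀ᶠ y in 𝓝 x, (Gm y).det ≠ 0 :=
    (SmoothNear.det hG).self_of_nhds.continuousAt.eventually_ne hdet.ne_zero
  filter_upwards [hmem, hdet'] with y hy hy'
  obtain ⟨a, ha⟩ := (Submodule.mem_span_range_iff_exists_fun ℂ).1 hy
  have h1 : (fun j => deriv y (X y) (u j)) = a ᵥ* Gm y := by
    ext j
    rw [← ha, deriv_sum_vec]
    simp only [deriv_smul_vec, Matrix.vecMul, dotProduct, Gm, Matrix.of_apply]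
  have h2 : (fun i => ∑ j, deriv y (X y) (u j) * (Gm y)⁻¹ j i) = a := by
    change (fun j => deriv y (X y) (u j)) ᵥ* (Gm y)⁻¹ = a
    rw [h1, Matrix.vecMul_vecMul, Matrix.mul_nonsing_inv _ (isUnit_iff_ne_zero.2 hy'),
      Matrix.vecMul_one]
  refine ha.symm.trans (Finset.sum_congr rfl fun i _ => ?_)
  exact congrArg (· • b i y) (congrFun h2 i).symm

end Frames

/-! ### Frames, local sections and direct sums of distributions -/

section Frames

variable {E : Type*} [NormedAddCommGroup E] [NormedSpace ℝ E] [FiniteDimensional ℝ E]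
  {M : Type*} [TopologicalSpace M] [ChartedSpace E M] [IsManifold 𝓘(ℝ, E) ∞ M]
  {x : M}

/-- `b` is a smooth frame of `D` on a neighbourhood of `x`. -/
def IsFrameNear {ι : Type*} (D : Distribution E M) (b : ι → CField E M) (x : M) : Prop :=
  ∀ᶠ y in 𝓝 x, (∀ i, SmoothFieldAt (b i) y) ∧ LinearIndependent ℂ (fun i => b i y) ∧
    Submodule.span ℂ (Set.range fun i => b i y) = D y

/-- The conjugate distribution. -/
def conjDist (D : Distribution E M) : Distribution E M := fun x => conjSub (D x)

/-- The sum of two distributions. -/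
def supDist (D D' : Distribution E M) : Distribution E M := fun x => D x ⊔ D' x

variable {ι κ : Type*} {D D' : Distribution E M} {b : ι → CField E M} {b' : κ → CField E M}
  {X Y : CField E M}

theorem IsLocalSection.eventually (h : IsLocalSection D X x) :
    ∀ᶠ y in 𝓝 x, IsLocalSection D X y :=
  eventually_eventually_nhds.2 h

theorem IsFrameNear.smooth [Finite ι] (h : IsFrameNear D b x) (i : ι) :
    SmoothFieldNear (b i) x := by
  filter_upwards [h] with y hy using hy.1 i

theorem IsFrameNear.isLocalSection (h : IsFrameNear D b x) (i : ι) :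
    IsLocalSection D (b i) x := by
  filter_upwards [h] with y hy
  exact ⟨hy.1 i, hy.2.2 ▸ Submodule.subset_span ⟨i, rfl⟩⟩

theorem IsLocalSection.smooth (h : IsLocalSection D X x) : SmoothFieldNear X x := by
  filter_upwards [h] with y hy using hy.1

theorem IsLocalSection.mem (h : IsLocalSection D X x) : X x ∈ D x := h.self_of_nhds.2

theorem isLocalSection_iff : IsLocalSection D X x ↔
    SmoothFieldNear X x ∧ ∀ᶠ y in 𝓝 x, X y ∈ D y := eventually_and

theorem IsLocalSection.mono (h : IsLocalSection D X x) (hD : ∀ᶠ y in 𝓝 x, D y ≤ D' y) :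
    IsLocalSection D' X x := by
  filter_upwards [h, hD] with y hy hle using ⟨hy.1, hle hy.2⟩

theorem IsLocalSection.add (hX : IsLocalSection D X x) (hY : IsLocalSection D Y x) :
    IsLocalSection D (fun y => X y + Y y) x := by
  refine isLocalSection_iff.2 ⟨hX.smooth.add hY.smooth, ?_⟩
  filter_upwards [hX, hY] with y h₁ h₂ using add_mem h₁.2 h₂.2

theorem IsLocalSection.sub (hX : IsLocalSection D X x) (hY : IsLocalSection D Y x) :
    IsLocalSection D (fun y => X y - Y y) x := by
  refine isLocalSection_iff.2 ⟨hX.smooth.sub hY.smooth, ?_⟩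
  filter_upwards [hX, hY] with y h₁ h₂ using sub_mem h₁.2 h₂.2

theorem isLocalSection_zero : IsLocalSection D (fun _ => 0) x :=
  isLocalSection_iff.2 ⟨smoothFieldNear_zero, Eventually.of_forall fun y => (D y).zero_mem⟩

theorem IsLocalSection.smul {u : M → ℂ} (hu : SmoothNear E u x) (hX : IsLocalSection D X x) :
    IsLocalSection D (fun y => u y • X y) x := by
  refine isLocalSection_iff.2 ⟨.smul hu hX.smooth, ?_⟩
  filter_upwards [hX] with y h₁ using Submodule.smul_mem _ _ h₁.2

theorem IsLocalSection.const_smul (c : ℂ) (hX : IsLocalSection D X x) :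
    IsLocalSection D (fun y => c • X y) x := .smul (smoothNear_const c) hX

theorem IsLocalSection.sum {t : Finset ι} {X : ι → CField E M}
    (hX : ∀ i ∈ t, IsLocalSection D (X i) x) :
    IsLocalSection D (fun y => ∑ i ∈ t, X i y) x := by
  refine isLocalSection_iff.2 ⟨.sum fun i hi => (hX i hi).smooth, ?_⟩
  have h : ∀ᶠ y in 𝓝 x, ∀ i ∈ t, X i y ∈ D y :=
    (eventually_all_finset t).2 fun i hi => (isLocalSection_iff.1 (hX i hi)).2
  filter_upwards [h] with y hy using Submodule.sum_mem _ hy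

theorem IsLocalSection.conj (hX : IsLocalSection D X x) :
    IsLocalSection (conjDist D) (conjField X) x := by
  refine isLocalSection_iff.2 ⟨hX.smooth.conj, ?_⟩
  filter_upwards [hX] with y h₁ using conj_mem_conjSub h₁.2

theorem IsLocalSection.conj' (hX : IsLocalSection (conjDist D) X x) :
    IsLocalSection D (conjField X) x := by
  refine isLocalSection_iff.2 ⟨hX.smooth.conj, ?_⟩
  filter_upwards [hX] with y h₁ using h₁.2

theorem IsFrameNear.coeff [Fintype ι] (h : IsFrameNear D b x) (hX : IsLocalSection D X x) :
    ∃ c : ι → M → ℂ, (∀ i, SmoothNear E (c i) x) ∧ ∀ᶠ y in 𝓝 x, X y = ∑ i, c i y • b i y := by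
  refine exists_smooth_coeff h.smooth h.self_of_nhds.2.1 hX.smooth ?_
  filter_upwards [h, hX] with y h₁ h₂
  rw [h₁.2.2]
  exact h₂.2

theorem IsFrameNear.sum (h : IsFrameNear D b x) (h' : IsFrameNear D' b' x)
    (hd : ∀ᶠ y in 𝓝 x, D y ⊓ D' y = ⊥) : IsFrameNear (supDist D D') (Sum.elim b b') x := by
  filter_upwards [h, h', hd] with y h₁ h₂ h₃
  have he : (fun i => Sum.elim b b' i y) = Sum.elim (fun i => b i y) fun i => b' i y := by
    ext (i | i) <;> rfl
  refine ⟨?_, ?_, ?_⟩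
  · rintro (i | i)
    exacts [h₁.1 i, h₂.1 i]
  · rw [he]
    refine h₁.2.1.sum_type h₂.2.1 ?_
    rw [h₁.2.2, h₂.2.2, disjoint_iff, h₃]
  · rw [he, Set.Sum.elim_range, Submodule.span_union, h₁.2.2, h₂.2.2, supDist]

theorem IsFrameNear.conj (h : IsFrameNear D b x) :
    IsFrameNear (conjDist D) (fun i => conjField (b i)) x := by
  filter_upwards [h] with y h₁
  refine ⟨fun i => ?_, ?_, ?_⟩
  · have h2 := h₁.1 i
    constructor
    · simpa only [conjField, re_conj] using h2.1
    · simp only [conjField, im_conj]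
      exact h2.2.neg_section
  · have h2 := h₁.2.1
    rw [linearIndependent_iff'] at h2 ⊢
    intro t c hc i hi
    have h3 := congrArg CRSymbol.conj hc
    simp only [conjField, conj_sum, conj_smul, conj_conj, map_zero] at h3
    have h4 := h2 t (fun i => (starRingEnd ℂ) (c i)) h3 i hi
    simpa using h4
  · rw [conjDist, ← h₁.2.2]
    apply le_antisymm
    · rw [Submodule.span_le]
      rintro _ ⟨i, rfl⟩
      exact conj_mem_conjSub (Submodule.subset_span ⟨i, rfl⟩)
    · suffices h3 : ∀ w ∈ Submodule.span ℂ (Set.range fun i => b i y), CRSymbol.conj w ∈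
          Submodule.span ℂ (Set.range fun i => conjField (b i) y) by
        intro v hv
        rw [← conj_conj v]
        exact h3 _ hv
      intro w hv
      induction hv using Submodule.span_induction with
      | mem w hw =>
        obtain ⟨i, rfl⟩ := hw
        exact Submodule.subset_span ⟨i, rfl⟩
      | zero => rw [map_zero]; exact Submodule.zero_mem _
      | add a b _ _ ha hb => rw [map_add]; exact Submodule.add_mem _ ha hb
      | smul c a _ ha => rw [conj_smul]; exact Submodule.smul_mem _ _ ha

/-- The components are smooth because they are cut out of one expansion in the joint frame. -/
theorem IsLocalSection.exists_add [Fintype ι] [Fintype κ] (h : IsFrameNear D b x)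
    (h' : IsFrameNear D' b' x) (hd : ∀ᶠ y in 𝓝 x, D y ⊓ D' y = ⊥)
    (hX : IsLocalSection (supDist D D') X x) :
    ∃ Y Z : CField E M, IsLocalSection D Y x ∧ IsLocalSection D' Z x ∧
      ∀ᶠ y in 𝓝 x, X y = Y y + Z y := by
  obtain ⟨c, hc, hX⟩ := (h.sum h' hd).coeff hX
  refine ⟨fun y => ∑ i, c (Sum.inl i) y • b i y, fun y => ∑ i, c (Sum.inr i) y • b' i y,
    .sum fun i _ => .smul (hc _) (h.isLocalSection i),
    .sum fun i _ => .smul (hc _) (h'.isLocalSection i), ?_⟩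
  filter_upwards [hX] with y hy
  rw [hy, Fintype.sum_sum_type]
  rfl

end Frames

/-! ### The Levi form is tensorial with kernel `K₂` -/

section LeviKernel

variable {E : Type*} [NormedAddCommGroup E] [NormedSpace ℝ E] [FiniteDimensional ℝ E]
  {M : Type*} [TopologicalSpace M] [ChartedSpace E M] [IsManifold 𝓘(ℝ, E) ∞ M]
  {x : M} {n s r : ℕ} {H : Distribution E M} {φ : GradedFrame E M s} {e : Fin r → CField E M}
  {X Y Z X' Y' : CField E M}

/-- The contact distribution `H ⊕ conj H`. -/
abbrev contactDist (H : Distribution E M) : Distribution E M := supDist H (conjDist H)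

/-- The complexified Levi foliation `K₂ ⊕ conj K₂`. -/
abbrev leafDist (H : Distribution E M) : Distribution E M :=
  supDist (freeman H 2) (conjDist (freeman H 2))

theorem IsCRHypersurface.exists_frame (hH : IsCRHypersurface n H) (x : M) :
    ∃ b : Fin n → CField E M, IsFrameNear H b x := hH.subbundle x

theorem IsCRHypersurface.eventually_disjoint (hH : IsCRHypersurface n H) (x : M) :
    ∀ᶠ y in 𝓝 x, H y ⊓ conjDist H y = ⊥ := Eventually.of_forall hH.disjoint

theorem freeman_two_le (H : Distribution E M) (x : M) : freeman H 2 x ≤ H x := by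
  change Submodule.span ℂ _ ≤ _
  rw [Submodule.span_le]
  rintro v ⟨X, hX, rfl, -⟩
  exact hX.mem

theorem conj_mem_contactDist {v : CTangent E x} (h : v ∈ contactDist H x) :
    conj v ∈ contactDist H x := conj_mem_sup h

theorem mem_contactDist_left {v : CTangent E x} (h : v ∈ H x) : v ∈ contactDist H x :=
  Submodule.mem_sup_left h

theorem conjSub_mono {V : Type*} [AddCommGroup V] [Module ℝ V] {W W' : Submodule ℂ (ℂ ⊗[ℝ] V)}
    (h : W ≤ W') : conjSub W ≤ conjSub W' := fun _ hv => h hv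

theorem leafDist_le_contactDist (H : Distribution E M) (x : M) :
    leafDist H x ≤ contactDist H x :=
  sup_le_sup (freeman_two_le H x) (conjSub_mono (freeman_two_le H x))

theorem IsLocalSection.to_contact (hX : IsLocalSection H X x) :
    IsLocalSection (contactDist H) X x :=
  hX.mono (Eventually.of_forall fun _ => le_sup_left)

theorem IsLocalSection.conj_to_contact (hX : IsLocalSection H X x) :
    IsLocalSection (contactDist H) (conjField X) x :=
  hX.conj.mono (Eventually.of_forall fun _ => le_sup_right)

theorem IsLocalSection.of_kernel (hX : IsLocalSection (freeman H 2) X x) :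
    IsLocalSection H X x :=
  hX.mono (Eventually.of_forall fun y => freeman_two_le H y)

/-- The coefficients of `X` in a frame of `H` vanish at `x`, so the Leibniz rule leaves only terms
in `H`. This is the tensoriality of the Levi form. -/
theorem IsCRHypersurface.bracket_conj_mem_of_eq_zero (hH : IsCRHypersurface n H)
    (hX : IsLocalSection H X x) (hY : IsLocalSection H Y x) (h0 : X x = 0) :
    bracket X (conjField Y) x ∈ contactDist H x := by
  obtain ⟨b, hb⟩ := hH.exists_frame x
  obtain ⟨c, hc, hXc⟩ := hb.coeff hX
  have hc0 : ∀ i, c i x = 0 := by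
    have h1 := hXc.self_of_nhds
    rw [h0] at h1
    exact Fintype.linearIndependent_iff.1 hb.self_of_nhds.2.1 (fun i => c i x) h1.symm
  rw [bracket_congr hX.smooth hY.smooth.conj hXc (Eventually.of_forall fun _ => rfl),
    bracket_sum_left hY.smooth.conj (fun i _ => hb.smooth i) fun i _ => hc i]
  refine Submodule.sum_mem _ fun i _ => ?_
  rw [hc0, zero_smul, zero_sub]
  exact neg_mem (Submodule.smul_mem _ _ (mem_contactDist_left (hb.isLocalSection i).mem))

/-- `freeman H 2 x` is a span of values of special sections. Tensoriality transfers their bracket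
condition to every section of `H` with the given value at the single point `x`. -/
theorem IsCRHypersurface.bracket_kernel_conj_mem (hH : IsCRHypersurface n H)
    (hX : IsLocalSection H X x) (hY : IsLocalSection H Y x) (hK : X x ∈ freeman H 2 x) :
    bracket X (conjField Y) x ∈ contactDist H x := by
  -- The difference `X - X'` vanishes at `x`, so it is enough to build, by induction over the span,
  -- one section with the right value.
  suffices h : ∃ X' : CField E M, IsLocalSection H X' x ∧ X' x = X x ∧
      bracket X' (conjField Y) x ∈ contactDist H x by
    obtain ⟨X', hX', hXX', hmem⟩ := h
    have h1 := hH.bracket_conj_mem_of_eq_zero (hX.sub hX') hY (by simp [hXX'])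
    have h2 := bracket_add_left (hX'.smooth) (hX.sub hX').smooth hY.smooth.conj
    simp only [add_sub_cancel] at h2
    change bracket (fun y => X y) (conjField Y) x ∈ _
    rw [h2]
    exact add_mem hmem h1
  change X x ∈ Submodule.span ℂ _ at hK
  generalize X x = v at hK
  induction hK using Submodule.span_induction with
  | mem v hv =>
    obtain ⟨X', hX', hv, hbr⟩ := hv
    exact ⟨X', hX', hv, hbr [Y] rfl (by simpa using hY)⟩
  | zero =>
    refine ⟨fun _ => 0, isLocalSection_zero, rfl, ?_⟩
    exact hH.bracket_conj_mem_of_eq_zero isLocalSection_zero hY rfl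
  | add a b _ _ ha hb =>
    obtain ⟨A, hA, rfl, hAm⟩ := ha
    obtain ⟨B, hB, rfl, hBm⟩ := hb
    refine ⟨_, hA.add hB, rfl, ?_⟩
    rw [bracket_add_left hA.smooth hB.smooth hY.smooth.conj]
    exact add_mem hAm hBm
  | smul c a _ ha =>
    obtain ⟨A, hA, rfl, hAm⟩ := ha
    refine ⟨_, hA.const_smul c, rfl, ?_⟩
    rw [bracket_smul_left hA.smooth hY.smooth.conj (smoothNear_const c), deriv_const, zero_smul,
      sub_zero]
    exact Submodule.smul_mem _ _ hAm

theorem IsCRHypersurface.exists_contact_decomp (hH : IsCRHypersurface n H)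
    (hX : IsLocalSection (contactDist H) X x) :
    ∃ Y Z : CField E M, IsLocalSection H Y x ∧ IsLocalSection H Z x ∧
      ∀ᶠ y in 𝓝 x, X y = Y y + conjField Z y := by
  obtain ⟨b, hb⟩ := hH.exists_frame x
  obtain ⟨Y, Z, hY, hZ, h⟩ := hX.exists_add hb hb.conj (hH.eventually_disjoint x)
  refine ⟨Y, conjField Z, hY, hZ.conj', ?_⟩
  filter_upwards [h] with y hy
  rw [hy, conjField, conjField, conj_conj]

theorem eq_of_add_eq_add_of_disjoint {V : Type*} [AddCommGroup V] [Module ℂ V]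
    {W W' : Submodule ℂ V} (hd : W ⊓ W' = ⊥) {a a' b b' : V} (ha : a ∈ W) (ha' : a' ∈ W)
    (hb : b ∈ W') (hb' : b' ∈ W') (h : a + b = a' + b') : a = a' ∧ b = b' := by
  have h1 : a - a' = b' - b := by
    rw [sub_eq_sub_iff_add_eq_add, h, add_comm]
  have h2 : a - a' ∈ W ⊓ W' := ⟨sub_mem ha ha', h1 ▸ sub_mem hb' hb⟩
  rw [hd, Submodule.mem_bot] at h2
  refine ⟨sub_eq_zero.1 h2, ?_⟩
  rw [h2] at h1
  exact (sub_eq_zero.1 h1.symm).symm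

/-- Split both fields into parts in `H` and `conj H`: the unmixed brackets are controlled by
involutivity, the mixed ones by the Levi kernel, directly or after conjugation. -/
theorem IsCRHypersurface.bracket_leaf_mem (hH : IsCRHypersurface n H)
    (hX : IsLocalSection (contactDist H) X x) (hY : IsLocalSection (contactDist H) Y x)
    (hK : X x ∈ leafDist H x) : bracket X Y x ∈ contactDist H x := by
  obtain ⟨X₁, X₂, hX₁, hX₂, hXd⟩ := hH.exists_contact_decomp hX
  obtain ⟨Y₁, Y₂, hY₁, hY₂, hYd⟩ := hH.exists_contact_decomp hY
  obtain ⟨a, ha, b, hb, hab⟩ := Submodule.mem_sup.1 hK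
  obtain ⟨h₁, h₂⟩ := eq_of_add_eq_add_of_disjoint (hH.disjoint x) (freeman_two_le H x ha) hX₁.mem
    (conjSub_mono (freeman_two_le H x) hb) (conj_mem_conjSub hX₂.mem)
    (hab.trans hXd.self_of_nhds)
  have hk₁ : X₁ x ∈ freeman H 2 x := h₁ ▸ ha
  have hk₂ : X₂ x ∈ freeman H 2 x := by
    have h3 : conj b ∈ freeman H 2 x := hb
    rwa [h₂, conj_conj] at h3
  have e₁ := hX₁.smooth
  have e₂ := hX₂.smooth
  have e₃ := hY₁.smooth
  have e₄ := hY₂.smooth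
  rw [bracket_congr hX.smooth hY.smooth hXd hYd, bracket_add_left e₁ e₂.conj (e₃.add e₄.conj),
    bracket_add_right e₁ e₃ e₄.conj, bracket_add_right e₂.conj e₃ e₄.conj]
  refine add_mem (add_mem ?_ ?_) (add_mem ?_ ?_)
  · exact mem_contactDist_left (hH.involutive x _ _ hX₁ hY₁)
  · exact hH.bracket_kernel_conj_mem hX₁ hY₂ hk₁
  · have h3 : bracket (conjField X₂) Y₁ x = conj (bracket X₂ (conjField Y₁) x) := by
      rw [← bracket_conj e₂ e₃.conj]
      congr 1
      ext y
      exact (conj_conj _).symm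
    rw [h3]
    exact conj_mem_contactDist (hH.bracket_kernel_conj_mem hX₂ hY₁ hk₂)
  · rw [bracket_conj e₂ e₄]
    exact conj_mem_contactDist (mem_contactDist_left (hH.involutive x _ _ hX₂ hY₂))

theorem IsCRHypersurface.bracket_leaf_mem_right (hH : IsCRHypersurface n H)
    (hX : IsLocalSection (contactDist H) X x) (hY : IsLocalSection (contactDist H) Y x)
    (hK : Y x ∈ leafDist H x) : bracket X Y x ∈ contactDist H x := by
  rw [bracket_swap hX.smooth hY.smooth]
  exact neg_mem (hH.bracket_leaf_mem hY hX hK)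

/-- Modulo `H ⊕ conj H`, the bracket of sections of `H ⊕ conj H` only depends on their values
modulo `K₂ ⊕ conj K₂`. -/
theorem IsCRHypersurface.bracket_sub_bracket_mem (hH : IsCRHypersurface n H)
    (hX : IsLocalSection (contactDist H) X x) (hX' : IsLocalSection (contactDist H) X' x)
    (hY : IsLocalSection (contactDist H) Y x) (hY' : IsLocalSection (contactDist H) Y' x)
    (h₁ : X x - X' x ∈ leafDist H x) (h₂ : Y x - Y' x ∈ leafDist H x) :
    bracket X Y x - bracket X' Y' x ∈ contactDist H x := by
  have h3 := hH.bracket_leaf_mem (hX.sub hX') hY h₁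
  have h4 := hH.bracket_leaf_mem_right hX' (hY.sub hY') h₂
  have h5 := bracket_add_left hX'.smooth (hX.sub hX').smooth hY.smooth
  have h6 := bracket_add_right hX'.smooth hY'.smooth (hY.sub hY').smooth
  simp only [add_sub_cancel] at h5 h6
  have h7 : bracket X Y x - bracket X' Y' x =
      bracket (fun y => X y - X' y) Y x + bracket X' (fun y => Y y - Y' y) x := by
    change bracket (fun y => X y) Y x - _ = _
    rw [h5]
    change bracket X' (fun y => Y y) x + _ - _ = _
    rw [h6]
    abel
  rw [h7]
  exact add_mem h3 h4

/-- The bracket of linear combinations with constant coefficients. -/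
theorem bracket_combination {ι κ : Type*} [Fintype ι] [Fintype κ] {F : ι → CField E M}
    {G : κ → CField E M} (hF : ∀ i, SmoothFieldNear (F i) x) (hG : ∀ i, SmoothFieldNear (G i) x)
    (a : ι → ℂ) (b : κ → ℂ) :
    bracket (fun y => ∑ i, a i • F i y) (fun y => ∑ j, b j • G j y) x =
      ∑ i, ∑ j, (a i * b j) • bracket (F i) (G j) x := by
  have h := bracket_sum_left (x := x) (v := fun i _ => a i) (Y := F) (t := Finset.univ)
    (X := fun y => ∑ j, b j • G j y) (.sum fun j _ => (hG j).const_smul _) (fun i _ => hF i)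
    fun i _ => smoothNear_const _
  rw [h]
  refine Finset.sum_congr rfl fun i _ => ?_
  have h' := bracket_sum_right (x := x) (v := fun j _ => b j) (Y := G) (t := Finset.univ)
    (hF i) (fun j _ => hG j) fun j _ => smoothNear_const _
  rw [h', deriv_const, zero_smul, sub_zero, Finset.smul_sum]
  refine Finset.sum_congr rfl fun j _ => ?_
  rw [deriv_const, zero_smul, add_zero, smul_smul]

/-- Freezing the coefficients at `x` is allowed because the bracket modulo `H ⊕ conj H` depends on
values only; this avoids derivatives of coefficients. -/
theorem IsCRHypersurface.bracket_sub_combination_mem {ι κ : Type*} [Fintype ι] [Fintype κ]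
    (hH : IsCRHypersurface n H) {F : ι → CField E M} {G : κ → CField E M}
    (hF : ∀ i, IsLocalSection (contactDist H) (F i) x)
    (hG : ∀ i, IsLocalSection (contactDist H) (G i) x)
    (hX : IsLocalSection (contactDist H) X x) (hY : IsLocalSection (contactDist H) Y x)
    (a : ι → ℂ) (b : κ → ℂ) (h₁ : X x - ∑ i, a i • F i x ∈ leafDist H x)
    (h₂ : Y x - ∑ j, b j • G j x ∈ leafDist H x) :
    bracket X Y x - ∑ i, ∑ j, (a i * b j) • bracket (F i) (G j) x ∈ contactDist H x := by
  rw [← bracket_combination (fun i => (hF i).smooth) (fun i => (hG i).smooth)]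
  exact hH.bracket_sub_bracket_mem hX (.sum fun i _ => (hF i).const_smul _) hY
    (.sum fun i _ => (hG i).const_smul _) h₁ h₂

end LeviKernel

/-- `coords` is an arbitrary choice of coefficients; independence of `b` modulo `W` makes the choice
unique. Every evaluation of `leviMatrix`, `xiMatrix` and `iotaLeaf` goes through this. -/
theorem coords_eq {ι V : Type*} [Fintype ι] [AddCommGroup V] [Module ℂ V] {b : ι → V}
    {W : Submodule ℂ V} (hb : ∀ c : ι → ℂ, ∑ i, c i • b i ∈ W → c = 0) {w : V} {c : ι → ℂ}
    (hc : w - ∑ i, c i • b i ∈ W) : coords b W w = c := by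
  have h : w - ∑ i, coords b W w i • b i ∈ W :=
    Classical.epsilon_spec (p := fun c : ι → ℂ => w - ∑ i, c i • b i ∈ W) ⟨c, hc⟩
  have h2 : coords b W w - c = 0 := by
    apply hb
    have h3 : ∑ i, (coords b W w - c) i • b i =
        (w - ∑ i, c i • b i) - (w - ∑ i, coords b W w i • b i) := by
      simp only [Pi.sub_apply, sub_smul, Finset.sum_sub_distrib]
      abel
    rw [h3]
    exact sub_mem hc h
  exact sub_eq_zero.1 h2

/-! ### Adapted frames and the Levi matrix -/

section GradedFrames

variable {E : Type*} [NormedAddCommGroup E] [NormedSpace ℝ E] [FiniteDimensional ℝ E]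
  {M : Type*} [TopologicalSpace M] [ChartedSpace E M] [IsManifold 𝓘(ℝ, E) ∞ M]
  {x : M} {n s r : ℕ} {H : Distribution E M} {φ : GradedFrame E M s} {e : Fin r → CField E M}
  {X Y Z X' Y' : CField E M}

theorem IsSectionNear.eventually (h : IsSectionNear H x φ) : ∀ᶠ y in 𝓝 x, IsSectionNear H y φ :=
  eventually_eventually_nhds.2 h

theorem IsKernelFrameNear.eventually (h : IsKernelFrameNear H x e) :
    ∀ᶠ y in 𝓝 x, IsKernelFrameNear H y e :=
  eventually_eventually_nhds.2 h

theorem IsKernelFrameNear.frame (h : IsKernelFrameNear H x e) :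
    IsFrameNear (freeman H 2) e x := h

theorem IsSectionNear.smooth_g (h : IsSectionNear H x φ) : SmoothFieldNear φ.g x := by
  filter_upwards [h] with y hy using hy.1

theorem IsSectionNear.isLocalSection (h : IsSectionNear H x φ) (j : Fin s) :
    IsLocalSection H (φ.f j) x := by
  filter_upwards [h] with y hy
  refine ⟨hy.2.1 j, ?_⟩
  rw [← hy.2.2.f_span]
  exact Submodule.mem_sup_left (Submodule.subset_span ⟨j, rfl⟩)

theorem IsSectionNear.at (h : IsSectionNear H x φ) : IsGradedFrameAt H φ x := h.self_of_nhds.2.2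

theorem IsGradedFrameAt.eq_zero_of_smul_mem (h : IsGradedFrameAt H φ x) {c : ℂ}
    (hc : c • φ.g x ∈ contactDist H x) : c = 0 := by
  by_contra h0
  refine h.g_notMem ?_
  have := Submodule.smul_mem _ c⁻¹ hc
  rwa [smul_smul, inv_mul_cancel₀ h0, one_smul] at this

theorem IsGradedFrameAt.eq_of_sub_mem (h : IsGradedFrameAt H φ x) {c d : ℂ} {v : CTangent E x}
    (hc : v - c • φ.g x ∈ contactDist H x) (hd : v - d • φ.g x ∈ contactDist H x) : c = d := by
  have h1 := sub_mem hd hc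
  rw [sub_sub_sub_cancel_left, ← sub_smul] at h1
  exact sub_eq_zero.1 (h.eq_zero_of_smul_mem h1)

/-- The distribution spanned by `f₁, …, f_s`. -/
def frameDist (φ : GradedFrame E M s) : Distribution E M :=
  fun y => Submodule.span ℂ (Set.range fun j => φ.f j y)

theorem IsGradedFrameAt.eq_zero_of_sum_mem (h : IsGradedFrameAt H φ x) {c : Fin s → ℂ}
    (hc : ∑ j, c j • φ.f j x ∈ freeman H 2 x) : c = 0 := by
  have h1 := Fintype.linearIndependent_iff.1 h.f_indep c
  have h2 : ∑ j, c j • (freeman H 2 x).mkQ (φ.f j x) = 0 := by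
    rw [← (Submodule.Quotient.mk_eq_zero _).2 hc]
    simp [← Submodule.mkQ_apply]
  exact funext fun j => h1 h2 j

/-- Since `H ∩ conj H = 0`, the `conj H` component cannot contribute, and independence modulo `K₂`
applies. -/
theorem IsCRHypersurface.eq_zero_of_sum_mem (hH : IsCRHypersurface n H)
    (h : IsGradedFrameAt H φ x) {c : Fin s → ℂ}
    (hc : ∑ j, c j • φ.f j x ∈ freeman H 2 x ⊔ conjSub (H x)) : c = 0 := by
  refine h.eq_zero_of_sum_mem ?_
  obtain ⟨a, ha, b, hb, hab⟩ := Submodule.mem_sup.1 hc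
  have hmem : ∑ j, c j • φ.f j x ∈ H x := by
    rw [← h.f_span]
    exact Submodule.mem_sup_left (Submodule.sum_mem _ fun j _ =>
      Submodule.smul_mem _ _ (Submodule.subset_span ⟨j, rfl⟩))
  have h1 := eq_of_add_eq_add_of_disjoint (hH.disjoint x) (freeman_two_le H x ha) hmem hb
    (zero_mem _) (by rw [hab, add_zero])
  rw [← h1.1]
  exact ha

theorem IsSectionNear.frame (h : IsSectionNear H x φ) : IsFrameNear (frameDist φ) φ.f x := by
  filter_upwards [h] with y hy
  exact ⟨hy.2.1, LinearIndependent.of_comp _ hy.2.2.f_indep, rfl⟩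

theorem IsGradedFrameAt.disjoint (h : IsGradedFrameAt H φ x) :
    frameDist φ x ⊓ freeman H 2 x = ⊥ := by
  rw [Submodule.eq_bot_iff]
  rintro v ⟨hv, hv'⟩
  obtain ⟨c, rfl⟩ := (Submodule.mem_span_range_iff_exists_fun ℂ).1 hv
  simp [h.eq_zero_of_sum_mem hv']

theorem IsGradedFrameAt.exists_coeff (h : IsGradedFrameAt H φ x) {v : CTangent E x}
    (hv : v ∈ H x) : ∃ c : Fin s → ℂ, v - ∑ j, c j • φ.f j x ∈ freeman H 2 x := by
  rw [← h.f_span] at hv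
  obtain ⟨a, ha, b, hb, rfl⟩ := Submodule.mem_sup.1 hv
  obtain ⟨c, rfl⟩ := (Submodule.mem_span_range_iff_exists_fun ℂ).1 ha
  exact ⟨c, by simpa using hb⟩

/-- Sections of `H` decompose smoothly along `f₁, …, f_s` modulo `K₂`. -/
theorem IsSectionNear.exists_smooth_coeff (hφ : IsSectionNear H x φ)
    (he : IsKernelFrameNear H x e) (hX : IsLocalSection H X x) :
    ∃ c : Fin s → M → ℂ, (∀ j, SmoothNear E (c j) x) ∧
      IsLocalSection (freeman H 2) (fun y => X y - ∑ j, c j y • φ.f j y) x := by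
  have hd : ∀ᶠ y in 𝓝 x, frameDist φ y ⊓ freeman H 2 y = ⊥ := by
    filter_upwards [hφ] with y hy using hy.2.2.disjoint
  have hX' : IsLocalSection (supDist (frameDist φ) (freeman H 2)) X x := by
    refine hX.mono ?_
    filter_upwards [hφ] with y hy using hy.2.2.f_span.ge
  obtain ⟨Y, Z, hY, hZ, hYZ⟩ := hX'.exists_add hφ.frame he.frame hd
  obtain ⟨c, hc, hYc⟩ := hφ.frame.coeff hY
  refine ⟨c, hc, isLocalSection_iff.2 ⟨hX.smooth.sub (.sum fun j _ => .smul (hc j)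
    (hφ.frame.smooth j)), ?_⟩⟩
  filter_upwards [hYZ, hYc, hZ] with y h₁ h₂ h₃
  rw [h₁, ← h₂, add_sub_cancel_left]
  exact h₃.2

/-- Every smooth field is a smooth multiple of `g` modulo `H ⊕ conj H`. -/
theorem IsCRHypersurface.exists_g_coeff (hH : IsCRHypersurface n H) (hφ : IsSectionNear H x φ)
    (hX : SmoothFieldNear X x) :
    ∃ a : M → ℂ, SmoothNear E a x ∧ ∀ᶠ y in 𝓝 x, X y - a y • φ.g y ∈ contactDist H y := by
  obtain ⟨b, hb⟩ := hH.exists_frame x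
  have hg : IsFrameNear (fun y => Submodule.span ℂ {φ.g y}) (fun _ : Unit => φ.g) x := by
    filter_upwards [hφ] with y hy
    refine ⟨fun _ => hy.1, ?_, by simp⟩
    rw [linearIndependent_unique_iff]
    intro h0
    exact hy.2.2.g_notMem (h0 ▸ zero_mem _)
  have hd : ∀ᶠ y in 𝓝 x, (Submodule.span ℂ {φ.g y}) ⊓ contactDist H y = ⊥ := by
    filter_upwards [hφ] with y hy
    rw [Submodule.eq_bot_iff]
    rintro v ⟨hv, hv'⟩
    obtain ⟨c, rfl⟩ := Submodule.mem_span_singleton.1 hv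
    rw [hy.2.2.eq_zero_of_smul_mem hv', zero_smul]
  have hX' : IsLocalSection (supDist (fun y => Submodule.span ℂ {φ.g y}) (contactDist H)) X x := by
    refine isLocalSection_iff.2 ⟨hX, ?_⟩
    filter_upwards [hφ] with y hy
    have h1 : supDist (fun y => Submodule.span ℂ {φ.g y}) (contactDist H) y = ⊤ := hy.2.2.g_span
    rw [h1]
    trivial
  obtain ⟨Y, Z, hY, hZ, hYZ⟩ := hX'.exists_add hg (hb.sum hb.conj (hH.eventually_disjoint x)) hd
  obtain ⟨c, hc, hYc⟩ := hg.coeff hY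
  refine ⟨c (), hc (), ?_⟩
  filter_upwards [hYZ, hYc, hZ] with y h₁ h₂ h₃
  rw [h₁, h₂]
  simpa using h₃.2

theorem IsGradedFrameAt.exists_coeff_g (h : IsGradedFrameAt H φ x) (v : CTangent E x) :
    ∃ c : ℂ, v - c • φ.g x ∈ contactDist H x := by
  have hv : v ∈ (⊤ : Submodule ℂ (CTangent E x)) := trivial
  rw [← h.g_span] at hv
  obtain ⟨a, ha, b, hb, rfl⟩ := Submodule.mem_sup.1 hv
  obtain ⟨c, rfl⟩ := Submodule.mem_span_singleton.1 ha
  exact ⟨c, by simpa using! hb⟩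

theorem IsGradedFrameAt.leviMatrix_eq (h : IsGradedFrameAt H φ x) {j k : Fin s} {c : ℂ}
    (hc : bracket (φ.f j) (conjField (φ.f k)) x - (2 * Complex.I * c) • φ.g x ∈
      contactDist H x) : leviMatrix H φ x j k = c := by
  have h1 : (1 / (2 * Complex.I)) • bracket (φ.f j) (conjField (φ.f k)) x -
      ∑ i : Unit, (fun _ => c) i • φ.g x ∈ H x ⊔ conjSub (H x) := by
    have h2 := Submodule.smul_mem _ (1 / (2 * Complex.I)) hc
    rw [smul_sub, smul_smul, one_div, inv_mul_cancel_left₀ (by simp)] at h2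
    simpa using! h2
  rw [leviMatrix, Matrix.of_apply, coords_eq ?_ h1]
  intro c hc
  ext i
  exact h.eq_zero_of_smul_mem (by simpa using! hc)

theorem IsGradedFrameAt.leviMatrix_spec (h : IsGradedFrameAt H φ x) (j k : Fin s) :
    bracket (φ.f j) (conjField (φ.f k)) x - (2 * Complex.I * leviMatrix H φ x j k) • φ.g x ∈
      contactDist H x := by
  obtain ⟨c, hc⟩ := h.exists_coeff_g (bracket (φ.f j) (conjField (φ.f k)) x)
  have h1 : c = 2 * Complex.I * (c / (2 * Complex.I)) := by
    rw [mul_div_cancel₀]; simp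
  rw [h1] at hc
  rwa [h.leviMatrix_eq hc]

theorem IsCRHypersurface.smooth_leviMatrix (hH : IsCRHypersurface n H)
    (hφ : IsSectionNear H x φ) (j k : Fin s) :
    SmoothNear E (fun y => leviMatrix H φ y j k) x := by
  obtain ⟨a, ha, h⟩ := hH.exists_g_coeff hφ
    ((hφ.isLocalSection j).smooth.bracket (hφ.isLocalSection k).smooth.conj)
  refine ((smoothNear_const (2 * Complex.I)⁻¹).mul ha).congr ?_
  filter_upwards [h, hφ] with y h₁ h₂
  symm
  apply h₂.2.2.leviMatrix_eq
  rwa [mul_inv_cancel_left₀ (by simp)]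

/-- For `c` in the left kernel, the section `∑ c_j f_j` has brackets with all of `conj H` lying in
`H ⊕ conj H`. Its value is therefore in `K₂` by definition, and independence of the `f_j` modulo
`K₂` forces `c = 0`. -/
theorem IsCRHypersurface.isUnit_leviMatrix (hH : IsCRHypersurface n H)
    (hφ : IsSectionNear H x φ) : IsUnit (leviMatrix H φ x).det := by
  rw [isUnit_iff_ne_zero]
  intro h0
  obtain ⟨c, hc0, hc⟩ := Matrix.exists_vecMul_eq_zero_iff.2 h0
  refine hc0 (hφ.at.eq_zero_of_sum_mem ?_)
  have hf := hφ.isLocalSection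
  have hX : IsLocalSection H (fun y => ∑ j, c j • φ.f j y) x :=
    .sum fun j _ => (hf j).const_smul _
  refine Submodule.subset_span ⟨_, hX, rfl, fun Y hY hYs => ?_⟩
  obtain ⟨W, rfl⟩ := List.length_eq_one_iff.1 hY
  have hW : IsLocalSection H W x := hYs W (by simp)
  change bracket (fun y => ∑ j, c j • φ.f j y) (conjField W) x ∈ contactDist H x
  obtain ⟨w, hw⟩ := hφ.at.exists_coeff hW.mem
  have h1 := hH.bracket_sub_combination_mem (fun j => (hf j).to_contact)
    (fun j => (hf j).conj_to_contact) hX.to_contact hW.conj_to_contact c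
    (fun k => (starRingEnd ℂ) (w k)) (by simp) (by
      have h2 := conj_mem_conjSub hw
      refine Submodule.mem_sup_right ?_
      simpa [conjField, conj_sum, conj_smul] using! h2)
  have h2 : ∑ j, ∑ k, (c j * (starRingEnd ℂ) (w k)) • bracket (φ.f j) (conjField (φ.f k)) x ∈
      contactDist H x := by
    have h3 : ∑ j, ∑ k, (c j * (starRingEnd ℂ) (w k)) • bracket (φ.f j) (conjField (φ.f k)) x =
        ∑ j, ∑ k, (c j * (starRingEnd ℂ) (w k)) • (bracket (φ.f j) (conjField (φ.f k)) x -
          (2 * Complex.I * leviMatrix H φ x j k) • φ.g x) := by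
      have h4 : ∑ j, ∑ k, (c j * (starRingEnd ℂ) (w k)) •
          ((2 * Complex.I * leviMatrix H φ x j k) • φ.g x) = 0 := by
        rw [Finset.sum_comm]
        refine Finset.sum_eq_zero fun k _ => ?_
        have h5 := congrFun hc k
        simp only [Matrix.vecMul, dotProduct, Pi.zero_apply] at h5
        calc _ = ((starRingEnd ℂ) (w k) * (2 * Complex.I) *
            ∑ j, c j * leviMatrix H φ x j k) • φ.g x := by
              rw [Finset.mul_sum, Finset.sum_smul]
              refine Finset.sum_congr rfl fun j _ => ?_
              rw [smul_smul]
              congr 1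
              ring
          _ = 0 := by rw [h5]; simp
      simp only [smul_sub, Finset.sum_sub_distrib]
      rw [h4, sub_zero]
    rw [h3]
    exact Submodule.sum_mem _ fun j _ => Submodule.sum_mem _ fun k _ =>
      Submodule.smul_mem _ _ (hφ.at.leviMatrix_spec j k)
  have h3 := add_mem h1 h2
  rwa [sub_add_cancel] at h3

/-- The Levi form is Hermitian up to a nonvanishing smooth factor. -/
theorem IsCRHypersurface.exists_leviMatrix_eq_smul (hH : IsCRHypersurface n H)
    (hφ : IsSectionNear H x φ) :
    ∃ a : M → ℂ, SmoothNear E a x ∧ a x ≠ 0 ∧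
      ∀ᶠ y in 𝓝 x, leviMatrix H φ y = a y • (leviMatrix H φ y)ᴴ := by
  -- The factor is defined by `conj g ≡ a g` modulo `H ⊕ conj H`. Conjugating the definition of
  -- `A_{jk}` and exchanging the arguments of the bracket gives `A_{kj} = a conj(A_{jk})`.
  obtain ⟨a, ha, h⟩ := hH.exists_g_coeff hφ hφ.smooth_g.conj
  refine ⟨a, ha, fun h0 => ?_, ?_⟩
  · have h1 := h.self_of_nhds
    rw [h0, zero_smul, sub_zero] at h1
    have h2 := conj_mem_contactDist h1
    rw [conjField, conj_conj] at h2
    exact hφ.at.g_notMem h2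
  · filter_upwards [h, hφ, hφ.eventually] with y h₁ h₂ h₃
    ext k j
    rw [Matrix.smul_apply, Matrix.conjTranspose_apply, smul_eq_mul]
    apply h₂.2.2.leviMatrix_eq
    have hj := (h₃.isLocalSection j).smooth
    have hk := (h₃.isLocalSection k).smooth
    have h4 := conj_mem_contactDist (h₂.2.2.leviMatrix_spec j k)
    have h5 : bracket (φ.f k) (conjField (φ.f j)) y =
        - conj (bracket (φ.f j) (conjField (φ.f k)) y) := by
      rw [bracket_swap hk hj.conj, ← bracket_conj hj hk.conj]
      congr 2
      ext z
      exact (conj_conj _).symm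
    rw [map_sub, conj_smul] at h4
    have h6 := Submodule.smul_mem _
      ((starRingEnd ℂ) (2 * Complex.I * leviMatrix H φ y j k)) h₁
    have h7 := neg_mem (add_mem h4 h6)
    rw [h5]
    convert h7 using 1
    rw [smul_sub, conjField, smul_smul]
    simp only [map_mul, Complex.conj_I, map_ofNat]
    have h8 : (2 * -Complex.I * (starRingEnd ℂ) (leviMatrix H φ y j k)) * a y =
        -(2 * Complex.I * (a y * star (leviMatrix H φ y j k))) := by
      rw [starRingEnd_apply]; ring
    rw [h8, neg_smul]
    abel

end GradedFrames

/-! ### The frame `(f, h)` and the matrix of `ad X` -/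

section DegreeOne

variable {E : Type*} [NormedAddCommGroup E] [NormedSpace ℝ E] [FiniteDimensional ℝ E]
  {M : Type*} [TopologicalSpace M] [ChartedSpace E M] [IsManifold 𝓘(ℝ, E) ∞ M]
  {x : M} {n s r : ℕ} {H : Distribution E M} {φ : GradedFrame E M s} {e : Fin r → CField E M}
  {X Y Z : CField E M}

theorem IsLocalSection.kernel_to_leaf (hX : IsLocalSection (freeman H 2) X x) :
    IsLocalSection (leafDist H) X x :=
  hX.mono (Eventually.of_forall fun _ => le_sup_left)

theorem IsLocalSection.leaf_to_contact (hX : IsLocalSection (leafDist H) X x) :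
    IsLocalSection (contactDist H) X x :=
  hX.mono (Eventually.of_forall fun y => leafDist_le_contactDist H y)

theorem IsCRHypersurface.bracket_leaf_section (hH : IsCRHypersurface n H)
    (hX : IsLocalSection (leafDist H) X x) (hY : IsLocalSection (contactDist H) Y x) :
    IsLocalSection (contactDist H) (bracket X Y) x := by
  refine isLocalSection_iff.2 ⟨hX.smooth.bracket hY.smooth, ?_⟩
  filter_upwards [hX.eventually, hY.eventually] with y h₁ h₂
  exact hH.bracket_leaf_mem h₁.leaf_to_contact h₂ h₁.mem

theorem IsCRHypersurface.xiMatrix_eq (hH : IsCRHypersurface n H) (h : IsGradedFrameAt H φ x)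
    {k : Fin s} {c : Fin s → ℂ}
    (hc : bracket X (conjField (φ.f k)) x - ∑ l, c l • φ.f l x ∈
      freeman H 2 x ⊔ conjSub (H x)) (l : Fin s) : xiMatrix H φ X x l k = c l := by
  rw [xiMatrix, Matrix.of_apply, coords_eq ?_ hc]
  exact fun c hc => hH.eq_zero_of_sum_mem h hc

/-- The bracket stays in `H ⊕ conj H` because `X` is tangent to the leaves; its `H` component is
expanded along `f` modulo `K₂`, with smooth coefficients. -/
theorem IsCRHypersurface.exists_xi_coeff (hH : IsCRHypersurface n H) (hφ : IsSectionNear H x φ)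
    (he : IsKernelFrameNear H x e) (hX : IsLocalSection (freeman H 2) X x) (k : Fin s) :
    ∃ c : Fin s → M → ℂ, (∀ l, SmoothNear E (c l) x) ∧ ∀ᶠ y in 𝓝 x,
      bracket X (conjField (φ.f k)) y - ∑ l, c l y • φ.f l y ∈
        freeman H 2 y ⊔ conjSub (H y) := by
  obtain ⟨Y, Z, hY, hZ, hYZ⟩ := hH.exists_contact_decomp
    (hH.bracket_leaf_section hX.kernel_to_leaf (hφ.isLocalSection k).conj_to_contact)
  obtain ⟨c, hc, hYc⟩ := hφ.exists_smooth_coeff he hY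
  refine ⟨c, hc, ?_⟩
  filter_upwards [hYZ, hYc, hZ] with y h₁ h₂ h₃
  rw [h₁, add_sub_right_comm]
  exact Submodule.add_mem_sup h₂.2 (conj_mem_conjSub h₃.2)

theorem IsCRHypersurface.smooth_xiMatrix (hH : IsCRHypersurface n H) (hφ : IsSectionNear H x φ)
    (he : IsKernelFrameNear H x e) (hX : IsLocalSection (freeman H 2) X x) (l k : Fin s) :
    SmoothNear E (fun y => xiMatrix H φ X y l k) x := by
  obtain ⟨c, hc, h⟩ := hH.exists_xi_coeff hφ he hX k
  refine (hc l).congr ?_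
  filter_upwards [h, hφ] with y h₁ h₂
  exact (hH.xiMatrix_eq h₂.2.2 h₁ l).symm

theorem IsCRHypersurface.xiMatrix_spec (hH : IsCRHypersurface n H) (hφ : IsSectionNear H x φ)
    (he : IsKernelFrameNear H x e) (hX : IsLocalSection (freeman H 2) X x) (k : Fin s) :
    bracket X (conjField (φ.f k)) x - ∑ l, xiMatrix H φ X x l k • φ.f l x ∈
      freeman H 2 x ⊔ conjSub (H x) := by
  obtain ⟨c, hc, h⟩ := hH.exists_xi_coeff hφ he hX k
  have h1 := h.self_of_nhds
  simp only [hH.xiMatrix_eq hφ.at h1]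
  exact h1

/-- The Leibniz terms are multiples of the `e α`, which vanish modulo `K₂`; so `Ξ` depends linearly
on the value of the section. -/
theorem IsCRHypersurface.xiMatrix_combination (hH : IsCRHypersurface n H)
    (hφ : IsSectionNear H x φ) (he : IsKernelFrameNear H x e) {b : Fin r → M → ℂ}
    (hb : ∀ α, SmoothNear E (b α) x) (hX : IsLocalSection (freeman H 2) X x)
    (hXb : ∀ᶠ y in 𝓝 x, X y = ∑ α, b α y • e α y) :
    xiMatrix H φ X x = ∑ α, b α x • xiMatrix H φ (e α) x := by
  ext l k
  have hf := (hφ.isLocalSection k).smooth.conj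
  have hs := he.frame.isLocalSection
  rw [hH.xiMatrix_eq (c := fun l => ∑ α, b α x * xiMatrix H φ (e α) x l k) hφ.at]
  · simp [Matrix.sum_apply]
  · rw [bracket_congr hX.smooth hf hXb (Eventually.of_forall fun _ => rfl),
      bracket_sum_left hf (fun α _ => (hs α).smooth) fun α _ => hb α]
    have h1 : ∑ l, (∑ α, b α x * xiMatrix H φ (e α) x l k) • φ.f l x =
        ∑ α, b α x • ∑ l, xiMatrix H φ (e α) x l k • φ.f l x := by
      simp only [Finset.sum_smul, Finset.smul_sum, smul_smul]
      exact Finset.sum_comm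
    rw [h1, ← Finset.sum_sub_distrib]
    refine Submodule.sum_mem _ fun α _ => ?_
    rw [sub_right_comm, ← smul_sub]
    exact sub_mem (Submodule.smul_mem _ _ (hH.xiMatrix_spec hφ he (hs α) k))
      (Submodule.mem_sup_left (Submodule.smul_mem _ _ (hs α).mem))

theorem IsCRHypersurface.smooth_inv_leviMatrix (hH : IsCRHypersurface n H)
    (hφ : IsSectionNear H x φ) (j k : Fin s) :
    SmoothNear E (fun y => (leviMatrix H φ y)⁻¹ j k) x :=
  .matrix_inv (hH.smooth_leviMatrix hφ) (hH.isUnit_leviMatrix hφ) j k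

theorem IsCRHypersurface.hField_section (hH : IsCRHypersurface n H) (hφ : IsSectionNear H x φ)
    (k : Fin s) : IsLocalSection (conjDist H) (hField H φ k) x :=
  .sum fun j _ => .smul (hH.smooth_inv_leviMatrix hφ j k) (hφ.isLocalSection j).conj

theorem IsCRHypersurface.degOne_section (hH : IsCRHypersurface n H) (hφ : IsSectionNear H x φ)
    (k : Fin s ⊕ Fin s) : IsLocalSection (contactDist H) (degOneFrame H φ k) x := by
  rcases k with k | k
  · exact (hφ.isLocalSection k).to_contact
  · exact (hH.hField_section hφ k).mono (Eventually.of_forall fun _ => le_sup_right)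

theorem IsCRHypersurface.conj_f_eq (hH : IsCRHypersurface n H) (hφ : IsSectionNear H x φ)
    (j : Fin s) : conj (φ.f j x) = ∑ k, leviMatrix H φ x k j • hField H φ k x := by
  simp only [hField, Finset.smul_sum, smul_smul]
  rw [Finset.sum_comm]
  simp only [← Finset.sum_smul]
  have h : ∀ i, ∑ k, leviMatrix H φ x k j * (leviMatrix H φ x)⁻¹ i k = (1 : Matrix _ _ ℂ) i j := by
    intro i
    rw [← Matrix.nonsing_inv_mul _ (hH.isUnit_leviMatrix hφ), Matrix.mul_apply]
    exact Finset.sum_congr rfl fun k _ => mul_comm _ _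
  simp only [h, Matrix.one_apply, ite_smul, one_smul, zero_smul, Finset.sum_ite_eq',
    Finset.mem_univ, if_true]

/-- The two halves separate since `H ∩ conj H = 0`. The `h` half is conjugated back to `H`, where
invertibility of `A` reduces it to independence of the `f_j`. -/
theorem IsCRHypersurface.eq_zero_of_degOne_sum_mem (hH : IsCRHypersurface n H)
    (hφ : IsSectionNear H x φ) {c : Fin s ⊕ Fin s → ℂ}
    (hc : ∑ k, c k • degOneFrame H φ k x ∈ leafDist H x) : c = 0 := by
  rw [Fintype.sum_sum_type] at hc
  obtain ⟨a, ha, b, hb, hab⟩ := Submodule.mem_sup.1 hc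
  have hf : ∑ j, c (Sum.inl j) • φ.f j x ∈ H x :=
    Submodule.sum_mem _ fun j _ => Submodule.smul_mem _ _ (hφ.isLocalSection j).mem
  have hh : ∑ j, c (Sum.inr j) • hField H φ j x ∈ conjSub (H x) :=
    Submodule.sum_mem _ fun j _ => Submodule.smul_mem _ _ (hH.hField_section hφ j).mem
  obtain ⟨h₁, h₂⟩ := eq_of_add_eq_add_of_disjoint (hH.disjoint x) (freeman_two_le H x ha) hf
    (conjSub_mono (freeman_two_le H x) hb) hh hab
  have h3 : (fun j => c (Sum.inl j)) = 0 := hφ.at.eq_zero_of_sum_mem (h₁ ▸ ha)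
  have h4 : ∑ j, c (Sum.inr j) • hField H φ j x =
      ∑ j, ((leviMatrix H φ x)⁻¹ *ᵥ fun k => c (Sum.inr k)) j • conj (φ.f j x) := by
    simp only [hField, Finset.smul_sum, smul_smul, Matrix.mulVec, dotProduct, Finset.sum_smul]
    rw [Finset.sum_comm]
    refine Finset.sum_congr rfl fun i _ => Finset.sum_congr rfl fun k _ => ?_
    rw [mul_comm]
  have h5 : conj b ∈ freeman H 2 x := hb
  rw [h₂, h4, conj_sum] at h5
  simp only [conj_smul, conj_conj] at h5
  have h6 := hφ.at.eq_zero_of_sum_mem h5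
  have h7 : ((leviMatrix H φ x)⁻¹ *ᵥ fun k => c (Sum.inr k)) = 0 := by
    ext j
    simpa using congrFun h6 j
  have h8 : (fun k => c (Sum.inr k)) = 0 := by
    have h9 := congrArg (fun v => leviMatrix H φ x *ᵥ v) h7
    simpa [Matrix.mulVec_mulVec, Matrix.mul_nonsing_inv _ (hH.isUnit_leviMatrix hφ)] using h9
  ext (j | j)
  exacts [congrFun h3 j, congrFun h8 j]

theorem IsCRHypersurface.exists_degOne_coeff (hH : IsCRHypersurface n H)
    (hφ : IsSectionNear H x φ) {v : CTangent E x} (hv : v ∈ contactDist H x) :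
    ∃ c : Fin s ⊕ Fin s → ℂ, v - ∑ k, c k • degOneFrame H φ k x ∈ leafDist H x := by
  obtain ⟨a, ha, b, hb, rfl⟩ := Submodule.mem_sup.1 hv
  obtain ⟨c, hc⟩ := hφ.at.exists_coeff ha
  obtain ⟨d, hd⟩ := hφ.at.exists_coeff (v := conj b) hb
  refine ⟨Sum.elim c fun k => ∑ j, leviMatrix H φ x k j * (starRingEnd ℂ) (d j), ?_⟩
  have h1 : _ ∈ leafDist H x := Submodule.add_mem_sup hc (conj_mem_conjSub hd)
  convert h1 using 1
  rw [Fintype.sum_sum_type, map_sub, conj_conj, conj_sum]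
  simp only [conj_smul, hH.conj_f_eq hφ, Sum.elim_inl, Sum.elim_inr, Finset.smul_sum, smul_smul]
  rw [Finset.sum_comm (f := fun i j => ((starRingEnd ℂ) (d i) * leviMatrix H φ x j i) •
    hField H φ j x)]
  simp only [← Finset.sum_smul, degOneFrame, Sum.elim_inl, Sum.elim_inr, mul_comm]
  abel

/-- The matrix of the symplectic form of the Heisenberg algebra. -/
def sympl (s : ℕ) : End1 s := Matrix.fromBlocks 0 1 (-1) 0

/-- The factor `A⁻¹` in `h` cancels the Levi matrix. This is what makes `(f, h)` a symplectic basis,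
up to the factor `2i`, at every nearby point. -/
theorem IsCRHypersurface.bracket_f_h (hH : IsCRHypersurface n H) (hφ : IsSectionNear H x φ)
    (j k : Fin s) : bracket (φ.f j) (hField H φ k) x -
      (2 * Complex.I * (1 : Matrix _ _ ℂ) j k) • φ.g x ∈ contactDist H x := by
  have h1 := hH.bracket_sub_combination_mem (F := fun _ : Unit => φ.f j)
    (fun _ => (hφ.isLocalSection j).to_contact) (fun m => (hφ.isLocalSection m).conj_to_contact)
    (hφ.isLocalSection j).to_contact (hH.degOne_section hφ (Sum.inr k)) (fun _ => 1)
    (fun m => (leviMatrix H φ x)⁻¹ m k) (by simp) (by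
      change hField H φ k x - hField H φ k x ∈ _
      rw [sub_self]; exact zero_mem _)
  simp only [Finset.univ_unique, one_mul, Finset.sum_singleton] at h1
  have h2 : ∑ m, (leviMatrix H φ x)⁻¹ m k • (bracket (φ.f j) (conjField (φ.f m)) x -
      (2 * Complex.I * leviMatrix H φ x j m) • φ.g x) ∈ contactDist H x :=
    Submodule.sum_mem _ fun m _ => Submodule.smul_mem _ _ (hφ.at.leviMatrix_spec j m)
  have h3 := add_mem h1 h2
  convert h3 using 1
  simp only [smul_sub, Finset.sum_sub_distrib]
  rw [sub_add_sub_cancel]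
  congr 1
  rw [← Matrix.mul_nonsing_inv _ (hH.isUnit_leviMatrix hφ), Matrix.mul_apply, Finset.mul_sum,
    Finset.sum_smul]
  refine Finset.sum_congr rfl fun m _ => ?_
  rw [smul_smul]
  congr 1
  ring

theorem IsCRHypersurface.bracket_degOne (hH : IsCRHypersurface n H) (hφ : IsSectionNear H x φ)
    (j k : Fin s ⊕ Fin s) : bracket (degOneFrame H φ j) (degOneFrame H φ k) x -
      ((2 * Complex.I) • sympl s) j k • φ.g x ∈ contactDist H x := by
  rcases j with j | j <;> rcases k with k | k
  · simp only [sympl, Matrix.smul_apply, Matrix.fromBlocks_apply₁₁, Matrix.zero_apply, smul_zero,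
      zero_smul, sub_zero]
    exact mem_contactDist_left (hH.involutive x _ _ (hφ.isLocalSection j) (hφ.isLocalSection k))
  · exact hH.bracket_f_h hφ j k
  · have h1 := neg_mem (hH.bracket_f_h hφ k j)
    have h2 := bracket_swap (hH.hField_section hφ j).smooth (hφ.isLocalSection k).smooth
    simp only [sympl, Matrix.smul_apply, Matrix.fromBlocks_apply₂₁, Matrix.neg_apply, smul_eq_mul]
    change bracket (hField H φ j) (φ.f k) x - _ ∈ _
    rw [h2]
    convert h1 using 1
    rw [neg_sub, mul_neg, neg_smul, sub_neg_eq_add, neg_add_eq_sub, Matrix.one_apply,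
      Matrix.one_apply]
    simp only [eq_comm]
  · simp only [sympl, Matrix.smul_apply, Matrix.fromBlocks_apply₂₂, Matrix.zero_apply, smul_zero,
      zero_smul, sub_zero]
    have h1 := hH.involutive x _ _ (hH.hField_section hφ j).conj' (hH.hField_section hφ k).conj'
    rw [bracket_conj (hH.hField_section hφ j).smooth (hH.hField_section hφ k).smooth] at h1
    exact Submodule.mem_sup_right h1

/-- A field preserving `H ⊕ conj H` acts on the bracket by a derivation. -/
theorem IsCRHypersurface.derivation_of_bracket (hH : IsCRHypersurface n H)
    (hφ : IsSectionNear H x φ) (hX : IsLocalSection (leafDist H) X x) {ι : Type*} [Fintype ι]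
    {F : ι → CField E M} (hF : ∀ i, IsLocalSection (contactDist H) (F i) x) {Q R : Matrix ι ι ℂ}
    (hQ : ∀ᶠ y in 𝓝 x, ∀ j k, bracket (F j) (F k) y - Q j k • φ.g y ∈ contactDist H y)
    (hR : ∀ k, bracket X (F k) x - ∑ l, R l k • F l x ∈ leafDist H x) :
    ∃ c : ℂ, Rᵀ * Q + Q * R = c • Q := by
  have hQx := hQ.self_of_nhds
  -- The scale `c` is the coefficient of `[X, g]` along `g`. Since `Q` is constant and `ad X`
  -- preserves `H ⊕ conj H`, the left side of the Jacobi identity for `X, F_j, F_k` is `c Q_{jk} g`.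
  obtain ⟨c, hc⟩ := hφ.at.exists_coeff_g (bracket X φ.g x)
  refine ⟨c, ?_⟩
  ext j k
  have hXF := fun i => hH.bracket_leaf_section hX (hF i)
  have hleft : bracket X (bracket (F j) (F k)) x - (c * Q j k) • φ.g x ∈ contactDist H x := by
    have hZ : IsLocalSection (contactDist H)
        (fun y => bracket (F j) (F k) y - Q j k • φ.g y) x := by
      refine isLocalSection_iff.2 ⟨((hF j).smooth.bracket (hF k).smooth).sub
        (hφ.smooth_g.const_smul _), ?_⟩
      filter_upwards [hQ] with y hy using hy j k
    have h1 := hH.bracket_leaf_mem hX.leaf_to_contact hZ hX.mem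
    have h2 := bracket_add_right hX.smooth (hφ.smooth_g.const_smul (Q j k)) hZ.smooth
    simp only [add_sub_cancel] at h2
    rw [bracket_smul_right hX.smooth hφ.smooth_g (smoothNear_const _), deriv_const, zero_smul,
      add_zero] at h2
    change bracket X (fun y => bracket (F j) (F k) y) x - _ ∈ _
    rw [h2]
    have h3 := add_mem (Submodule.smul_mem _ (Q j k) hc) h1
    convert h3 using 1
    rw [smul_sub, smul_smul, mul_comm]
    abel
  have hr : ∀ {a b : CTangent E x} {w w' : ℂ}, a - b ∈ contactDist H x →
      b - w • φ.g x ∈ contactDist H x → w = w' → a - w' • φ.g x ∈ contactDist H x := by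
    intro a b w w' h₁ h₂ h₃
    rw [← h₃, ← sub_add_sub_cancel a b]
    exact add_mem h₁ h₂
  have h₁ : bracket (bracket X (F j)) (F k) x - (Rᵀ * Q) j k • φ.g x ∈ contactDist H x := by
    have h1 := hH.bracket_sub_combination_mem (G := fun _ : Unit => F k) hF (fun _ => hF k)
      (hXF j) (hF k) (fun l => R l j) (fun _ => 1) (hR j) (by simp)
    simp only [Finset.univ_unique, mul_one, Finset.sum_singleton] at h1
    refine hr h1 (w := ∑ l, R l j * Q l k) ?_ (by simp [Matrix.mul_apply])
    rw [Finset.sum_smul, ← Finset.sum_sub_distrib]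
    refine Submodule.sum_mem _ fun l _ => ?_
    rw [← smul_smul, ← smul_sub]
    exact Submodule.smul_mem _ _ (hQx l k)
  have h₂ : bracket (F j) (bracket X (F k)) x - (Q * R) j k • φ.g x ∈ contactDist H x := by
    have h1 := hH.bracket_sub_combination_mem (F := fun _ : Unit => F j) (fun _ => hF j) hF
      (hF j) (hXF k) (fun _ => 1) (fun l => R l k) (by simp) (hR k)
    simp only [Finset.univ_unique, one_mul, Finset.sum_singleton] at h1
    refine hr h1 (w := ∑ l, R l k * Q j l) ?_ (by simp [Matrix.mul_apply, mul_comm])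
    rw [Finset.sum_smul, ← Finset.sum_sub_distrib]
    refine Submodule.sum_mem _ fun l _ => ?_
    rw [← smul_smul, ← smul_sub]
    exact Submodule.smul_mem _ _ (hQx j l)
  have h3 := add_mem h₁ h₂
  rw [bracket_jacobi hX.smooth (hF j).smooth (hF k).smooth] at hleft
  rw [Matrix.add_apply, Matrix.smul_apply, smul_eq_mul]
  refine hφ.at.eq_of_sub_mem ?_ hleft
  convert h3 using 1
  rw [add_smul]
  abel

/-- The matrix of `ad X` in the frame `(f, h)` for a section `X` of the Levi kernel. -/
theorem IsCRHypersurface.exists_ad_eq_modElt (hH : IsCRHypersurface n H)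
    (hφ : IsSectionNear H x φ) (he : IsKernelFrameNear H x e)
    (hX : IsLocalSection (freeman H 2) X x) :
    (sUp (leviMatrix H φ x) (xiMatrix H φ X x)).IsSymm ∧
    ∃ (L : Matrix (Fin s) (Fin s) ℂ) (c : ℂ), ∀ k, bracket X (degOneFrame H φ k) x -
      ∑ l, (modElt (leviMatrix H φ x) (xiMatrix H φ X x) L + c • 1) l k • degOneFrame H φ l x ∈
        leafDist H x := by
  have hF := hH.degOne_section hφ
  have hXl := hX.kernel_to_leaf
  have hex : ∀ k, ∃ c : Fin s ⊕ Fin s → ℂ,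
      bracket X (degOneFrame H φ k) x - ∑ l, c l • degOneFrame H φ l x ∈ leafDist H x :=
    fun k => hH.exists_degOne_coeff hφ (hH.bracket_leaf_section hXl (hF k)).mem
  choose R' hR' using hex
  let R : End1 s := Matrix.of fun l k => R' k l
  have hR : ∀ k, bracket X (degOneFrame H φ k) x - ∑ l, R l k • degOneFrame H φ l x ∈
    leafDist H x := hR'
  obtain ⟨c, hc⟩ := hH.derivation_of_bracket hφ hXl hF (Q := (2 * Complex.I) • sympl s) (R := R) (by
    filter_upwards [hφ.eventually] with y hy using fun j k => hH.bracket_degOne hy j k) hR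
  have hc' : Rᵀ * sympl s + sympl s * R = c • sympl s := by
    have h1 : (2 * Complex.I) • (Rᵀ * sympl s + sympl s * R) = (2 * Complex.I) • (c • sympl s) := by
      rw [smul_comm, ← hc, smul_add, Matrix.mul_smul, Matrix.smul_mul]
    exact smul_right_injective _ (by simp) h1
  -- Both `X` and `f_k` are sections of the involutive `H`, so their bracket has no `h` component.
  have h21 : R.toBlocks₂₁ = 0 := by
    ext m k
    obtain ⟨d, hd⟩ := hφ.at.exists_coeff (hH.involutive x _ _ hX.of_kernel (hφ.isLocalSection k))
    have h1 := sub_mem (Submodule.mem_sup_left hd : _ ∈ leafDist H x) (hR (Sum.inl k))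
    have h2 : ∑ l, (R l (Sum.inl k) - Sum.elim d 0 l) • degOneFrame H φ l x ∈ leafDist H x := by
      have h1' : bracket X (φ.f k) x - ∑ j, d j • φ.f j x -
          (bracket X (φ.f k) x - ∑ l, R l (Sum.inl k) • degOneFrame H φ l x) ∈ leafDist H x := h1
      convert h1' using 1
      simp only [sub_smul, Finset.sum_sub_distrib, Fintype.sum_sum_type, Sum.elim_inl,
        Sum.elim_inr, Pi.zero_apply, zero_smul, Finset.sum_const_zero, add_zero, degOneFrame]
      abel
    have h3 := congrFun (hH.eq_zero_of_degOne_sum_mem hφ h2) (Sum.inr m)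
    simpa using! h3
  -- Expanding `h_k` in the `conj f_j` turns `Ξ` into `Ξ A⁻¹`; the derivatives of `A⁻¹` only produce
  -- terms in `conj H`.
  have h12 : R.toBlocks₁₂ = sUp (leviMatrix H φ x) (xiMatrix H φ X x) := by
    ext m k
    have hb : bracket X (hField H φ k) x - ∑ l, (sUp (leviMatrix H φ x) (xiMatrix H φ X x)) l k •
        φ.f l x ∈ freeman H 2 x ⊔ conjSub (H x) := by
      have h1 := bracket_sum_right (x := x) (v := fun j y => (leviMatrix H φ y)⁻¹ j k)
        (Y := fun j => conjField (φ.f j)) (t := Finset.univ) hX.smooth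
        (fun j _ => (hφ.isLocalSection j).smooth.conj)
        fun j _ => hH.smooth_inv_leviMatrix hφ j k
      change bracket X (fun y => ∑ j, (leviMatrix H φ y)⁻¹ j k • conjField (φ.f j) y) x - _ ∈ _
      have h2 : ∑ l, (sUp (leviMatrix H φ x) (xiMatrix H φ X x)) l k • φ.f l x =
          ∑ j, (leviMatrix H φ x)⁻¹ j k • ∑ l, xiMatrix H φ X x l j • φ.f l x := by
        simp only [sUp, Matrix.mul_apply, Finset.sum_smul, Finset.smul_sum, smul_smul]
        rw [Finset.sum_comm]
        simp only [mul_comm]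
      rw [h1, h2, ← Finset.sum_sub_distrib]
      refine Submodule.sum_mem _ fun j _ => ?_
      rw [add_sub_right_comm, ← smul_sub]
      exact add_mem (Submodule.smul_mem _ _ (hH.xiMatrix_spec hφ he hX j))
        (Submodule.mem_sup_right (Submodule.smul_mem _ _ (hφ.isLocalSection j).conj.mem))
    have h1 : bracket X (hField H φ k) x - ∑ l, R l (Sum.inr k) • degOneFrame H φ l x ∈
      leafDist H x := hR (Sum.inr k)
    have hle : leafDist H x ≤ freeman H 2 x ⊔ conjSub (H x) :=
      sup_le_sup le_rfl (conjSub_mono (freeman_two_le H x))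
    have h2 : ∑ l, (R (Sum.inl l) (Sum.inr k) -
        (sUp (leviMatrix H φ x) (xiMatrix H φ X x)) l k) • φ.f l x ∈
        freeman H 2 x ⊔ conjSub (H x) := by
      have h3 : ∑ l, R (Sum.inr l) (Sum.inr k) • hField H φ l x ∈
          freeman H 2 x ⊔ conjSub (H x) := Submodule.mem_sup_right (Submodule.sum_mem _
        fun l _ => Submodule.smul_mem _ _ (hH.hField_section hφ l).mem)
      have h4 := sub_mem (sub_mem hb (hle h1)) h3
      convert h4 using 1
      simp only [sub_smul, Finset.sum_sub_distrib, Fintype.sum_sum_type, degOneFrame,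
        Sum.elim_inl, Sum.elim_inr]
      abel
    have h3 := congrFun (hH.eq_zero_of_sum_mem hφ.at h2) m
    exact sub_eq_zero.1 h3
  have hRb : R = Matrix.fromBlocks R.toBlocks₁₁ (sUp (leviMatrix H φ x) (xiMatrix H φ X x)) 0
      R.toBlocks₂₂ := by
    rw [← h12, ← h21, Matrix.fromBlocks_toBlocks]
  set S := sUp (leviMatrix H φ x) (xiMatrix H φ X x) with hS
  rw [hRb, sympl, Matrix.fromBlocks_transpose, Matrix.fromBlocks_multiply,
    Matrix.fromBlocks_multiply, Matrix.fromBlocks_add, Matrix.fromBlocks_smul,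
    Matrix.fromBlocks_inj] at hc'
  obtain ⟨-, h₁₂, -, h₂₂⟩ := hc'
  simp only [Matrix.transpose_zero, mul_zero, zero_mul, mul_one, one_mul, add_zero, zero_add,
    smul_zero, neg_mul] at h₁₂ h₂₂
  -- With diagonal blocks `P, T` and upper right block `S`, the derivation identity reads `Sᵀ = S`
  -- and `Pᵀ + T = c`. Moving half of `c` out of each diagonal block leaves the pair `L, -Lᵀ`.
  refine ⟨add_neg_eq_zero.1 h₂₂, R.toBlocks₁₁ - (c / 2) • 1, c / 2, ?_⟩
  have hfin : modElt (leviMatrix H φ x) (xiMatrix H φ X x) (R.toBlocks₁₁ - (c / 2) • 1) +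
      (c / 2) • 1 = R := by
    conv_rhs => rw [hRb]
    rw [modElt, ← Matrix.fromBlocks_one, Matrix.fromBlocks_smul, Matrix.fromBlocks_add,
      Matrix.fromBlocks_inj]
    refine ⟨by simp, by simp [hS], by simp, ?_⟩
    rw [Matrix.transpose_sub, Matrix.transpose_smul, Matrix.transpose_one]
    have h5 : R.toBlocks₂₂ = c • 1 - R.toBlocks₁₁ᵀ := by rw [← h₁₂]; abel
    rw [h5, neg_sub]
    have h6 : (c : ℂ) • (1 : Matrix (Fin s) (Fin s) ℂ) = (c / 2) • 1 + (c / 2) • 1 := by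
      rw [← add_smul, add_halves]
    rw [h6]
    abel
  rw [hfin]
  exact hR

end DegreeOne

/-! ### Testing complexified vectors by real functionals -/

section Pairing

variable {V : Type*} [NormedAddCommGroup V] [NormedSpace ℝ V]

/-- The complex-linear extension of a real functional. -/
def pairing (ℓ : V →L[ℝ] ℝ) : ℂ ⊗[ℝ] V →ₗ[ℂ] ℂ where
  toFun z := (ℓ (re z) : ℂ) + Complex.I * (ℓ (im z) : ℂ)
  map_add' z w := by simp only [map_add, Complex.ofReal_add]; ring
  map_smul' c z := by
    simp only [re_smul, im_smul, map_add, map_sub, map_smul, smul_eq_mul, Complex.ofReal_add,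
      Complex.ofReal_sub, Complex.ofReal_mul, RingHom.id_apply]
    conv_rhs => rw [← Complex.re_add_im c]
    linear_combination (- c.im * (ℓ (im z) : ℂ)) * Complex.I_sq

theorem pairing_apply (ℓ : V →L[ℝ] ℝ) (z : ℂ ⊗[ℝ] V) :
    pairing ℓ z = (ℓ (re z) : ℂ) + Complex.I * (ℓ (im z) : ℂ) := rfl

theorem eq_zero_of_ofReal_add_eq_zero {a b : ℝ} (h : (a : ℂ) + Complex.I * b = 0) :
    a = 0 ∧ b = 0 := by
  have h1 := congrArg Complex.re h
  have h2 := congrArg Complex.im h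
  simp at h1 h2
  exact ⟨h1, h2⟩

/-- Real functionals separate points of a normed space. Statements about `π_*`, which has values in
`ℂ ⊗ F`, can thus be checked on scalar coordinate functions. -/
theorem eq_of_pairing_eq {z w : ℂ ⊗[ℝ] V} (h : ∀ ℓ : V →L[ℝ] ℝ, pairing ℓ z = pairing ℓ w) :
    z = w := by
  have h1 : ∀ ℓ : V →L[ℝ] ℝ, ℓ (re (z - w)) = 0 ∧ ℓ (im (z - w)) = 0 := by
    intro ℓ
    apply eq_zero_of_ofReal_add_eq_zero
    rw [← pairing_apply, map_sub, h, sub_self]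
  rw [← sub_eq_zero]
  apply reIm_ext
  · rw [map_zero]
    by_contra h0
    obtain ⟨ℓ, hℓ⟩ := SeparatingDual.exists_ne_zero (R := ℝ) h0
    exact hℓ (h1 ℓ).1
  · rw [map_zero]
    by_contra h0
    obtain ⟨ℓ, hℓ⟩ := SeparatingDual.exists_ne_zero (R := ℝ) h0
    exact hℓ (h1 ℓ).2

end Pairing

/-! ### The leaf space, and `ι` as the action of `ad X` -/

section LeafSpace

variable {E : Type*} [NormedAddCommGroup E] [NormedSpace ℝ E] [FiniteDimensional ℝ E]
  {M : Type*} [TopologicalSpace M] [ChartedSpace E M] [IsManifold 𝓘(ℝ, E) ∞ M]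
  {F : Type*} [NormedAddCommGroup F] [NormedSpace ℝ F]
  {N : Type*} [TopologicalSpace N] [ChartedSpace F N] [IsManifold 𝓘(ℝ, F) ∞ N]
  {p x : M} {n s r : ℕ} {H : Distribution E M} {φ : GradedFrame E M s} {e : Fin r → CField E M}
  {π : M → N} {X Y Z : CField E M}

variable (F) in
/-- The projection to the leaf space in the chart at `π p`. -/
def leafChart (π : M → N) (p : M) (y : M) : F := extChartAt 𝓘(ℝ, F) (π p) (π y)

variable (F) in
/-- The coordinate functions of the leaf space. -/
def leafFun (π : M → N) (p : M) (ℓ : F →L[ℝ] ℝ) (y : M) : ℂ := (ℓ (leafChart F π p y) : ℂ)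

theorem conj_mem_leafDist {v : CTangent E x} (h : v ∈ leafDist H x) : conj v ∈ leafDist H x :=
  conj_mem_sup h

/-- `K₂ ⊕ conj K₂` is stable under conjugation, hence contains real and imaginary parts. This is
needed because the kernel condition in `IsLeafSpace` concerns real vectors only. -/
theorem mem_leafDist_iff {v : CTangent E x} :
    v ∈ leafDist H x ↔ ofReIm (re v) 0 ∈ leafDist H x ∧ ofReIm (im v) 0 ∈ leafDist H x := by
  constructor
  · intro h
    constructor
    · have h1 := Submodule.smul_mem _ (1 / 2 : ℂ) (add_mem h (conj_mem_leafDist h))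
      convert h1 using 1
      apply reIm_ext
      · simp only [re_ofReIm, re_smul, map_add, re_conj, im_conj, ← two_smul ℝ (re v), smul_smul]
        simp
      · simp
    · have h1 := Submodule.smul_mem _ (1 / (2 * Complex.I) : ℂ) (sub_mem h (conj_mem_leafDist h))
      convert h1 using 1
      apply reIm_ext
      · simp [← two_smul ℝ (im v), smul_smul]
      · simp
  · rintro ⟨h₁, h₂⟩
    have h1 := add_mem h₁ (Submodule.smul_mem _ Complex.I h₂)
    convert h1 using 1
    apply reIm_ext <;> simp

theorem IsLeafSpace.smooth_leafChart (hπ : IsLeafSpace F H π) (p : M) :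
    SmoothNear E (leafChart F π p) p := by
  have h1 : ∀ᶠ y in 𝓝 p, π y ∈ (chartAt F (π p)).source :=
    hπ.smooth.continuous.continuousAt.eventually (chart_source_mem_nhds F (π p))
  filter_upwards [h1] with y hy
  exact (contMDiffAt_extChartAt' (I := 𝓘(ℝ, F)) (n := ∞) hy).comp y (hπ.smooth y)

theorem IsLeafSpace.realDeriv_leafChart (hπ : IsLeafSpace F H π) (p : M) :
    ∀ᶠ y in 𝓝 p, ∀ w : TangentSpace 𝓘(ℝ, E) y,
      realDeriv y w (leafChart F π p) = 0 ↔ ofReIm w 0 ∈ leafDist H y := by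
  have h1 : ∀ᶠ y in 𝓝 p, π y ∈ (chartAt F (π p)).source :=
    hπ.smooth.continuous.continuousAt.eventually (chart_source_mem_nhds F (π p))
  filter_upwards [h1] with y hy w
  have hd : MDifferentiableAt 𝓘(ℝ, F) 𝓘(ℝ, F) (extChartAt 𝓘(ℝ, F) (π p)) (π y) :=
    (contMDiffAt_extChartAt' (I := 𝓘(ℝ, F)) (n := ∞) hy).mdifferentiableAt (by simp)
  have hc := mfderiv_comp y hd ((hπ.smooth y).mdifferentiableAt (by simp))
  obtain ⟨D, hD⟩ := isInvertible_mfderiv_extChartAt (I := 𝓘(ℝ, F)) (x := π p) (y := π y)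
    (by rwa [extChartAt_source])
  have h2 : realDeriv y w (leafChart F π p) = D (mfderiv 𝓘(ℝ, E) 𝓘(ℝ, F) π y w) := by
    have h3 : realDeriv y w (leafChart F π p) =
      mfderiv 𝓘(ℝ, E) 𝓘(ℝ, F) (extChartAt 𝓘(ℝ, F) (π p) ∘ π) y w := rfl
    rw [h3, hc, ← hD]
    rfl
  rw [h2]
  refine Iff.trans ?_ (hπ.kernel y w)
  exact D.map_eq_zero_iff

theorem IsLeafSpace.smooth_leafFun (hπ : IsLeafSpace F H π) (p : M) (ℓ : F →L[ℝ] ℝ) :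
    SmoothNear E (leafFun F π p ℓ) p :=
  (hπ.smooth_leafChart p).clm_comp (Complex.ofRealCLM.comp ℓ)

theorem realDeriv_leafFun (ℓ : F →L[ℝ] ℝ) (h : SmoothNear E (leafChart F π p) x)
    (w : TangentSpace 𝓘(ℝ, E) x) :
    realDeriv x w (leafFun F π p ℓ) = (ℓ (realDeriv x w (leafChart F π p)) : ℂ) :=
  realDeriv_clm (Complex.ofRealCLM.comp ℓ) w h.mdiff

theorem deriv_leafFun (ℓ : F →L[ℝ] ℝ) (h : SmoothNear E (leafChart F π p) x)
    (w : CTangent E x) : deriv x w (leafFun F π p ℓ) = pairing ℓ (push F π p x w) := by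
  rw [deriv, realDeriv_leafFun ℓ h, realDeriv_leafFun ℓ h, pairing_apply, push, re_ofReIm,
    im_ofReIm]
  rfl

/-- The leaf distribution as the common kernel of the differentials of the coordinates of `N`; it
holds near `p` and so can be differentiated. -/
theorem IsLeafSpace.mem_leafDist (hπ : IsLeafSpace F H π) (p : M) :
    ∀ᶠ y in 𝓝 p, ∀ w : CTangent E y,
      w ∈ leafDist H y ↔ ∀ ℓ : F →L[ℝ] ℝ, deriv y w (leafFun F π p ℓ) = 0 := by
  filter_upwards [hπ.realDeriv_leafChart p, (hπ.smooth_leafChart p).eventually] with y h₁ h₂ w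
  have h0 : w ∈ leafDist H y ↔ push F π p y w = 0 := by
    rw [mem_leafDist_iff, ← h₁, ← h₁]
    constructor
    · rintro ⟨ha, hb⟩
      apply reIm_ext
      · rw [push, re_ofReIm, map_zero]; exact ha
      · rw [push, im_ofReIm, map_zero]; exact hb
    · intro h
      have ha := congrArg re h
      have hb := congrArg im h
      rw [push, re_ofReIm, map_zero] at ha
      rw [push, im_ofReIm, map_zero] at hb
      exact ⟨ha, hb⟩
  rw [h0]
  constructor
  · intro h ℓ
    rw [deriv_leafFun ℓ h₂, h, map_zero]
  · intro h
    exact eq_of_pairing_eq fun ℓ => by rw [← deriv_leafFun ℓ h₂, h, map_zero]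

theorem IsLeafSpace.deriv_eq_of_sub_mem (hπ : IsLeafSpace F H π) {v w : CTangent E p}
    (h : v - w ∈ leafDist H p) (ℓ : F →L[ℝ] ℝ) :
    deriv p v (leafFun F π p ℓ) = deriv p w (leafFun F π p ℓ) := by
  have h1 := ((hπ.mem_leafDist p).self_of_nhds _).1 h ℓ
  rw [deriv_sub_vec] at h1
  exact sub_eq_zero.1 h1

/-- Along the leaves, the derivative of `π_* Y` is `π_* [X, Y]`. -/
theorem IsLeafSpace.deriv_deriv (hπ : IsLeafSpace F H π) (hX : IsLocalSection (leafDist H) X p)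
    (hY : SmoothFieldNear Y p) (ℓ : F →L[ℝ] ℝ) :
    deriv p (X p) (fun y => deriv y (Y y) (leafFun F π p ℓ)) =
      deriv p (bracket X Y p) (leafFun F π p ℓ) := by
  -- `X` annihilates the leaf functions on a whole neighbourhood, so only one term of the commutator
  -- survives.
  have h : deriv p (Y p) (fun y => deriv y (X y) (leafFun F π p ℓ)) = 0 := by
    rw [deriv_congr (v := fun _ => 0), deriv_const]
    filter_upwards [hX, hπ.mem_leafDist p] with y h₁ h₂ using (h₂ _).1 h₁.2 ℓ
  rw [deriv_bracket hX.smooth hY (hπ.smooth_leafFun p ℓ), h, sub_zero]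

/-- Both fields annihilate the leaf functions near `p`, hence so does their commutator: the
foliation is integrable because the submersion exists. -/
theorem IsLeafSpace.bracket_mem (hπ : IsLeafSpace F H π) (hX : IsLocalSection (leafDist H) X p)
    (hY : IsLocalSection (leafDist H) Y p) : bracket X Y p ∈ leafDist H p := by
  rw [(hπ.mem_leafDist p).self_of_nhds]
  intro ℓ
  rw [← hπ.deriv_deriv hX hY.smooth, deriv_congr (v := fun _ => 0), deriv_const]
  filter_upwards [hY, hπ.mem_leafDist p] with y h₁ h₂ using (h₂ _).1 h₁.2 ℓ

theorem pairing_derivVec (hπ : IsLeafSpace F H π) (hY : SmoothFieldNear Y p) (v : CTangent E p)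
    (ℓ : F →L[ℝ] ℝ) :
    pairing ℓ (derivVec p v fun y => push F π p y (Y y)) =
      deriv p v (fun y => deriv y (Y y) (leafFun F π p ℓ)) := by
  have hs := hπ.smooth_leafChart p
  have h₁ : SmoothNear E (fun y => realDeriv y (re (Y y)) (leafChart F π p)) p := by
    filter_upwards [hs, hY] with y h₁ h₂ using contMDiffAt_realDeriv h₂.1 h₁
  have h₂ : SmoothNear E (fun y => realDeriv y (im (Y y)) (leafChart F π p)) p := by
    filter_upwards [hs, hY] with y h₁ h₂ using contMDiffAt_realDeriv h₂.2 h₁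
  let L : F →L[ℝ] ℂ := Complex.ofRealCLM.comp ℓ
  have h₃ : deriv p v (fun y => deriv y (Y y) (leafFun F π p ℓ)) =
      deriv p v (fun y => L (realDeriv y (re (Y y)) (leafChart F π p)) +
        Complex.I * L (realDeriv y (im (Y y)) (leafChart F π p))) := by
    refine deriv_congr _ ?_
    filter_upwards [hs.eventually] with y hy
    rw [deriv, realDeriv_leafFun ℓ hy, realDeriv_leafFun ℓ hy]
    rfl
  rw [h₃, deriv_add _ (h₁.clm_comp L) ((smoothNear_const _).mul (h₂.clm_comp L)),
    deriv_const_mul _ _ (h₂.clm_comp L)]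
  have hpush : ∀ y (w : CTangent E y), push F π p y w =
      ofReIm (realDeriv y (re w) (leafChart F π p)) (realDeriv y (im w) (leafChart F π p)) :=
    fun _ _ => rfl
  simp only [deriv, realDeriv_clm L _ h₁.mdiff, realDeriv_clm L _ h₂.mdiff, pairing_apply,
    derivVec, re_ofReIm, im_ofReIm, map_add, map_sub, hpush, Complex.ofReal_add, Complex.ofReal_sub]
  simp only [L, ContinuousLinearMap.comp_apply, Complex.ofRealCLM_apply]
  linear_combination (-(ℓ (realDeriv p (im v) fun y => realDeriv y (im (Y y))
    (leafChart F π p)) : ℂ)) * Complex.I_sq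

/-- `R` is the matrix of `ι_φ̃(v)`. -/
def IsIota (F : Type*) [NormedAddCommGroup F] [NormedSpace ℝ F] {N : Type*} [TopologicalSpace N]
    [ChartedSpace F N] (H : Distribution E M) (π : M → N) (φ : GradedFrame E M s) (p : M)
    (v : CTangent E p) (R : End1 s) : Prop :=
  ∀ k (ℓ : F →L[ℝ] ℝ), deriv p v (fun y => deriv y (degOneFrame H φ k y) (leafFun F π p ℓ)) =
    ∑ l, R l k * deriv p (degOneFrame H φ l p) (leafFun F π p ℓ)

theorem IsIota.add {v w : CTangent E p} {R R' : End1 s} (h : IsIota F H π φ p v R)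
    (h' : IsIota F H π φ p w R') : IsIota F H π φ p (v + w) (R + R') := by
  intro k ℓ
  rw [deriv_add_vec, h, h', ← Finset.sum_add_distrib]
  simp only [Matrix.add_apply, add_mul]

theorem IsIota.smul {v : CTangent E p} {R : End1 s} (h : IsIota F H π φ p v R) (c : ℂ) :
    IsIota F H π φ p (c • v) (c • R) := by
  intro k ℓ
  rw [deriv_smul_vec, h, Finset.mul_sum]
  simp only [Matrix.smul_apply, smul_eq_mul, mul_assoc]

theorem isIota_zero : IsIota F H π φ p (0 : CTangent E p) 0 := by
  intro k ℓ
  rw [deriv_zero_vec]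
  simp

theorem IsIota.sum {ι : Type*} (t : Finset ι) {v : ι → CTangent E p} {R : ι → End1 s}
    (h : ∀ i, IsIota F H π φ p (v i) (R i)) :
    IsIota F H π φ p (∑ i ∈ t, v i) (∑ i ∈ t, R i) := by
  classical
  induction t using Finset.induction_on with
  | empty => simpa using! isIota_zero
  | insert i t hi ih =>
    rw [Finset.sum_insert hi, Finset.sum_insert hi]
    exact (h i).add ih

/-- The vectors `π_*(F_j(p))` are independent because `ker π_*` is the leaf distribution and `(f,
h)` is independent modulo it. So the scalar equations `IsIota` determine the matrix. -/
theorem IsIota.iotaLeaf_eq (hH : IsCRHypersurface n H) (hπ : IsLeafSpace F H π)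
    (hφ : IsSectionNear H p φ) {v : CTangent E p} {R : End1 s} (h : IsIota F H π φ p v R) :
    iotaLeaf F H π φ p v = R := by
  have hs := hπ.smooth_leafChart p
  ext j k
  rw [iotaLeaf, Matrix.of_apply, coords_eq (c := fun l => R l k)]
  · intro c hc
    apply hH.eq_zero_of_degOne_sum_mem hφ
    rw [(hπ.mem_leafDist p).self_of_nhds]
    intro ℓ
    have h1 := congrArg (pairing ℓ) ((Submodule.mem_bot ℂ).1 hc)
    rw [map_zero, map_sum] at h1
    rw [deriv_sum_vec, ← h1]
    refine Finset.sum_congr rfl fun i _ => ?_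
    rw [deriv_smul_vec, map_smul, smul_eq_mul, deriv_leafFun ℓ hs]
  · rw [Submodule.mem_bot, sub_eq_zero]
    refine eq_of_pairing_eq fun ℓ => ?_
    rw [pairing_derivVec hπ (hH.degOne_section hφ k).smooth, h, map_sum]
    refine Finset.sum_congr rfl fun i _ => ?_
    rw [map_smul, smul_eq_mul, deriv_leafFun ℓ hs]

theorem IsLeafSpace.isIota_of_ad (hH : IsCRHypersurface n H) (hπ : IsLeafSpace F H π)
    (hφ : IsSectionNear H p φ) (hX : IsLocalSection (leafDist H) X p) {R : End1 s}
    (hR : ∀ k, bracket X (degOneFrame H φ k) p - ∑ l, R l k • degOneFrame H φ l p ∈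
      leafDist H p) : IsIota F H π φ p (X p) R := by
  intro k ℓ
  rw [hπ.deriv_deriv hX (hH.degOne_section hφ k).smooth, hπ.deriv_eq_of_sub_mem (hR k),
    deriv_sum_vec]
  simp only [deriv_smul_vec]

/-- The half difference of the diagonal blocks in `omegaMatrix` cancels the scalar part. -/
theorem modElt_omega (A Ξ L : Matrix (Fin s) (Fin s) ℂ) (c : ℂ) :
    (1 / 2 : ℂ) • ((modElt A Ξ L + c • 1).toBlocks₁₁ - (modElt A Ξ L + c • 1).toBlocks₂₂ᵀ) = L := by
  have h : modElt A Ξ L + c • 1 = Matrix.fromBlocks (L + c • 1) (sUp A Ξ) 0 (-Lᵀ + c • 1) := by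
    rw [modElt, ← Matrix.fromBlocks_one, Matrix.fromBlocks_smul, Matrix.fromBlocks_add]
    simp
  rw [h, Matrix.toBlocks_fromBlocks₁₁, Matrix.toBlocks_fromBlocks₂₂]
  simp only [Matrix.transpose_add, Matrix.transpose_neg, Matrix.transpose_transpose,
    Matrix.transpose_smul, Matrix.transpose_one]
  rw [add_sub_add_right_eq_sub, sub_neg_eq_add, ← two_smul ℂ L, smul_smul]
  norm_num

/-- This combines the block form of `ad X` with the identification of `ι` and `ad X`; the matrix `L`
found there is `Ω` by `modElt_omega`. -/
theorem IsLeafSpace.isIota_kernel (hH : IsCRHypersurface n H) (hπ : IsLeafSpace F H π)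
    (hφ : IsSectionNear H p φ) (he : IsKernelFrameNear H p e)
    (hX : IsLocalSection (freeman H 2) X p) :
    ∃ c : ℂ, IsIota F H π φ p (X p) (modElt (leviMatrix H φ p) (xiMatrix H φ X p)
      (omegaMatrix F H π φ p (X p)) + c • 1) := by
  obtain ⟨-, L, c, h⟩ := hH.exists_ad_eq_modElt hφ he hX
  have h1 := hπ.isIota_of_ad hH hφ hX.kernel_to_leaf h
  have h2 : omegaMatrix F H π φ p (X p) = L := by
    rw [omegaMatrix, h1.iotaLeaf_eq hH hπ hφ, modElt_omega]
  rw [h2]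
  exact ⟨c, h1⟩

end LeafSpace

/-! ### Entrywise differentiation of matrix functions -/

section MatrixCalculus

variable {E : Type*} [NormedAddCommGroup E] [NormedSpace ℝ E]
  {M : Type*} [TopologicalSpace M] [ChartedSpace E M] [IsManifold 𝓘(ℝ, E) ∞ M]
  {p : M} {ι : Type*} [Fintype ι] {Y Z : M → Matrix ι ι ℂ} (v w : CTangent E p)

variable (E) in
/-- All entries of a matrix-valued function are smooth near `p`. -/
def SmoothMatrixNear (Z : M → Matrix ι ι ℂ) (p : M) : Prop :=
  ∀ i j, SmoothNear E (fun y => Z y i j) p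

theorem SmoothMatrixNear.mul (hY : SmoothMatrixNear E Y p) (hZ : SmoothMatrixNear E Z p) :
    SmoothMatrixNear E (fun y => Y y * Z y) p := fun i j => .matrix_mul hY hZ i j

theorem SmoothMatrixNear.transpose (hZ : SmoothMatrixNear E Z p) :
    SmoothMatrixNear E (fun y => (Z y)ᵀ) p := fun i j => hZ j i

theorem SmoothMatrixNear.map_star (hZ : SmoothMatrixNear E Z p) :
    SmoothMatrixNear E (fun y => (Z y).map (starRingEnd ℂ)) p := fun i j => (hZ i j).star

theorem derivMatrix_congr (h : ∀ᶠ y in 𝓝 p, Y y = Z y) :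
    derivMatrix p v Y = derivMatrix p v Z := by
  ext i j
  exact deriv_congr _ (by filter_upwards [h] with y hy; rw [hy])

theorem derivMatrix_mul (hY : SmoothMatrixNear E Y p) (hZ : SmoothMatrixNear E Z p) :
    derivMatrix p v (fun y => Y y * Z y) =
      derivMatrix p v Y * Z p + Y p * derivMatrix p v Z := by
  ext i j
  simp only [derivMatrix, Matrix.of_apply, Matrix.mul_apply, Matrix.add_apply]
  rw [deriv_sum _ fun k _ => (hY i k).mul (hZ k j), ← Finset.sum_add_distrib]
  refine Finset.sum_congr rfl fun k _ => ?_
  rw [deriv_mul _ (hY i k) (hZ k j)]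
  ring

theorem derivMatrix_smul {u : M → ℂ} (hu : SmoothNear E u p) (hZ : SmoothMatrixNear E Z p) :
    derivMatrix p v (fun y => u y • Z y) = deriv p v u • Z p + u p • derivMatrix p v Z := by
  ext i j
  simp only [derivMatrix, Matrix.of_apply, Matrix.smul_apply, Matrix.add_apply, smul_eq_mul]
  rw [deriv_mul _ hu (hZ i j)]
  ring

theorem derivMatrix_transpose :
    derivMatrix p v (fun y => (Z y)ᵀ) = (derivMatrix p v Z)ᵀ := rfl

theorem derivMatrix_map_star (hZ : SmoothMatrixNear E Z p) :
    derivMatrix p v (fun y => (Z y).map (starRingEnd ℂ)) =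
      (derivMatrix p (conj v) Z).map (starRingEnd ℂ) := by
  ext i j
  exact deriv_star v (hZ i j)

theorem derivMatrix_add_vec (Z : M → Matrix ι ι ℂ) :
    derivMatrix p (v + w) Z = derivMatrix p v Z + derivMatrix p w Z := by
  ext i j
  exact deriv_add_vec v w _

theorem derivMatrix_upElt {s : ℕ} (S : M → Matrix (Fin s) (Fin s) ℂ) :
    derivMatrix p v (fun y => upElt (S y)) = upElt (derivMatrix p v S) := by
  ext (i | i) (j | j)
  · exact deriv_const v 0
  · rfl
  · exact deriv_const v 0
  · exact deriv_const v 0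

theorem derivMatrix_downElt {s : ℕ} (S : M → Matrix (Fin s) (Fin s) ℂ) :
    derivMatrix p v (fun y => downElt (S y)) = downElt (derivMatrix p v S) := by
  ext (i | i) (j | j)
  · exact deriv_const v 0
  · exact deriv_const v 0
  · rfl
  · exact deriv_const v 0

end MatrixCalculus

/-! ### Change of section: transformation laws near `p` -/

section Gauge

variable {E : Type*} [NormedAddCommGroup E] [NormedSpace ℝ E] [FiniteDimensional ℝ E]
  {M : Type*} [TopologicalSpace M] [ChartedSpace E M] [IsManifold 𝓘(ℝ, E) ∞ M]
  {F : Type*} [NormedAddCommGroup F] [NormedSpace ℝ F]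
  {N : Type*} [TopologicalSpace N] [ChartedSpace F N] [IsManifold 𝓘(ℝ, F) ∞ N]
  {p x : M} {n s r : ℕ} {H : Distribution E M} {φ φ' : GradedFrame E M s}
  {e : Fin r → CField E M} {π : M → N} {X Y Z : CField E M}
  {U : M → Matrix (Fin s) (Fin s) ℂ} {u : M → ℂ}

/-- Near `p`, `φ'` is obtained from `φ` by the action of `(u, U)`, which is trivial at `p`. -/
structure IsGauge (H : Distribution E M) (φ φ' : GradedFrame E M s) (p : M)
    (U : M → Matrix (Fin s) (Fin s) ℂ) (u : M → ℂ) : Prop where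
  smooth_mat : SmoothMatrixNear E U p
  smooth_fun : SmoothNear E u p
  mat_eq : U p = 1
  fun_eq : u p = 1
  g : ∀ᶠ y in 𝓝 p, φ'.g y - u y • φ.g y ∈ contactDist H y
  f : ∀ᶠ y in 𝓝 p, ∀ j, φ'.f j y - ∑ l, U y l j • φ.f l y ∈ freeman H 2 y

/-- The new frame is expanded in the old one with smooth coefficients; equality of the values in `𝓕`
forces them to be trivial at `p`. -/
theorem IsCRHypersurface.exists_gauge (hH : IsCRHypersurface n H) (hφ : IsSectionNear H p φ)
    (hφ' : IsSectionNear H p φ') (he : IsKernelFrameNear H p e) (h : SameValueAt H p φ φ') :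
    ∃ U u, IsGauge H φ φ' p U u := by
  have h1 := fun j => hφ.exists_smooth_coeff he (hφ'.isLocalSection j)
  choose c hc hcf using h1
  obtain ⟨u, hu, hug⟩ := hH.exists_g_coeff hφ hφ'.smooth_g
  refine ⟨fun y => Matrix.of fun l j => c j l y, u, fun i j => hc j i, hu, ?_, ?_, hug, ?_⟩
  · ext l j
    have h2 := sub_mem (hcf j).mem (h.2 j)
    rw [sub_sub_sub_cancel_left] at h2
    have h3 : φ.f j p - ∑ l, c j l p • φ.f l p =
        ∑ l, ((1 : Matrix (Fin s) (Fin s) ℂ) l j - c j l p) • φ.f l p := by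
      simp [sub_smul, Matrix.one_apply]
    rw [h3] at h2
    have h4 := congrFun (hφ.at.eq_zero_of_sum_mem h2) l
    exact (sub_eq_zero.1 h4).symm
  · have h2 : φ'.g p - (1 : ℂ) • φ.g p ∈ contactDist H p := by rw [one_smul]; exact h.1
    exact hφ.at.eq_of_sub_mem hug.self_of_nhds h2
  · have h2 : ∀ j, ∀ᶠ y in 𝓝 p, φ'.f j y - ∑ l, c j l y • φ.f l y ∈ freeman H 2 y := fun j => by
      filter_upwards [hcf j] with y hy using hy.2
    exact eventually_all.2 h2

theorem IsGauge.sameValue (h : IsGauge H φ φ' p U u) : SameValueAt H p φ φ' := by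
  constructor
  · have := h.g.self_of_nhds
    rwa [h.fun_eq, one_smul] at this
  · intro j
    have := h.f.self_of_nhds j
    simpa [h.mat_eq, Matrix.one_apply] using this

/-- The Levi form is tensorial, so its matrix transforms sesquilinearly; `u` appears because the
bracket is measured against the new `g`. -/
theorem IsGauge.levi (h : IsGauge H φ φ' p U u) (hH : IsCRHypersurface n H)
    (hφ : IsSectionNear H p φ) (hφ' : IsSectionNear H p φ') :
    ∀ᶠ y in 𝓝 p, u y • leviMatrix H φ' y =
      (U y)ᵀ * leviMatrix H φ y * (U y).map (starRingEnd ℂ) := by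
  filter_upwards [h.g, h.f, hφ.eventually, hφ'.eventually] with y hg hf h₁ h₂
  ext j k
  have h3 := hH.bracket_sub_combination_mem (fun l => (h₁.isLocalSection l).to_contact)
    (fun l => (h₁.isLocalSection l).conj_to_contact) (h₂.isLocalSection j).to_contact
    (h₂.isLocalSection k).conj_to_contact (fun l => U y l j)
    (fun m => (starRingEnd ℂ) (U y m k)) (Submodule.mem_sup_left (hf j)) (by
      refine Submodule.mem_sup_right ?_
      have h4 := conj_mem_conjSub (hf k)
      rw [map_sub, conj_sum] at h4
      simpa only [conj_smul] using! h4)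
  have h4 : ∑ l, ∑ m, (U y l j * (starRingEnd ℂ) (U y m k)) •
      (bracket (φ.f l) (conjField (φ.f m)) y -
        (2 * Complex.I * leviMatrix H φ y l m) • φ.g y) ∈ contactDist H y :=
    Submodule.sum_mem _ fun l _ => Submodule.sum_mem _ fun m _ =>
      Submodule.smul_mem _ _ (h₁.at.leviMatrix_spec l m)
  have h5 := add_mem h3 h4
  have h6 := add_mem (h₂.at.leviMatrix_spec j k)
    (Submodule.smul_mem _ (2 * Complex.I * leviMatrix H φ' y j k) hg)
  have h7 : (2 * Complex.I) * (u y • leviMatrix H φ' y) j k = (2 * Complex.I) *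
      ((U y)ᵀ * leviMatrix H φ y * (U y).map (starRingEnd ℂ)) j k := by
    refine h₁.at.eq_of_sub_mem (v := bracket (φ'.f j) (conjField (φ'.f k)) y) ?_ ?_
    · convert h6 using 1
      rw [smul_sub, smul_smul, Matrix.smul_apply, smul_eq_mul, sub_add_sub_cancel]
      congr 2
      ring
    · convert h5 using 1
      simp only [smul_sub, Finset.sum_sub_distrib]
      rw [sub_add_sub_cancel]
      congr 1
      simp only [Matrix.mul_apply, Matrix.transpose_apply, Matrix.map_apply, Finset.sum_mul,
        Finset.mul_sum, Finset.sum_smul, smul_smul]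
      rw [Finset.sum_comm]
      refine Finset.sum_congr rfl fun l _ => Finset.sum_congr rfl fun m _ => ?_
      congr 1
      ring
  exact mul_left_cancel₀ (by simp) h7

/-- The action of a gauge transformation on the fields `h₁, …, h_s`. -/
def gaugeH (H : Distribution E M) (φ φ' : GradedFrame E M s)
    (U : M → Matrix (Fin s) (Fin s) ℂ) (y : M) : Matrix (Fin s) (Fin s) ℂ :=
  leviMatrix H φ y * (U y).map (starRingEnd ℂ) * (leviMatrix H φ' y)⁻¹

theorem IsGauge.smooth_gaugeH (h : IsGauge H φ φ' p U u) (hH : IsCRHypersurface n H)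
    (hφ : IsSectionNear H p φ) (hφ' : IsSectionNear H p φ') :
    SmoothMatrixNear E (gaugeH H φ φ' U) p :=
  .mul (.mul (hH.smooth_leviMatrix hφ) h.smooth_mat.map_star) (hH.smooth_inv_leviMatrix hφ')

/-- Both frames `(f, h)` are symplectic with respect to their own `g`, so `h` transforms
contragrediently to `f`, up to `u`. -/
theorem IsGauge.transpose_mul_gaugeH (h : IsGauge H φ φ' p U u) (hH : IsCRHypersurface n H)
    (hφ : IsSectionNear H p φ) (hφ' : IsSectionNear H p φ') :
    ∀ᶠ y in 𝓝 p, (U y)ᵀ * gaugeH H φ φ' U y = u y • 1 := by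
  filter_upwards [h.levi hH hφ hφ', hφ'.eventually] with y h₁ h₂
  rw [gaugeH, ← mul_assoc, ← mul_assoc, ← h₁, Matrix.smul_mul,
    Matrix.mul_nonsing_inv _ (hH.isUnit_leviMatrix h₂)]

/-- The action of a gauge transformation on the frame `(f, h)`. -/
def gaugeF (H : Distribution E M) (φ φ' : GradedFrame E M s)
    (U : M → Matrix (Fin s) (Fin s) ℂ) (y : M) : End1 s :=
  Matrix.fromBlocks (U y) 0 0 (gaugeH H φ φ' U y)

theorem IsGauge.smooth_gaugeF (h : IsGauge H φ φ' p U u) (hH : IsCRHypersurface n H)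
    (hφ : IsSectionNear H p φ) (hφ' : IsSectionNear H p φ') :
    SmoothMatrixNear E (gaugeF H φ φ' U) p := by
  rintro (i | i) (j | j)
  · exact h.smooth_mat i j
  · exact smoothNear_const 0
  · exact smoothNear_const 0
  · exact h.smooth_gaugeH hH hφ hφ' i j

theorem IsGauge.degOne (h : IsGauge H φ φ' p U u) (hH : IsCRHypersurface n H)
    (hφ : IsSectionNear H p φ) :
    ∀ᶠ y in 𝓝 p, ∀ k, degOneFrame H φ' k y - ∑ l, gaugeF H φ φ' U y l k • degOneFrame H φ l y ∈
      leafDist H y := by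
  filter_upwards [h.f, hφ.eventually] with y hf h₁ k
  rcases k with k | k
  · refine Submodule.mem_sup_left ?_
    convert hf k using 1
    simp [Fintype.sum_sum_type, gaugeF, degOneFrame]
  · refine Submodule.mem_sup_right ?_
    have h2 : ∑ j, (leviMatrix H φ' y)⁻¹ j k •
        conj (φ'.f j y - ∑ l, U y l j • φ.f l y) ∈ conjDist (freeman H 2) y :=
      Submodule.sum_mem _ fun j _ => Submodule.smul_mem _ _ (conj_mem_conjSub (hf j))
    convert h2 using 1
    simp only [map_sub, conj_sum, conj_smul, smul_sub, Finset.sum_sub_distrib, degOneFrame,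
      Sum.elim_inr, Sum.elim_inl, gaugeF, Fintype.sum_sum_type, Matrix.fromBlocks_apply₁₂,
      Matrix.fromBlocks_apply₂₂, Matrix.zero_apply, zero_smul, Finset.sum_const_zero, zero_add]
    congr 1
    simp only [hH.conj_f_eq h₁, Finset.smul_sum, smul_smul, gaugeH, Matrix.mul_apply,
      Finset.sum_mul, Finset.sum_smul, Matrix.map_apply]
    rw [Finset.sum_comm]
    refine Finset.sum_congr rfl fun j _ => ?_
    rw [Finset.sum_comm]
    refine Finset.sum_congr rfl fun m _ => Finset.sum_congr rfl fun l _ => ?_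
    congr 1
    ring

/-- Let `R, R'` be the matrices of `ad X` in the two frames and `V = diag(U, W)` the change of
frame. Then `V R' = R V + X(V)`, and the upper right block of `X(V)` vanishes. This leaves `U S' = S
W`, and `W Uᵀ = u` gives the law. -/
theorem IsGauge.up (h : IsGauge H φ φ' p U u) (hH : IsCRHypersurface n H)
    (hπ : IsLeafSpace F H π) (hφ : IsSectionNear H p φ) (hφ' : IsSectionNear H p φ')
    (he : IsKernelFrameNear H p e) (hX : IsLocalSection (freeman H 2) X p) :
    ∀ᶠ y in 𝓝 p, U y * sUp (leviMatrix H φ' y) (xiMatrix H φ' X y) * (U y)ᵀ =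
      u y • sUp (leviMatrix H φ y) (xiMatrix H φ X y) := by
  have hu0 : ∀ᶠ y in 𝓝 p, u y ≠ 0 :=
    h.smooth_fun.self_of_nhds.continuousAt.eventually_ne (by rw [h.fun_eq]; exact one_ne_zero)
  have hsm : ∀ᶠ y in 𝓝 p, SmoothMatrixNear E (gaugeF H φ φ' U) y := by
    have h1 := h.smooth_gaugeF hH hφ hφ'
    have h2 : ∀ i j, ∀ᶠ y in 𝓝 p, SmoothNear E (fun y => gaugeF H φ φ' U y i j) y :=
      fun i j => (h1 i j).eventually
    exact eventually_all.2 fun i => eventually_all.2 (h2 i)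
  filter_upwards [hu0, hsm, h.transpose_mul_gaugeH hH hφ hφ',
    eventually_eventually_nhds.2 (h.degOne hH hφ), hφ.eventually, hφ'.eventually,
    he.eventually, hX.eventually] with y hy0 hys hyW hyF h₁ h₂ h₃ hX
  obtain ⟨-, L, c, hR⟩ := hH.exists_ad_eq_modElt h₁ h₃ hX
  obtain ⟨-, L', c', hR'⟩ := hH.exists_ad_eq_modElt h₂ h₃ hX
  set S := sUp (leviMatrix H φ y) (xiMatrix H φ X y) with hS
  set S' := sUp (leviMatrix H φ' y) (xiMatrix H φ' X y) with hS'
  set R := modElt (leviMatrix H φ y) (xiMatrix H φ X y) L + c • 1 with hRd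
  set R' := modElt (leviMatrix H φ' y) (xiMatrix H φ' X y) L' + c' • 1 with hRd'
  set V := gaugeF H φ φ' U with hV
  have hF := fun k => hH.degOne_section h₁ k
  have hF' := fun k => hH.degOne_section h₂ k
  -- The frames are related only modulo `K₂ ⊕ conj K₂`; the error field stays there under `ad X`
  -- because the leaf distribution is involutive.
  have hlin : ∀ k, ∑ l, ((V y * R') l k - (R * V y) l k - deriv y (X y) fun z => V z l k) •
      degOneFrame H φ l y ∈ leafDist H y := by
    intro k
    have hsum : IsLocalSection (contactDist H) (fun z => ∑ l, V z l k • degOneFrame H φ l z) y :=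
      .sum fun l _ => .smul (hys l k) (hF l)
    have hκ : IsLocalSection (leafDist H)
        (fun z => degOneFrame H φ' k z - ∑ l, V z l k • degOneFrame H φ l z) y := by
      refine isLocalSection_iff.2 ⟨(hF' k).smooth.sub hsum.smooth, ?_⟩
      filter_upwards [hyF] with z hz using hz k
    have h4 := hπ.bracket_mem hX.kernel_to_leaf hκ
    have h5 := bracket_add_right hX.smooth hsum.smooth hκ.smooth
    simp only [add_sub_cancel] at h5
    rw [bracket_sum_right hX.smooth (fun l _ => (hF l).smooth) fun l _ => hys l k] at h5
    have h6 := hR' k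
    change bracket X (fun z => degOneFrame H φ' k z) y - _ ∈ _ at h6
    rw [h5] at h6
    have h7 : ∑ m, R' m k • (degOneFrame H φ' m y - ∑ l, V y l m • degOneFrame H φ l y) ∈
        leafDist H y :=
      Submodule.sum_mem _ fun m _ => Submodule.smul_mem _ _ (hyF.self_of_nhds m)
    have h8 : ∑ l, V y l k • (bracket X (degOneFrame H φ l) y -
        ∑ m, R m l • degOneFrame H φ m y) ∈ leafDist H y :=
      Submodule.sum_mem _ fun l _ => Submodule.smul_mem _ _ (hR l)
    have h9 := neg_mem (sub_mem (sub_mem (add_mem h6 h7) h8) h4)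
    convert h9 using 1
    have e₁ : ∑ l, (V y * R') l k • degOneFrame H φ l y =
        ∑ m, R' m k • ∑ l, V y l m • degOneFrame H φ l y := by
      simp only [Matrix.mul_apply, Finset.sum_smul, Finset.smul_sum, smul_smul]
      rw [Finset.sum_comm]
      simp only [mul_comm]
    have e₂ : ∑ l, (R * V y) l k • degOneFrame H φ l y =
        ∑ l, V y l k • ∑ m, R m l • degOneFrame H φ m y := by
      simp only [Matrix.mul_apply, Finset.sum_smul, Finset.smul_sum, smul_smul]
      rw [Finset.sum_comm]
      simp only [mul_comm]
    simp only [sub_smul, smul_sub, Finset.sum_sub_distrib, Finset.sum_add_distrib]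
    rw [e₁, e₂]
    abel
  have h12 : U y * S' = S * gaugeH H φ φ' U y := by
    ext m k
    have h4 := congrFun (hH.eq_zero_of_degOne_sum_mem h₁ (hlin (Sum.inr k))) (Sum.inl m)
    have h5 : (deriv y (X y) fun z => V z (Sum.inl m) (Sum.inr k)) = 0 := deriv_const _ 0
    have e₁ : (V y * R').toBlocks₁₂ = U y * S' := by
      rw [hRd', modElt, hV, gaugeF, ← hS', ← Matrix.fromBlocks_one, Matrix.fromBlocks_smul,
        Matrix.fromBlocks_add, Matrix.fromBlocks_multiply, Matrix.toBlocks_fromBlocks₁₂]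
      simp
    have e₂ : (R * V y).toBlocks₁₂ = S * gaugeH H φ φ' U y := by
      rw [hRd, modElt, hV, gaugeF, ← hS, ← Matrix.fromBlocks_one, Matrix.fromBlocks_smul,
        Matrix.fromBlocks_add, Matrix.fromBlocks_multiply, Matrix.toBlocks_fromBlocks₁₂]
      simp
    rw [h5, sub_zero] at h4
    have h6 := sub_eq_zero.1 h4
    rw [← e₁, ← e₂]
    exact h6
  have hWU : gaugeH H φ φ' U y * (U y)ᵀ = u y • 1 := by
    have h4 : (U y)ᵀ * ((u y)⁻¹ • gaugeH H φ φ' U y) = 1 := by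
      rw [Matrix.mul_smul, hyW, smul_smul, inv_mul_cancel₀ hy0, one_smul]
    have h5 := mul_eq_one_comm.1 h4
    rw [Matrix.smul_mul] at h5
    rw [← h5, smul_smul, mul_inv_cancel₀ hy0, one_smul]
  rw [h12, mul_assoc, hWU, Matrix.mul_smul, mul_one]

theorem map_star_mul {m : Type*} [Fintype m] (Y Z : Matrix m m ℂ) :
    (Y * Z).map (starRingEnd ℂ) = Y.map (starRingEnd ℂ) * Z.map (starRingEnd ℂ) :=
  Matrix.map_mul

theorem map_star_map_star {m : Type*} (Z : Matrix m m ℂ) :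
    (Z.map (starRingEnd ℂ)).map (starRingEnd ℂ) = Z := by
  ext i j
  simp

theorem map_star_smul {m : Type*} (c : ℂ) (Z : Matrix m m ℂ) :
    (c • Z).map (starRingEnd ℂ) = (starRingEnd ℂ) c • Z.map (starRingEnd ℂ) := by
  ext i j
  simp

/-- This form exhibits `S^{0,-2}` as the lower left block of `σ` applied to `S^{0,2}`. -/
theorem sDown_eq_of_sUp {A Ξ : Matrix (Fin s) (Fin s) ℂ} (hA : IsUnit A.det) :
    sDown A Ξ = A * (sUp A Ξ).map (starRingEnd ℂ) * A.map (starRingEnd ℂ) := by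
  rw [mul_assoc, ← map_star_mul, sUp, Matrix.nonsing_inv_mul_cancel_right _ _ hA, sDown]

/-- Conjugating the law for `S^{0,2}` and inserting the law for `A` on both sides suffices, since
`S^{0,-2} = A conj(S^{0,2}) conj(A)`. -/
theorem IsGauge.down (h : IsGauge H φ φ' p U u) (hH : IsCRHypersurface n H)
    (hπ : IsLeafSpace F H π) (hφ : IsSectionNear H p φ) (hφ' : IsSectionNear H p φ')
    (he : IsKernelFrameNear H p e) (hX : IsLocalSection (freeman H 2) X p) :
    ∀ᶠ y in 𝓝 p, u y • sDown (leviMatrix H φ' y) (xiMatrix H φ' X y) =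
      (U y)ᵀ * sDown (leviMatrix H φ y) (xiMatrix H φ X y) * U y := by
  have hu0 : ∀ᶠ y in 𝓝 p, u y ≠ 0 :=
    h.smooth_fun.self_of_nhds.continuousAt.eventually_ne (by rw [h.fun_eq]; exact one_ne_zero)
  filter_upwards [hu0, h.levi hH hφ hφ', h.up hH hπ hφ hφ' he hX, hφ.eventually,
    hφ'.eventually] with y hy0 hA hS h₁ h₂
  rw [sDown_eq_of_sUp (hH.isUnit_leviMatrix h₁), sDown_eq_of_sUp (hH.isUnit_leviMatrix h₂)]
  set S := sUp (leviMatrix H φ y) (xiMatrix H φ X y)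
  set S' := sUp (leviMatrix H φ' y) (xiMatrix H φ' X y)
  set A := leviMatrix H φ y
  set A' := leviMatrix H φ' y
  have hA2 := congrArg (fun Z => Z.map (starRingEnd ℂ)) hA
  have hS2 := congrArg (fun Z => Z.map (starRingEnd ℂ)) hS
  simp only [map_star_mul, map_star_smul, map_star_map_star] at hA2 hS2
  have hu1 : (starRingEnd ℂ) (u y) ≠ 0 := by simpa using hy0
  -- The law for `conj A'` carries the factor `conj(u)`, so both sides are first multiplied by it.
  refine smul_right_injective _ hu1 ?_
  change (starRingEnd ℂ) (u y) • (u y • (A' * S'.map (starRingEnd ℂ) * A'.map (starRingEnd ℂ))) =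
    (starRingEnd ℂ) (u y) • ((U y)ᵀ * (A * S.map (starRingEnd ℂ) * A.map (starRingEnd ℂ)) * U y)
  calc _ = (u y • A') * S'.map (starRingEnd ℂ) *
        ((starRingEnd ℂ) (u y) • A'.map (starRingEnd ℂ)) := by
        simp only [Matrix.smul_mul, Matrix.mul_smul]
    _ = (U y)ᵀ * A * ((U y).map (starRingEnd ℂ) * S'.map (starRingEnd ℂ) *
        ((U y)ᵀ).map (starRingEnd ℂ)) * A.map (starRingEnd ℂ) * U y := by
        rw [hA, hA2]
        simp only [mul_assoc]
    _ = _ := by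
        rw [hS2]
        simp only [Matrix.smul_mul, Matrix.mul_smul, mul_assoc]

end Gauge

/-! ### Brackets of diagonal with off-diagonal blocks -/

section Blocks

variable {s : ℕ}

theorem upElt_sub (S S' : Matrix (Fin s) (Fin s) ℂ) : upElt (S - S') = upElt S - upElt S' := by
  ext (i | i) (j | j) <;> simp [upElt]

theorem downElt_sub (S S' : Matrix (Fin s) (Fin s) ℂ) :
    downElt (S - S') = downElt S - downElt S' := by
  ext (i | i) (j | j) <;> simp [downElt]

theorem lie_fromBlocks_upElt (P Q S : Matrix (Fin s) (Fin s) ℂ) :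
    ⁅Matrix.fromBlocks P 0 0 Q, upElt S⁆ = upElt (P * S - S * Q) := by
  rw [upElt_sub, Ring.lie_def]
  simp [upElt, Matrix.fromBlocks_multiply]

theorem lie_fromBlocks_downElt (P Q S : Matrix (Fin s) (Fin s) ℂ) :
    ⁅Matrix.fromBlocks P 0 0 Q, downElt S⁆ = downElt (Q * S - S * P) := by
  rw [downElt_sub, Ring.lie_def]
  simp [downElt, Matrix.fromBlocks_multiply]

end Blocks

/-! ### Change of section: first-order effect at `p` -/

section GaugeDerivative

variable {E : Type*} [NormedAddCommGroup E] [NormedSpace ℝ E] [FiniteDimensional ℝ E]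
  {M : Type*} [TopologicalSpace M] [ChartedSpace E M] [IsManifold 𝓘(ℝ, E) ∞ M]
  {F : Type*} [NormedAddCommGroup F] [NormedSpace ℝ F]
  {N : Type*} [TopologicalSpace N] [ChartedSpace F N] [IsManifold 𝓘(ℝ, F) ∞ N]
  {p : M} {n s r : ℕ} {H : Distribution E M} {φ φ' : GradedFrame E M s}
  {e : Fin r → CField E M} {π : M → N} {X : CField E M}
  {U : M → Matrix (Fin s) (Fin s) ℂ} {u : M → ℂ}

theorem IsCRHypersurface.smooth_sUp (hH : IsCRHypersurface n H) (hφ : IsSectionNear H p φ)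
    (he : IsKernelFrameNear H p e) (hX : IsLocalSection (freeman H 2) X p) :
    SmoothMatrixNear E (fun y => sUp (leviMatrix H φ y) (xiMatrix H φ X y)) p :=
  .mul (hH.smooth_xiMatrix hφ he hX) (hH.smooth_inv_leviMatrix hφ)

theorem IsCRHypersurface.smooth_sDown (hH : IsCRHypersurface n H) (hφ : IsSectionNear H p φ)
    (he : IsKernelFrameNear H p e) (hX : IsLocalSection (freeman H 2) X p) :
    SmoothMatrixNear E (fun y => sDown (leviMatrix H φ y) (xiMatrix H φ X y)) p :=
  .mul (hH.smooth_leviMatrix hφ) (.map_star (hH.smooth_xiMatrix hφ he hX))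

theorem map_star_one {m : Type*} [DecidableEq m] :
    (1 : Matrix m m ℂ).map (starRingEnd ℂ) = 1 :=
  Matrix.map_one _ (map_zero _) (map_one _)

theorem IsGauge.leviMatrix_eq (h : IsGauge H φ φ' p U u) (hH : IsCRHypersurface n H)
    (hφ : IsSectionNear H p φ) (hφ' : IsSectionNear H p φ') :
    leviMatrix H φ' p = leviMatrix H φ p := by
  have := (h.levi hH hφ hφ').self_of_nhds
  simpa [h.fun_eq, h.mat_eq, map_star_one] using this

/-- `Ξ` is computed from a bracket, hence from first derivatives; the transformation law at `p`
shows that `S^{0,2}` still depends only on the value of the section in `𝓕`. -/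
theorem IsGauge.sUp_eq (h : IsGauge H φ φ' p U u) (hH : IsCRHypersurface n H)
    (hπ : IsLeafSpace F H π) (hφ : IsSectionNear H p φ) (hφ' : IsSectionNear H p φ')
    (he : IsKernelFrameNear H p e) (hX : IsLocalSection (freeman H 2) X p) :
    sUp (leviMatrix H φ' p) (xiMatrix H φ' X p) = sUp (leviMatrix H φ p) (xiMatrix H φ X p) := by
  have := (h.up hH hπ hφ hφ' he hX).self_of_nhds
  simpa [h.fun_eq, h.mat_eq] using this

theorem IsGauge.sDown_eq (h : IsGauge H φ φ' p U u) (hH : IsCRHypersurface n H)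
    (hπ : IsLeafSpace F H π) (hφ : IsSectionNear H p φ) (hφ' : IsSectionNear H p φ')
    (he : IsKernelFrameNear H p e) (hX : IsLocalSection (freeman H 2) X p) :
    sDown (leviMatrix H φ' p) (xiMatrix H φ' X p) =
      sDown (leviMatrix H φ p) (xiMatrix H φ X p) := by
  have := (h.down hH hπ hφ hφ' he hX).self_of_nhds
  simpa [h.fun_eq, h.mat_eq] using this

theorem IsGauge.upField_eq (h : IsGauge H φ φ' p U u) (hH : IsCRHypersurface n H)
    (hπ : IsLeafSpace F H π) (hφ : IsSectionNear H p φ) (hφ' : IsSectionNear H p φ')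
    (he : IsKernelFrameNear H p e) (hX : IsLocalSection (freeman H 2) X p) :
    upField H φ' X p = upField H φ X p :=
  congrArg upElt (h.sUp_eq hH hπ hφ hφ' he hX)

theorem IsGauge.downField_eq (h : IsGauge H φ φ' p U u) (hH : IsCRHypersurface n H)
    (hπ : IsLeafSpace F H π) (hφ : IsSectionNear H p φ) (hφ' : IsSectionNear H p φ')
    (he : IsKernelFrameNear H p e) (hX : IsLocalSection (freeman H 2) X p) :
    downField H φ' X p = downField H φ X p :=
  congrArg downElt (h.sDown_eq hH hπ hφ hφ' he hX)

theorem IsGauge.g00_eq (h : IsGauge H φ φ' p U u) (hH : IsCRHypersurface n H)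
    (hπ : IsLeafSpace F H π) (hφ : IsSectionNear H p φ) (hφ' : IsSectionNear H p φ')
    (he : IsKernelFrameNear H p e) : g00 H φ' p = g00 H φ p := by
  have h1 : g02 H φ' p = g02 H φ p := by
    refine congrArg (Submodule.span ℂ) (Set.ext fun Z => ?_)
    exact exists_congr fun X => exists_prop.symm.trans <| (exists_congr fun hX => by
      rw [h.upField_eq hH hπ hφ hφ' he hX]).trans exists_prop
  have h2 : g0m2 H φ' p = g0m2 H φ p := by
    refine congrArg (Submodule.span ℂ) (Set.ext fun Z => ?_)
    exact exists_congr fun X => exists_prop.symm.trans <| (exists_congr fun hX => by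
      rw [h.downField_eq hH hπ hφ hφ' he hX]).trans exists_prop
  rw [g00, g00, h1, h2]

/-- The derivative at `p` along `v` of the gauge transformation `(u, U)`, as an element of
`csp_{0,0}`. -/
def gaugeElt (p : M) (v : CTangent E p) (U : M → Matrix (Fin s) (Fin s) ℂ) (u : M → ℂ) : End1 s :=
  diagElt (-(deriv p v u / 2)) (derivMatrix p v U - (deriv p v u / 2) • 1)

theorem gaugeElt_mem (p : M) (v : CTangent E p) (U : M → Matrix (Fin s) (Fin s) ℂ) (u : M → ℂ) :
    gaugeElt p v U u ∈ csp00 s := ⟨_, _, rfl⟩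

/-- The half-shifts in `gaugeElt` serve to display an element of `csp_{0,0}`. In blocks it is the
derivative of `diag(U, u (Uᵀ)⁻¹)` where `U = 1` and `u = 1`. -/
theorem gaugeElt_eq (p : M) (v : CTangent E p) (U : M → Matrix (Fin s) (Fin s) ℂ) (u : M → ℂ) :
    gaugeElt p v U u = Matrix.fromBlocks (derivMatrix p v U) 0 0
      (deriv p v u • 1 - (derivMatrix p v U)ᵀ) := by
  rw [gaugeElt, diagElt]
  congr 1
  · rw [neg_smul, sub_neg_eq_add, sub_add_cancel]
  · rw [Matrix.transpose_sub, Matrix.transpose_smul, Matrix.transpose_one]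
    rw [neg_sub, neg_smul, sub_neg_eq_add, sub_add_eq_add_sub, ← add_smul, add_halves]

/-- The conjugated factor brings in the derivative of `U` along `conj v`, which is independent of
the one along `v`. This is the freedom exploited to make `A` constant to first order. -/
theorem IsGauge.deriv_levi (h : IsGauge H φ φ' p U u) (hH : IsCRHypersurface n H)
    (hφ : IsSectionNear H p φ) (hφ' : IsSectionNear H p φ') (v : CTangent E p) :
    deriv p v u • leviMatrix H φ p + derivMatrix p v (leviMatrix H φ') =
      (derivMatrix p v U)ᵀ * leviMatrix H φ p + derivMatrix p v (leviMatrix H φ) +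
        leviMatrix H φ p * (derivMatrix p (conj v) U).map (starRingEnd ℂ) := by
  have hA : SmoothMatrixNear E (leviMatrix H φ) p := hH.smooth_leviMatrix hφ
  have hA' : SmoothMatrixNear E (leviMatrix H φ') p := hH.smooth_leviMatrix hφ'
  have hU := h.smooth_mat
  have h1 := derivMatrix_congr v (h.levi hH hφ hφ')
  rw [derivMatrix_smul v h.smooth_fun hA', derivMatrix_mul v (hU.transpose.mul hA) hU.map_star,
    derivMatrix_mul v hU.transpose hA, derivMatrix_transpose, derivMatrix_map_star v hU,
    h.leviMatrix_eq hH hφ hφ', h.fun_eq, h.mat_eq, map_star_one, one_smul,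
    Matrix.transpose_one] at h1
  simpa only [mul_one, one_mul] using h1

/-- Differentiating `U S' Uᵀ = u S` where `U = 1` and `u = 1` yields exactly the bracket with the
block-diagonal derivative. -/
theorem IsGauge.deriv_up (h : IsGauge H φ φ' p U u) (hH : IsCRHypersurface n H)
    (hπ : IsLeafSpace F H π) (hφ : IsSectionNear H p φ) (hφ' : IsSectionNear H p φ')
    (he : IsKernelFrameNear H p e) (hX : IsLocalSection (freeman H 2) X p) (v : CTangent E p) :
    derivMatrix p v (upField H φ' X) =
      derivMatrix p v (upField H φ X) - ⁅gaugeElt p v U u, upField H φ X p⁆ := by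
  have hS := hH.smooth_sUp hφ he hX
  have hS' := hH.smooth_sUp hφ' he hX
  have hU := h.smooth_mat
  have h1 := derivMatrix_congr v (h.up hH hπ hφ hφ' he hX)
  rw [derivMatrix_smul v h.smooth_fun hS, derivMatrix_mul v (hU.mul hS') hU.transpose,
    derivMatrix_mul v hU hS', derivMatrix_transpose, h.sUp_eq hH hπ hφ hφ' he hX,
    h.fun_eq, h.mat_eq, one_smul, Matrix.transpose_one] at h1
  simp only [one_mul, mul_one] at h1
  have e₁ : derivMatrix p v (upField H φ' X) = upElt _ := derivMatrix_upElt v _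
  have e₂ : derivMatrix p v (upField H φ X) = upElt _ := derivMatrix_upElt v _
  rw [e₁, e₂, gaugeElt_eq, upField, lie_fromBlocks_upElt, ← upElt_sub, Matrix.mul_sub,
    Matrix.mul_smul, mul_one]
  congr 1
  rw [← sub_eq_zero] at h1 ⊢
  rw [← h1]
  abel

theorem IsGauge.deriv_down (h : IsGauge H φ φ' p U u) (hH : IsCRHypersurface n H)
    (hπ : IsLeafSpace F H π) (hφ : IsSectionNear H p φ) (hφ' : IsSectionNear H p φ')
    (he : IsKernelFrameNear H p e) (hX : IsLocalSection (freeman H 2) X p) (v : CTangent E p) :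
    derivMatrix p v (downField H φ' X) =
      derivMatrix p v (downField H φ X) - ⁅gaugeElt p v U u, downField H φ X p⁆ := by
  have hS := hH.smooth_sDown hφ he hX
  have hS' := hH.smooth_sDown hφ' he hX
  have hU := h.smooth_mat
  have h1 := derivMatrix_congr v (h.down hH hπ hφ hφ' he hX)
  rw [derivMatrix_smul v h.smooth_fun hS', derivMatrix_mul v (hU.transpose.mul hS) hU,
    derivMatrix_mul v hU.transpose hS, derivMatrix_transpose, h.sDown_eq hH hπ hφ hφ' he hX,
    h.fun_eq, h.mat_eq, one_smul, Matrix.transpose_one] at h1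
  simp only [one_mul, mul_one] at h1
  have e₁ : derivMatrix p v (downField H φ' X) = downElt _ := derivMatrix_downElt v _
  have e₂ : derivMatrix p v (downField H φ X) = downElt _ := derivMatrix_downElt v _
  rw [e₁, e₂, gaugeElt_eq, downField, lie_fromBlocks_downElt, ← downElt_sub, Matrix.sub_mul,
    Matrix.smul_mul, one_mul]
  congr 1
  rw [← sub_eq_zero] at h1 ⊢
  rw [← h1]
  abel

/-- The lower block comes from differentiating `Uᵀ W = u` at `p`. -/
theorem IsGauge.derivMatrix_gaugeF (h : IsGauge H φ φ' p U u) (hH : IsCRHypersurface n H)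
    (hφ : IsSectionNear H p φ) (hφ' : IsSectionNear H p φ') (v : CTangent E p) :
    derivMatrix p v (gaugeF H φ φ' U) = gaugeElt p v U u := by
  have hW1 : gaugeH H φ φ' U p = 1 := by
    rw [gaugeH, h.mat_eq, map_star_one, mul_one, h.leviMatrix_eq hH hφ hφ',
      Matrix.mul_nonsing_inv _ (hH.isUnit_leviMatrix hφ)]
  have h1 := derivMatrix_congr v (h.transpose_mul_gaugeH hH hφ hφ')
  have hone : SmoothMatrixNear E (fun _ : M => (1 : Matrix (Fin s) (Fin s) ℂ)) p :=
    fun i j => smoothNear_const _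
  have hone' : derivMatrix p v (fun _ : M => (1 : Matrix (Fin s) (Fin s) ℂ)) = 0 := by
    ext i j
    exact deriv_const v _
  rw [derivMatrix_mul v h.smooth_mat.transpose (h.smooth_gaugeH hH hφ hφ'),
    derivMatrix_smul v h.smooth_fun hone, derivMatrix_transpose, hW1, h.mat_eq, hone',
    Matrix.transpose_one, mul_one, one_mul, smul_zero, add_zero] at h1
  rw [gaugeElt_eq, ← h1, add_sub_cancel_left]
  ext (i | i) (j | j)
  · rfl
  · exact deriv_const v 0
  · exact deriv_const v 0
  · rfl

/-- Along the leaf `π_*` of the new frame is `π_*` of the old one times `V`; since `V(p) = 1`, the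
Leibniz rule adds the derivative of `V`. -/
theorem IsGauge.isIota (h : IsGauge H φ φ' p U u) (hH : IsCRHypersurface n H)
    (hπ : IsLeafSpace F H π) (hφ : IsSectionNear H p φ) (hφ' : IsSectionNear H p φ')
    {v : CTangent E p} {R : End1 s} (hR : IsIota F H π φ p v R) :
    IsIota F H π φ' p v (R + gaugeElt p v U u) := by
  have hV := h.smooth_gaugeF hH hφ hφ'
  have hV1 : gaugeF H φ φ' U p = 1 := by
    rw [gaugeF, gaugeH, h.mat_eq, map_star_one, mul_one, h.leviMatrix_eq hH hφ hφ',
      Matrix.mul_nonsing_inv _ (hH.isUnit_leviMatrix hφ), Matrix.fromBlocks_one]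
  have hfun : ∀ ℓ : F →L[ℝ] ℝ, ∀ᶠ y in 𝓝 p, ∀ k,
      deriv y (degOneFrame H φ' k y) (leafFun F π p ℓ) =
        ∑ l, gaugeF H φ φ' U y l k * deriv y (degOneFrame H φ l y) (leafFun F π p ℓ) := by
    intro ℓ
    filter_upwards [h.degOne hH hφ, hπ.mem_leafDist p] with y h₁ h₂ k
    have h3 := (h₂ _).1 (h₁ k) ℓ
    rw [deriv_sub_vec, deriv_sum_vec, sub_eq_zero] at h3
    simpa only [deriv_smul_vec] using h3
  intro k ℓ
  have hd : ∀ l, SmoothNear E (fun y => deriv y (degOneFrame H φ l y) (leafFun F π p ℓ)) p :=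
    fun l => (hπ.smooth_leafFun p ℓ).deriv (hH.degOne_section hφ l).smooth
  rw [deriv_congr v ((hfun ℓ).mono fun y hy => hy k),
    deriv_sum v fun l _ => (hV l k).mul (hd l)]
  simp only [(hfun ℓ).self_of_nhds, hV1]
  have e₁ : ∀ l, deriv p v (fun y => gaugeF H φ φ' U y l k *
      deriv y (degOneFrame H φ l y) (leafFun F π p ℓ)) =
      (1 : End1 s) l k * ∑ m, R m l * deriv p (degOneFrame H φ m p) (leafFun F π p ℓ) +
      deriv p (degOneFrame H φ l p) (leafFun F π p ℓ) * gaugeElt p v U u l k := by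
    intro l
    rw [deriv_mul v (hV l k) (hd l), hR l ℓ, hV1, ← h.derivMatrix_gaugeF hH hφ hφ' v]
    rfl
  simp only [e₁, Finset.sum_add_distrib, Matrix.one_apply, ite_mul, one_mul, zero_mul,
    Finset.sum_ite_eq', Finset.mem_univ, if_true, Matrix.add_apply, add_mul]
  congr 1
  exact Finset.sum_congr rfl fun l _ => mul_comm _ _

end GaugeDerivative

/-! ### Representatives of classes -/

section Quotients

variable {V : Type*} [AddCommGroup V] [Module ℂ V] {C G : Submodule ℂ V}
  {q q' : C ⧸ G.submoduleOf C} {x y : V}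

theorem exists_isClassOf (q : C ⧸ G.submoduleOf C) : ∃ x, IsClassOf q x := by
  obtain ⟨⟨x, hx⟩, rfl⟩ := Submodule.Quotient.mk_surjective _ q
  exact ⟨x, hx, rfl⟩

theorem IsClassOf.mem (h : IsClassOf q x) : x ∈ C := h.1

theorem IsClassOf.sub_mem (h : IsClassOf q x) (h' : IsClassOf q y) : x - y ∈ G := by
  obtain ⟨hx, rfl⟩ := h
  obtain ⟨hy, h⟩ := h'
  exact (Submodule.Quotient.eq (G.submoduleOf C)).1 h.symm

theorem IsClassOf.congr (h : IsClassOf q x) (hG : G ≤ C) (hxy : x - y ∈ G) : IsClassOf q y := by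
  obtain ⟨hx, rfl⟩ := h
  have hy : y ∈ C := (Submodule.sub_mem_iff_right C hx).1 (hG hxy)
  exact ⟨hy, ((Submodule.Quotient.eq (G.submoduleOf C)).2 hxy).symm⟩

theorem isClassOf_mk (hx : x ∈ C) :
    IsClassOf (Submodule.Quotient.mk ⟨x, hx⟩ : C ⧸ G.submoduleOf C) x := ⟨hx, rfl⟩

theorem IsClassOf.eq_of_sub_mem (h : IsClassOf q x) (h' : IsClassOf q' y) (hxy : x - y ∈ G) :
    q = q' := by
  obtain ⟨hx, rfl⟩ := h
  obtain ⟨hy, rfl⟩ := h'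
  exact (Submodule.Quotient.eq (G.submoduleOf C)).2 hxy

end Quotients

/-! ### The antilinear involution `σ` on `csp` -/

section Involution

variable {s : ℕ} {A : Matrix (Fin s) (Fin s) ℂ} {Z W : End1 s}

theorem map_star_inv (hA : IsUnit A.det) :
    ((A.map (starRingEnd ℂ))⁻¹).map (starRingEnd ℂ) = A⁻¹ := by
  have h1 : A.map (starRingEnd ℂ) * (A⁻¹).map (starRingEnd ℂ) = 1 := by
    rw [← map_star_mul, Matrix.mul_nonsing_inv _ hA, map_star_one]
  rw [Matrix.inv_eq_right_inv h1, map_star_map_star]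

theorem sigma_fromBlocks (hA : IsUnit A.det) (P Q R T : Matrix (Fin s) (Fin s) ℂ) :
    sigma A (Matrix.fromBlocks P Q R T) = Matrix.fromBlocks
      ((A.map (starRingEnd ℂ))⁻¹ * T.map (starRingEnd ℂ) * A.map (starRingEnd ℂ))
      ((A.map (starRingEnd ℂ))⁻¹ * R.map (starRingEnd ℂ) * A⁻¹)
      (A * Q.map (starRingEnd ℂ) * A.map (starRingEnd ℂ))
      (A * P.map (starRingEnd ℂ) * A⁻¹) := by
  have h0 : (0 : Matrix (Fin s) (Fin s) ℂ).map (starRingEnd ℂ) = 0 := by ext; simp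
  rw [sigma, conjMatrix, Matrix.fromBlocks_map, Matrix.fromBlocks_map, map_star_inv hA, h0,
    Matrix.fromBlocks_multiply, Matrix.fromBlocks_multiply]
  simp

theorem sigma_add (Z W : End1 s) : sigma A (Z + W) = sigma A Z + sigma A W := by
  have h : (Z + W).map (starRingEnd ℂ) = Z.map (starRingEnd ℂ) + W.map (starRingEnd ℂ) := by
    ext; simp
  rw [sigma, h, mul_add, add_mul]
  rfl

theorem sigma_smul (c : ℂ) (Z : End1 s) : sigma A (c • Z) = (starRingEnd ℂ) c • sigma A Z := by
  rw [sigma, map_star_smul, Matrix.mul_smul, Matrix.smul_mul]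
  rfl

theorem sigma_zero : sigma A (0 : End1 s) = 0 := by
  simpa using sigma_smul (A := A) 0 (0 : End1 s)

theorem sigma_sub (Z W : End1 s) : sigma A (Z - W) = sigma A Z - sigma A W := by
  rw [sub_eq_add_neg, sigma_add, ← neg_one_smul ℂ W, sigma_smul]
  simp [sub_eq_add_neg]

theorem sigma_sum {ι : Type*} (t : Finset ι) (Z : ι → End1 s) :
    sigma A (∑ i ∈ t, Z i) = ∑ i ∈ t, sigma A (Z i) := by
  classical
  induction t using Finset.induction_on with
  | empty => exact sigma_zero
  | insert i t hi ih => rw [Finset.sum_insert hi, Finset.sum_insert hi, sigma_add, ih]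

/-- This expresses that conjugation squares to the identity; hence `σ` is multiplicative and
involutive. -/
theorem conjMatrix_mul_map_star (hA : IsUnit A.det) :
    conjMatrix A * (conjMatrix A).map (starRingEnd ℂ) = 1 := by
  have h0 : (0 : Matrix (Fin s) (Fin s) ℂ).map (starRingEnd ℂ) = 0 := by ext; simp
  have h1 : (A.map (starRingEnd ℂ))⁻¹ * A.map (starRingEnd ℂ) = 1 := by
    have h2 := congrArg (fun Z => Z.map (starRingEnd ℂ)) (Matrix.nonsing_inv_mul A hA)
    rw [← map_star_inv hA] at h2
    simpa only [map_star_mul, map_star_map_star, map_star_one] using h2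
  rw [conjMatrix, Matrix.fromBlocks_map, map_star_inv hA, h0, Matrix.fromBlocks_multiply]
  simp [h1, Matrix.mul_nonsing_inv A hA]

theorem map_star_mul_conjMatrix (hA : IsUnit A.det) :
    (conjMatrix A).map (starRingEnd ℂ) * conjMatrix A = 1 :=
  mul_eq_one_comm.1 (conjMatrix_mul_map_star hA)

theorem sigma_mul (hA : IsUnit A.det) (Z W : End1 s) :
    sigma A (Z * W) = sigma A Z * sigma A W := by
  simp only [sigma, map_star_mul]
  calc _ = conjMatrix A * Z.map (starRingEnd ℂ) * 1 * W.map (starRingEnd ℂ) *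
        (conjMatrix A).map (starRingEnd ℂ) := by simp only [mul_assoc, one_mul]
    _ = _ := by
        rw [← map_star_mul_conjMatrix hA]
        simp only [mul_assoc]

theorem sigma_sigma (hA : IsUnit A.det) (Z : End1 s) : sigma A (sigma A Z) = Z := by
  simp only [sigma, map_star_mul, map_star_map_star]
  calc _ = conjMatrix A * (conjMatrix A).map (starRingEnd ℂ) * Z *
        (conjMatrix A * (conjMatrix A).map (starRingEnd ℂ)) := by simp only [mul_assoc]
    _ = _ := by rw [conjMatrix_mul_map_star hA, one_mul, mul_one]

theorem sigma_lie (hA : IsUnit A.det) (Z W : End1 s) :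
    sigma A ⁅Z, W⁆ = ⁅sigma A Z, sigma A W⁆ := by
  rw [Ring.lie_def, sigma_sub, sigma_mul hA, sigma_mul hA, Ring.lie_def]

theorem sigma_up (hA : IsUnit A.det) (Ξ : Matrix (Fin s) (Fin s) ℂ) :
    sigma A (upElt (sUp A Ξ)) = downElt (sDown A Ξ) := by
  have h0 : (0 : Matrix (Fin s) (Fin s) ℂ).map (starRingEnd ℂ) = 0 := by ext; simp
  rw [upElt, sigma_fromBlocks hA, sDown_eq_of_sUp hA, downElt, h0]
  simp

theorem sigma_down (hA : IsUnit A.det) (Ξ : Matrix (Fin s) (Fin s) ℂ) :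
    sigma A (downElt (sDown A Ξ)) = upElt (sUp A Ξ) := by
  rw [← sigma_up hA, sigma_sigma hA]

/-- `σ` exchanges and conjugates the diagonal blocks. The relation between them survives because
conjugation by `A` and by `Aᴴ` agree, and here the Levi matrix must be Hermitian up to a factor. -/
theorem sigma_mem_csp00 (hA : IsUnit A.det) {c : ℂ} (hc : A = c • Aᴴ) (hZ : Z ∈ csp00 s) :
    sigma A Z ∈ csp00 s := by
  obtain ⟨d, L, rfl⟩ := hZ
  have hA' : IsUnit (A.map (starRingEnd ℂ)).det := by
    rw [← RingHom.mapMatrix_apply, ← RingHom.map_det]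
    exact hA.map _
  have e₁ : ∀ Y : Matrix (Fin s) (Fin s) ℂ, (-Yᵀ - d • 1).map (starRingEnd ℂ) =
      -(Y.map (starRingEnd ℂ))ᵀ - (starRingEnd ℂ) d • 1 := by
    intro Y
    ext i j
    by_cases h : i = j <;> simp [h]
  have e₂ : (L - d • 1).map (starRingEnd ℂ) =
      L.map (starRingEnd ℂ) - (starRingEnd ℂ) d • 1 := by
    ext i j
    by_cases h : i = j <;> simp [h]
  have h0 : (0 : Matrix (Fin s) (Fin s) ℂ).map (starRingEnd ℂ) = 0 := by ext; simp
  have hH : Aᴴ = (A.map (starRingEnd ℂ))ᵀ := rfl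
  refine ⟨(starRingEnd ℂ) d, -((A.map (starRingEnd ℂ))⁻¹ * (L.map (starRingEnd ℂ))ᵀ *
    A.map (starRingEnd ℂ)), ?_⟩
  rw [diagElt, sigma_fromBlocks hA, diagElt, e₁, e₂, h0]
  -- The proportionality factor of `A` and `Aᴴ` cancels in a conjugation.
  have e₃ : A * L.map (starRingEnd ℂ) * A⁻¹ =
      Aᴴ * L.map (starRingEnd ℂ) * (Aᴴ)⁻¹ := by
    have hu : IsUnit (Aᴴ).det := by rw [hH, Matrix.det_transpose]; exact hA'
    have h1 : A * L.map (starRingEnd ℂ) = (Aᴴ * L.map (starRingEnd ℂ) * (Aᴴ)⁻¹) * A := by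
      nth_rewrite 1 [hc]
      nth_rewrite 4 [hc]
      rw [Matrix.mul_smul, mul_assoc _ _ Aᴴ, Matrix.nonsing_inv_mul _ hu, mul_one,
        Matrix.smul_mul]
    rw [h1, mul_assoc, Matrix.mul_nonsing_inv _ hA, mul_one]
  congr 1
  · rw [mul_sub, sub_mul, Matrix.mul_smul, Matrix.smul_mul, mul_one,
      Matrix.nonsing_inv_mul _ hA', mul_neg, neg_mul]
  · simp
  · simp
  · rw [mul_sub, sub_mul, Matrix.mul_smul, Matrix.smul_mul, mul_one,
      Matrix.mul_nonsing_inv _ hA, e₃, Matrix.transpose_neg, neg_neg, Matrix.transpose_mul,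
      Matrix.transpose_mul, Matrix.transpose_transpose, hH, Matrix.transpose_nonsing_inv, mul_assoc]

theorem sigma_mem_span {ι : Type*} {x : ι → End1 s} {P : Submodule ℂ (End1 s)}
    (h : ∀ i, sigma A (x i) ∈ P) (hZ : Z ∈ Submodule.span ℂ (Set.range x)) : sigma A Z ∈ P := by
  induction hZ using Submodule.span_induction with
  | mem y hy =>
    obtain ⟨i, rfl⟩ := hy
    exact h i
  | zero => rw [sigma_zero]; exact P.zero_mem
  | add y z _ _ hy hz => rw [sigma_add]; exact P.add_mem hy hz
  | smul c y _ hy => rw [sigma_smul]; exact P.smul_mem _ hy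

/-- `σ` respects brackets and exchanges `P` and `Q`, so it carries the condition on one to the
condition on the other. -/
theorem sigma_mem_stabilizer (hA : IsUnit A.det) {c : ℂ} (hc : A = c • Aᴴ)
    {P Q : Submodule ℂ (End1 s)} (hP : ∀ W ∈ P, sigma A W ∈ Q) (hQ : ∀ W ∈ Q, sigma A W ∈ P)
    (hZ : Z ∈ stabilizer P Q) : sigma A Z ∈ stabilizer P Q := by
  obtain ⟨h₁, h₂, h₃⟩ := hZ
  refine ⟨sigma_mem_csp00 hA hc h₁, fun W hW => ?_, fun W hW => ?_⟩
  · have h := hQ _ (h₃ _ (hP W hW))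
    rwa [sigma_lie hA, sigma_sigma hA] at h
  · have h := hP _ (h₂ _ (hQ W hW))
    rwa [sigma_lie hA, sigma_sigma hA] at h

/-- The identity is central and equals `diagElt (-1) 0`. Hence scalar parts of `ι` are invisible
modulo `𝔤_{0,0}`. -/
theorem one_mem_stabilizer (P Q : Submodule ℂ (End1 s)) : (1 : End1 s) ∈ stabilizer P Q := by
  have h : ∀ W : End1 s, ⁅(1 : End1 s), W⁆ = 0 := fun W => by simp [Ring.lie_def]
  refine ⟨⟨-1, 0, ?_⟩, fun W _ => ?_, fun W _ => ?_⟩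
  · simp [diagElt, Matrix.fromBlocks_one]
  · rw [h]; exact P.zero_mem
  · rw [h]; exact Q.zero_mem

/-- The part of degree zero of a modified symbol depends on `𝔤_{0,+}` modulo `𝔤_{0,0}` only. -/
theorem span_sup_span_sigma_le {ι : Type*} {x y : ι → End1 s} {G : Submodule ℂ (End1 s)}
    (hG : ∀ W ∈ G, sigma A W ∈ G) (h : ∀ i, x i - y i ∈ G) :
    Submodule.span ℂ (Set.range x) ⊔ Submodule.span ℂ (Set.range fun i => sigma A (x i)) ⊔ G ≤
    Submodule.span ℂ (Set.range y) ⊔ Submodule.span ℂ (Set.range fun i => sigma A (y i)) ⊔ G := by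
  refine sup_le (sup_le ?_ ?_) le_sup_right
  · rw [Submodule.span_le]
    rintro _ ⟨i, rfl⟩
    have h1 := add_mem (Submodule.mem_sup_right (S := Submodule.span ℂ (Set.range y) ⊔
        Submodule.span ℂ (Set.range fun i => sigma A (y i))) (h i))
      (Submodule.mem_sup_left (Submodule.mem_sup_left
        (Submodule.subset_span (Set.mem_range_self i))))
    rwa [sub_add_cancel] at h1
  · rw [Submodule.span_le]
    rintro _ ⟨i, rfl⟩
    have h2 := hG _ (h i)
    rw [sigma_sub] at h2
    have h1 := add_mem (Submodule.mem_sup_right (S := Submodule.span ℂ (Set.range y) ⊔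
        Submodule.span ℂ (Set.range fun i => sigma A (y i))) h2)
      (Submodule.mem_sup_left (Submodule.mem_sup_right
        (Submodule.subset_span (Set.mem_range_self i))))
    rwa [sub_add_cancel] at h1

theorem span_sup_span_sigma_eq {ι : Type*} {x y : ι → End1 s} {G : Submodule ℂ (End1 s)}
    (hG : ∀ W ∈ G, sigma A W ∈ G) (h : ∀ i, x i - y i ∈ G) :
    Submodule.span ℂ (Set.range x) ⊔ Submodule.span ℂ (Set.range fun i => sigma A (x i)) ⊔ G =
    Submodule.span ℂ (Set.range y) ⊔ Submodule.span ℂ (Set.range fun i => sigma A (y i)) ⊔ G :=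
  le_antisymm (span_sup_span_sigma_le hG h) (span_sup_span_sigma_le hG fun i => by
    rw [← neg_sub]; exact neg_mem (h i))

end Involution

/-! ### `𝔤_{0,±2}`, `𝔤_{0,0}` and modified symbols in terms of a kernel frame -/

section Symbols

variable {E : Type*} [NormedAddCommGroup E] [NormedSpace ℝ E] [FiniteDimensional ℝ E]
  {M : Type*} [TopologicalSpace M] [ChartedSpace E M] [IsManifold 𝓘(ℝ, E) ∞ M]
  {F : Type*} [NormedAddCommGroup F] [NormedSpace ℝ F]
  {N : Type*} [TopologicalSpace N] [ChartedSpace F N] [IsManifold 𝓘(ℝ, F) ∞ N]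
  {p : M} {n s r : ℕ} {H : Distribution E M} {φ φ' : GradedFrame E M s}
  {e : Fin r → CField E M} {π : M → N} {X : CField E M}
  {U : M → Matrix (Fin s) (Fin s) ℂ} {u : M → ℂ}

theorem upElt_smul (c : ℂ) (S : Matrix (Fin s) (Fin s) ℂ) : upElt (c • S) = c • upElt S := by
  ext (i | i) (j | j) <;> simp [upElt]

theorem upElt_sum {ι : Type*} (t : Finset ι) (S : ι → Matrix (Fin s) (Fin s) ℂ) :
    upElt (∑ i ∈ t, S i) = ∑ i ∈ t, upElt (S i) := by
  ext (i | i) (j | j) <;> simp [upElt, Matrix.sum_apply]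

theorem IsCRHypersurface.upField_combination (hH : IsCRHypersurface n H)
    (hφ : IsSectionNear H p φ) (he : IsKernelFrameNear H p e)
    (hX : IsLocalSection (freeman H 2) X p) :
    ∃ c : Fin r → ℂ, upField H φ X p = ∑ α, c α • upField H φ (e α) p := by
  obtain ⟨b, hb, hXb⟩ := he.frame.coeff hX
  refine ⟨fun α => b α p, ?_⟩
  rw [upField, sUp, hH.xiMatrix_combination hφ he hb hX hXb, Finset.sum_mul, upElt_sum]
  refine Finset.sum_congr rfl fun α _ => ?_
  rw [Matrix.smul_mul, upElt_smul]
  rfl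

theorem IsCRHypersurface.sigma_upField (hH : IsCRHypersurface n H) (hφ : IsSectionNear H p φ)
    (X : CField E M) : sigma (leviMatrix H φ p) (upField H φ X p) = downField H φ X p :=
  sigma_up (hH.isUnit_leviMatrix hφ) _

theorem IsCRHypersurface.sigma_downField (hH : IsCRHypersurface n H) (hφ : IsSectionNear H p φ)
    (X : CField E M) : sigma (leviMatrix H φ p) (downField H φ X p) = upField H φ X p :=
  sigma_down (hH.isUnit_leviMatrix hφ) _

theorem IsCRHypersurface.g02_eq (hH : IsCRHypersurface n H) (hφ : IsSectionNear H p φ)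
    (he : IsKernelFrameNear H p e) :
    g02 H φ p = Submodule.span ℂ (Set.range fun α => upField H φ (e α) p) := by
  refine le_antisymm (Submodule.span_le.2 ?_) (Submodule.span_le.2 ?_)
  · rintro _ ⟨X, hX, rfl⟩
    obtain ⟨c, hc⟩ := hH.upField_combination hφ he hX
    rw [hc]
    exact Submodule.sum_mem _ fun α _ => Submodule.smul_mem _ _
      (Submodule.subset_span (Set.mem_range_self α))
  · rintro _ ⟨α, rfl⟩
    exact Submodule.subset_span ⟨e α, he.frame.isLocalSection α, rfl⟩

theorem IsCRHypersurface.g0m2_eq (hH : IsCRHypersurface n H) (hφ : IsSectionNear H p φ)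
    (he : IsKernelFrameNear H p e) :
    g0m2 H φ p = Submodule.span ℂ (Set.range fun α => downField H φ (e α) p) := by
  refine le_antisymm (Submodule.span_le.2 ?_) (Submodule.span_le.2 ?_)
  · rintro _ ⟨X, hX, rfl⟩
    obtain ⟨c, hc⟩ := hH.upField_combination hφ he hX
    -- `S^{0,-2}` is antilinear in the section, so the combination for `S^{0,2}` is transported by
    -- `σ`.
    have h := congrArg (sigma (leviMatrix H φ p)) hc
    rw [hH.sigma_upField hφ, sigma_sum] at h
    rw [h]
    refine Submodule.sum_mem _ fun α _ => ?_
    rw [sigma_smul, hH.sigma_upField hφ]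
    exact Submodule.smul_mem _ _ (Submodule.subset_span (Set.mem_range_self α))
  · rintro _ ⟨α, rfl⟩
    exact Submodule.subset_span ⟨e α, he.frame.isLocalSection α, rfl⟩

theorem IsCRHypersurface.g00_eq (hH : IsCRHypersurface n H) (hφ : IsSectionNear H p φ)
    (he : IsKernelFrameNear H p e) :
    g00 H φ p = stabilizer (Submodule.span ℂ (Set.range fun α => upField H φ (e α) p))
      (Submodule.span ℂ (Set.range fun α => downField H φ (e α) p)) := by
  rw [g00, hH.g02_eq hφ he, hH.g0m2_eq hφ he]

theorem IsCRHypersurface.upField_mem (hH : IsCRHypersurface n H) (hφ : IsSectionNear H p φ)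
    (he : IsKernelFrameNear H p e) (hX : IsLocalSection (freeman H 2) X p) :
    upField H φ X p ∈ csp02 s := ⟨_, (hH.exists_ad_eq_modElt hφ he hX).1, rfl⟩

/-- In `A conj(S) conj(A)` transposition exchanges the outer factors up to `a` and `a⁻¹`, where `A =
a Aᴴ`; these cancel and symmetry of `S` remains. -/
theorem IsCRHypersurface.downField_mem (hH : IsCRHypersurface n H) (hφ : IsSectionNear H p φ)
    (he : IsKernelFrameNear H p e) (hX : IsLocalSection (freeman H 2) X p) :
    downField H φ X p ∈ csp0m2 s := by
  refine ⟨_, ?_, rfl⟩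
  have hS := (hH.exists_ad_eq_modElt hφ he hX).1
  obtain ⟨a, -, ha0, ha⟩ := hH.exists_leviMatrix_eq_smul hφ
  have hA := hH.isUnit_leviMatrix hφ
  rw [sDown_eq_of_sUp hA]
  set S := sUp (leviMatrix H φ p) (xiMatrix H φ X p)
  have h1 := ha.self_of_nhds
  set A := leviMatrix H φ p
  have h2 : A = a p • (A.map (starRingEnd ℂ))ᵀ := h1
  have h3 : (A.map (starRingEnd ℂ))ᵀ = (a p)⁻¹ • A := by
    nth_rewrite 2 [h2]
    rw [smul_smul, inv_mul_cancel₀ ha0, one_smul]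
  have h4 : Aᵀ = a p • A.map (starRingEnd ℂ) := by
    nth_rewrite 1 [h2]
    rw [Matrix.transpose_smul, Matrix.transpose_transpose]
  have h5 : (S.map (starRingEnd ℂ))ᵀ = S.map (starRingEnd ℂ) := by
    rw [← Matrix.transpose_map, hS.eq]
  rw [Matrix.IsSymm, Matrix.transpose_mul, Matrix.transpose_mul, h3, h4, h5]
  simp only [Matrix.smul_mul, Matrix.mul_smul, smul_smul, one_smul, mul_assoc,
    mul_inv_cancel₀ ha0]

theorem IsCRHypersurface.g02_le (hH : IsCRHypersurface n H) (hφ : IsSectionNear H p φ)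
    (he : IsKernelFrameNear H p e) : g02 H φ p ≤ csp02 s := by
  refine Submodule.span_le.2 ?_
  rintro _ ⟨X, hX, rfl⟩
  exact hH.upField_mem hφ he hX

theorem IsCRHypersurface.g0m2_le (hH : IsCRHypersurface n H) (hφ : IsSectionNear H p φ)
    (he : IsKernelFrameNear H p e) : g0m2 H φ p ≤ csp0m2 s := by
  refine Submodule.span_le.2 ?_
  rintro _ ⟨X, hX, rfl⟩
  exact hH.downField_mem hφ he hX

theorem IsCRHypersurface.sigma_mem_g00 (hH : IsCRHypersurface n H) (hφ : IsSectionNear H p φ)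
    (he : IsKernelFrameNear H p e) {W : End1 s} (hW : W ∈ g00 H φ p) :
    sigma (leviMatrix H φ p) W ∈ g00 H φ p := by
  obtain ⟨a, -, -, ha⟩ := hH.exists_leviMatrix_eq_smul hφ
  rw [hH.g00_eq hφ he] at hW ⊢
  refine sigma_mem_stabilizer (hH.isUnit_leviMatrix hφ) ha.self_of_nhds
    (fun W hW => ?_) (fun W hW => ?_) hW
  · refine sigma_mem_span (fun α => ?_) hW
    rw [hH.sigma_upField hφ]
    exact Submodule.subset_span (Set.mem_range_self α)
  · refine sigma_mem_span (fun α => ?_) hW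
    rw [hH.sigma_downField hφ]
    exact Submodule.subset_span (Set.mem_range_self α)

theorem IsKernelFrameNear.exists_combination (he : IsKernelFrameNear H p e) {v : CTangent E p}
    (hv : v ∈ freeman H 2 p) : ∃ c : Fin r → ℂ, v = ∑ α, c α • e α p := by
  rw [← he.self_of_nhds.2.2] at hv
  obtain ⟨c, hc⟩ := (Submodule.mem_span_range_iff_exists_fun ℂ).1 hv
  exact ⟨c, hc.symm⟩

/-- `ι` is linear in `v`, so the spans over all of `K₂(p)` reduce to those over the frame `e`. -/
theorem modifiedSymbol_eq (hH : IsCRHypersurface n H) (hπ : IsLeafSpace F H π)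
    (hφ : IsSectionNear H p φ) (he : IsKernelFrameNear H p e) {R : Fin r → End1 s}
    (hR : ∀ α, IsIota F H π φ p (e α p) (R α)) :
    modifiedSymbol F H π φ p = (⊤ : Submodule ℂ (Heis s)).prod
      (Submodule.span ℂ (Set.range R) ⊔
        Submodule.span ℂ (Set.range fun α => sigma (leviMatrix H φ p) (R α)) ⊔ g00 H φ p) := by
  have hsum : ∀ c : Fin r → ℂ, iotaLeaf F H π φ p (∑ α, c α • e α p) = ∑ α, c α • R α :=
    fun c => (IsIota.sum _ fun α => (hR α).smul (c α)).iotaLeaf_eq hH hπ hφ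
  have hmem : ∀ α, e α p ∈ freeman H 2 p := fun α => (he.frame.isLocalSection α).mem
  have h1 : Submodule.span ℂ {Z | ∃ v ∈ freeman H 2 p, iotaLeaf F H π φ p v = Z} =
      Submodule.span ℂ (Set.range R) := by
    refine le_antisymm (Submodule.span_le.2 ?_) (Submodule.span_le.2 ?_)
    · rintro _ ⟨v, hv, rfl⟩
      obtain ⟨c, rfl⟩ := he.exists_combination hv
      rw [hsum]
      exact Submodule.sum_mem _ fun α _ => Submodule.smul_mem _ _
        (Submodule.subset_span (Set.mem_range_self α))
    · rintro _ ⟨α, rfl⟩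
      exact Submodule.subset_span ⟨e α p, hmem α, (hR α).iotaLeaf_eq hH hπ hφ⟩
  have h2 : Submodule.span ℂ {Z | ∃ v ∈ freeman H 2 p,
      sigma (leviMatrix H φ p) (iotaLeaf F H π φ p v) = Z} =
      Submodule.span ℂ (Set.range fun α => sigma (leviMatrix H φ p) (R α)) := by
    refine le_antisymm (Submodule.span_le.2 ?_) (Submodule.span_le.2 ?_)
    · rintro _ ⟨v, hv, rfl⟩
      obtain ⟨c, rfl⟩ := he.exists_combination hv
      rw [hsum, sigma_sum]
      refine Submodule.sum_mem _ fun α _ => ?_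
      rw [sigma_smul]
      exact Submodule.smul_mem _ _ (Submodule.subset_span (Set.mem_range_self α))
    · rintro _ ⟨α, rfl⟩
      exact Submodule.subset_span ⟨e α p, hmem α, by rw [(hR α).iotaLeaf_eq hH hπ hφ]⟩
  rw [modifiedSymbol, h1, h2]

/-- The modified symbol along a section `φ'` obtained from `φ` by a gauge transformation trivial at
`p` is given by matrices, provided these determine `ι_φ'` modulo `𝔤_{0,0}`. -/
theorem IsGauge.modifiedSymbol_eq_symbolOfMatrices (h : IsGauge H φ φ' p U u)
    (hH : IsCRHypersurface n H) (hπ : IsLeafSpace F H π) (hφ : IsSectionNear H p φ)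
    (hφ' : IsSectionNear H p φ') (he : IsKernelFrameNear H p e) {R : Fin r → End1 s}
    (hR : ∀ α, IsIota F H π φ' p (e α p) (R α)) {L : Fin r → Matrix (Fin s) (Fin s) ℂ}
    (hL : ∀ α, R α - modElt (leviMatrix H φ p) (xiMatrix H φ (e α) p) (L α) ∈ g00 H φ p) :
    modifiedSymbol F H π φ' p = symbolOfMatrices (leviMatrix H φ p)
      (fun α => xiMatrix H φ (e α) p) L := by
  rw [modifiedSymbol_eq hH hπ hφ' he hR, h.leviMatrix_eq hH hφ hφ', h.g00_eq hH hπ hφ hφ' he,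
    span_sup_span_sigma_eq (fun W hW => hH.sigma_mem_g00 hφ he hW) hL, symbolOfMatrices]
  congr 2
  exact hH.g00_eq hφ he

theorem isGauge_refl : IsGauge H φ φ p (fun _ => 1) (fun _ => 1) where
  smooth_mat i j := smoothNear_const _
  smooth_fun := smoothNear_const _
  mat_eq := rfl
  fun_eq := rfl
  g := Eventually.of_forall fun y => by simp
  f := Eventually.of_forall fun y j => by simp [Matrix.one_apply]

end Symbols

/-! ### Solving the normalization equations -/

section Normalization

variable {E : Type*} [NormedAddCommGroup E] [NormedSpace ℝ E] [FiniteDimensional ℝ E]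
  {M : Type*} [TopologicalSpace M] [ChartedSpace E M] [IsManifold 𝓘(ℝ, E) ∞ M]
  {F : Type*} [NormedAddCommGroup F] [NormedSpace ℝ F]
  {N : Type*} [TopologicalSpace N] [ChartedSpace F N] [IsManifold 𝓘(ℝ, F) ∞ N]
  {p : M} {n s r : ℕ} {H : Distribution E M} {φ φ' : GradedFrame E M s}
  {e : Fin r → CField E M} {π : M → N} {X : CField E M}
  {U : M → Matrix (Fin s) (Fin s) ℂ} {u : M → ℂ} {Nm : DownMap H φ p} {Np : UpMap H φ p}
  {B B' : Fin r → (csp00 s ⧸ (g00 H φ p).submoduleOf (csp00 s))}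

theorem sub_lie_end (Y Z W : End1 s) : ⁅Y - Z, W⁆ = ⁅Y, W⁆ - ⁅Z, W⁆ := by
  simp only [Ring.lie_def]
  noncomm_ring

theorem lie_add_end (Y Z W : End1 s) : ⁅Y, Z + W⁆ = ⁅Y, Z⁆ + ⁅Y, W⁆ := by
  simp only [Ring.lie_def]
  noncomm_ring

theorem lie_mem_span {x : Fin r → End1 s} {Z W : End1 s} {P : Submodule ℂ (End1 s)}
    (h : ∀ i, ⁅Z, x i⁆ ∈ P) (hW : W ∈ Submodule.span ℂ (Set.range x)) : ⁅Z, W⁆ ∈ P := by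
  induction hW using Submodule.span_induction with
  | mem y hy =>
    obtain ⟨i, rfl⟩ := hy
    exact h i
  | zero => rw [Ring.lie_def, mul_zero, zero_mul, sub_zero]; exact P.zero_mem
  | add y z _ _ hy hz => rw [lie_add_end]; exact P.add_mem hy hz
  | smul c y _ hy =>
    have h1 : ⁅Z, c • y⁆ = c • ⁅Z, y⁆ := by
      simp only [Ring.lie_def, mul_smul_comm, smul_mul_assoc, smul_sub]
    rw [h1]
    exact P.smul_mem _ hy

/-- The gauge transformation to a normalized section solves the normalization equations. -/
theorem IsNormalized.normalizationEquations (h : IsNormalized H φ p Nm Np φ')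
    (hU : IsGauge H φ φ' p U u) (hH : IsCRHypersurface n H) (hπ : IsLeafSpace F H π)
    (hφ : IsSectionNear H p φ) (he : IsKernelFrameNear H p e) :
    NormalizationEquations H φ p Nm Np e
      fun α => Submodule.Quotient.mk ⟨gaugeElt p (e α p) U u, gaugeElt_mem _ _ _ _⟩ := by
  intro b hb α β hα hβ
  have hmem := (hb α).sub_mem (isClassOf_mk (gaugeElt_mem p (e α p) U u))
  -- Another representative `b α` differs from `gaugeElt` by an element of `𝔤_{0,0}`, whose bracket
  -- with `S^{0,±2}_β` stays in `𝔤_{0,±2}`.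
  have key : ∀ D D' S : End1 s, D' = D - ⁅gaugeElt p (e α p) U u, S⁆ →
      D' - (D - ⁅b α, S⁆) = ⁅b α - gaugeElt p (e α p) U u, S⁆ := by
    rintro D _ S rfl
    rw [sub_lie_end]
    abel
  constructor
  · refine (h.down ⟨e α p, hα⟩ (e β) hβ).congr (hH.g0m2_le hφ he) ?_
    rw [key _ _ _ (hU.deriv_down hH hπ hφ h.isSection he hβ (e α p))]
    exact hmem.2.2 _ (downAt H φ p (e β) hβ).2
  · refine (h.up ⟨e α p, hα⟩ (e β) hβ).congr (hH.g02_le hφ he) ?_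
    rw [key _ _ _ (hU.deriv_up hH hπ hφ h.isSection he hβ (e α p))]
    exact hmem.2.1 _ (upAt H φ p (e β) hβ).2

/-- Subtracting the equations, `B' α - B α` brackets every `S^{0,±2}_β` into `𝔤_{0,±2}`. Over a
frame of `K₂` this is the defining condition of `𝔤_{0,0}`. -/
theorem NormalizationEquations.unique (h : NormalizationEquations H φ p Nm Np e B)
    (h' : NormalizationEquations H φ p Nm Np e B') (hH : IsCRHypersurface n H)
    (hφ : IsSectionNear H p φ) (he : IsKernelFrameNear H p e) : B' = B := by
  choose b hb using fun α => exists_isClassOf (B α)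
  choose b' hb' using fun α => exists_isClassOf (B' α)
  funext α
  refine (hb' α).eq_of_sub_mem (hb α) ?_
  have hα : e α p ∈ freeman H 2 p := (he.frame.isLocalSection α).mem
  have key : ∀ D S : End1 s, D - ⁅b α, S⁆ - (D - ⁅b' α, S⁆) = ⁅b' α - b α, S⁆ := by
    intro D S
    rw [sub_lie_end]
    abel
  have h1 : ∀ β, ⁅b' α - b α, upField H φ (e β) p⁆ ∈ g02 H φ p ∧
      ⁅b' α - b α, downField H φ (e β) p⁆ ∈ g0m2 H φ p := by
    intro β
    have hβ := he.frame.isLocalSection β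
    have h₁ := h b hb α β hα hβ
    have h₂ := h' b' hb' α β hα hβ
    have hd := h₁.1.sub_mem h₂.1
    have hu := h₁.2.sub_mem h₂.2
    rw [key] at hd hu
    exact ⟨hu, hd⟩
  refine ⟨sub_mem (hb' α).mem (hb α).mem, fun W hW => ?_, fun W hW => ?_⟩
  · rw [hH.g02_eq hφ he] at hW
    exact lie_mem_span (fun β => (h1 β).1) hW
  · rw [hH.g0m2_eq hφ he] at hW
    exact lie_mem_span (fun β => (h1 β).2) hW

/-- The term `c • 1` undoes the scalar part of `diagElt c L`, which `modElt` does not contain. -/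
theorem modElt_add (A Ξ Ω L : Matrix (Fin s) (Fin s) ℂ) (c : ℂ) :
    modElt A Ξ (Ω + L) = modElt A Ξ Ω + diagElt c L + c • 1 := by
  rw [modElt, modElt, diagElt, ← Matrix.fromBlocks_one, Matrix.fromBlocks_smul,
    Matrix.fromBlocks_add, Matrix.fromBlocks_add]
  congr 1
  · abel
  · simp
  · simp
  · rw [Matrix.transpose_add]
    abel

/-- The modified symbol along a normalized section. -/
theorem IsNormalized.modifiedSymbol_eq (h : IsNormalized H φ p Nm Np φ')
    (hH : IsCRHypersurface n H) (hπ : IsLeafSpace F H π) (hφ : IsSectionNear H p φ)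
    (he : IsKernelFrameNear H p e) (hB : NormalizationEquations H φ p Nm Np e B)
    {c : Fin r → ℂ} {L : Fin r → Matrix (Fin s) (Fin s) ℂ}
    (hL : ∀ α, IsClassOf (B α) (diagElt (c α) (L α))) :
    (∀ α, iotaLeaf F H π φ' p (e α p) - modElt (leviMatrix H φ p) (xiMatrix H φ (e α) p)
      (omegaMatrix F H π φ p (e α p) + L α) ∈ g00 H φ p) ∧
    modifiedSymbol F H π φ' p = symbolOfMatrices (leviMatrix H φ p)
      (fun α => xiMatrix H φ (e α) p) (fun α => omegaMatrix F H π φ p (e α p) + L α) := by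
  obtain ⟨U, u, hU⟩ := hH.exists_gauge hφ h.isSection he h.sameValue
  have h1 := hB.unique (h.normalizationEquations hU hH hπ hφ he) hH hφ he
  choose d hd using fun α => hπ.isIota_kernel hH hφ he (he.frame.isLocalSection α)
  have hR := fun α => hU.isIota hH hπ hφ h.isSection (hd α)
  have hmem : ∀ α, modElt (leviMatrix H φ p) (xiMatrix H φ (e α) p)
      (omegaMatrix F H π φ p (e α p)) + d α • 1 + gaugeElt p (e α p) U u -
      modElt (leviMatrix H φ p) (xiMatrix H φ (e α) p)
        (omegaMatrix F H π φ p (e α p) + L α) ∈ g00 H φ p := by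
    intro α
    have h2 := (isClassOf_mk (gaugeElt_mem p (e α p) U u)).sub_mem
      ((congrFun h1 α).symm ▸ hL α)
    -- The scalar parts `d α` of `ι` and `c α` of the representative are discarded together, since
    -- the identity lies in `𝔤_{0,0}`.
    have h3 := (g00 H φ p).smul_mem (d α - c α) (one_mem_stabilizer (g02 H φ p) (g0m2 H φ p))
    have h4 := add_mem h2 h3
    convert h4 using 1
    rw [modElt_add _ _ _ _ (c α), sub_smul]
    abel
  refine ⟨fun α => ?_, hU.modifiedSymbol_eq_symbolOfMatrices hH hπ hφ h.isSection he hR hmem⟩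
  rw [(hR α).iotaLeaf_eq hH hπ h.isSection]
  exact hmem α

end Normalization

/-! ### Sections along which the involution is constant to first order -/

section Conjugation

variable {E : Type*} [NormedAddCommGroup E] [NormedSpace ℝ E] [FiniteDimensional ℝ E]
  {M : Type*} [TopologicalSpace M] [ChartedSpace E M] [IsManifold 𝓘(ℝ, E) ∞ M]
  {F : Type*} [NormedAddCommGroup F] [NormedSpace ℝ F]
  {N : Type*} [TopologicalSpace N] [ChartedSpace F N] [IsManifold 𝓘(ℝ, F) ∞ N]
  {p : M} {n s r : ℕ} {H : Distribution E M} {φ : GradedFrame E M s}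
  {e : Fin r → CField E M} {π : M → N}

theorem IsCRHypersurface.conj_degOneFrame (hH : IsCRHypersurface n H) (hφ : IsSectionNear H p φ)
    (k : Fin s ⊕ Fin s) : conj (degOneFrame H φ k p) =
      ∑ l, conjMatrix (leviMatrix H φ p) l k • degOneFrame H φ l p := by
  rcases k with k | k
  · rw [Fintype.sum_sum_type]
    simp [conjMatrix, degOneFrame, hH.conj_f_eq hφ]
  · rw [Fintype.sum_sum_type]
    have h1 : (leviMatrix H φ p).map (starRingEnd ℂ) *
        ((leviMatrix H φ p)⁻¹).map (starRingEnd ℂ) = 1 := by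
      rw [← map_star_mul, Matrix.mul_nonsing_inv _ (hH.isUnit_leviMatrix hφ), map_star_one]
    simp [conjMatrix, degOneFrame, hField, conj_smul, CRSymbol.conj_conj,
      Matrix.inv_eq_right_inv h1]

theorem IsCRHypersurface.smooth_conjMatrix (hH : IsCRHypersurface n H)
    (hφ : IsSectionNear H p φ) :
    SmoothMatrixNear E (fun y => conjMatrix (leviMatrix H φ y)) p := by
  have hA : SmoothMatrixNear E (leviMatrix H φ) p := hH.smooth_leviMatrix hφ
  have hu : IsUnit ((leviMatrix H φ p).map (starRingEnd ℂ)).det := by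
    rw [← RingHom.mapMatrix_apply, ← RingHom.map_det]
    exact (hH.isUnit_leviMatrix hφ).map _
  rintro (i | i) (j | j)
  · exact smoothNear_const 0
  · exact SmoothNear.matrix_inv hA.map_star hu i j
  · exact hA i j
  · exact smoothNear_const 0

/-- Differentiating `conj(A)` along `v` means differentiating `A` along `conj v`, which is again a
leaf direction; the inverse is then handled by the product rule. -/
theorem IsInvolutionConstAt.derivMatrix_conjMatrix (h : IsInvolutionConstAt H φ p)
    (hH : IsCRHypersurface n H) (hφ : IsSectionNear H p φ) {v : CTangent E p}
    (hv : v ∈ leafDist H p) : derivMatrix p v (fun y => conjMatrix (leviMatrix H φ y)) = 0 := by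
  have hA : SmoothMatrixNear E (leviMatrix H φ) p := hH.smooth_leviMatrix hφ
  have hC := hH.smooth_conjMatrix hφ
  have hB : SmoothMatrixNear E (fun y => ((leviMatrix H φ y).map (starRingEnd ℂ))⁻¹) p :=
    fun i j => hC (Sum.inl i) (Sum.inr j)
  have hu : ∀ y, IsSectionNear H y φ → IsUnit ((leviMatrix H φ y).map (starRingEnd ℂ)).det := by
    intro y hy
    rw [← RingHom.mapMatrix_apply, ← RingHom.map_det]
    exact (hH.isUnit_leviMatrix hy).map _
  have h1 : derivMatrix p v (fun y => ((leviMatrix H φ y).map (starRingEnd ℂ))⁻¹ *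
      (leviMatrix H φ y).map (starRingEnd ℂ)) = 0 := by
    rw [derivMatrix_congr (Z := fun _ => 1) v]
    · ext i j
      exact deriv_const v _
    · filter_upwards [hφ.eventually] with y hy using Matrix.nonsing_inv_mul _ (hu y hy)
  have h0 : (0 : Matrix (Fin s) (Fin s) ℂ).map (starRingEnd ℂ) = 0 := by ext; simp
  rw [derivMatrix_mul v hB hA.map_star, derivMatrix_map_star v hA,
    h _ (conj_mem_leafDist hv), h0, mul_zero, add_zero] at h1
  have h2 : derivMatrix p v (fun y => ((leviMatrix H φ y).map (starRingEnd ℂ))⁻¹) = 0 := by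
    rw [← Matrix.mul_nonsing_inv_cancel_right _ (derivMatrix p v _) (hu p hφ), h1, zero_mul]
  ext (i | i) (j | j)
  · exact deriv_const v 0
  · exact congrFun (congrFun h2 i) j
  · exact congrFun (congrFun (h v hv) i) j
  · exact deriv_const v 0

/-- If the involution is constant to first order, `ι` commutes with complex conjugation. -/
theorem IsInvolutionConstAt.isIota_conj (h : IsInvolutionConstAt H φ p)
    (hH : IsCRHypersurface n H) (hπ : IsLeafSpace F H π) (hφ : IsSectionNear H p φ)
    {v : CTangent E p} (hv : v ∈ leafDist H p) {R : End1 s} (hR : IsIota F H π φ p v R) :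
    IsIota F H π φ p (conj v) (sigma (leviMatrix H φ p) R) := by
  intro k ℓ
  set C := fun y => conjMatrix (leviMatrix H φ y) with hC
  set D := fun k y => deriv y (degOneFrame H φ k y) (leafFun F π p ℓ) with hD
  have hCs : SmoothMatrixNear E C p := hH.smooth_conjMatrix hφ
  have hDs : ∀ k, SmoothNear E (D k) p :=
    fun k => (hπ.smooth_leafFun p ℓ).deriv (hH.degOne_section hφ k).smooth
  have hreal : ∀ y, (starRingEnd ℂ) (leafFun F π p ℓ y) = leafFun F π p ℓ y :=
    fun y => Complex.conj_ofReal _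
  -- The leaf functions are real, so conjugating the derivative along `F_k` gives the derivative
  -- along `conj F_k = ∑ C_{lk} F_l`.
  have hstar : ∀ᶠ y in 𝓝 p, ∀ k, (starRingEnd ℂ) (D k y) = ∑ l, C y l k * D l y := by
    filter_upwards [hφ.eventually, (hπ.smooth_leafFun p ℓ).eventually] with y h₁ h₂ k
    rw [hD]
    simp only
    rw [← deriv_star_of_real _ h₂ hreal, hH.conj_degOneFrame h₁, deriv_sum_vec]
    simp only [deriv_smul_vec, hC]
  have hdC : ∀ l k, deriv p v (fun y => C y l k) = 0 := fun l k =>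
    congrFun (congrFun (h.derivMatrix_conjMatrix hH hφ hv) l) k
  have hsum : SmoothNear E (fun y => ∑ l, C y l k * D l y) p :=
    .sum fun l _ => (hCs l k).mul (hDs l)
  -- The derivative of `C` along `v` is zero, so only the derivatives of the frame remain.
  -- Conjugating once more assembles `C conj(R) conj(C)`.
  have h1 : deriv p (conj v) (D k) =
      (starRingEnd ℂ) (∑ l, C p l k * ∑ m, R m l * D m p) := by
    rw [deriv_congr (v := fun y => (starRingEnd ℂ) (∑ l, C y l k * D l y)),
      deriv_star _ hsum, CRSymbol.conj_conj, deriv_sum v fun l _ => (hCs l k).mul (hDs l)]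
    · congr 1
      refine Finset.sum_congr rfl fun l _ => ?_
      rw [deriv_mul v (hCs l k) (hDs l), hdC, mul_zero, add_zero]
      exact congrArg _ (hR l ℓ)
    · filter_upwards [hstar] with y hy
      rw [← hy, starRingEnd_self_apply]
  change deriv p (conj v) (D k) = ∑ l, sigma (leviMatrix H φ p) R l k * D l p
  rw [h1]
  simp only [map_sum, map_mul, hstar.self_of_nhds, sigma, Matrix.mul_apply, Matrix.map_apply,
    Finset.sum_mul, Finset.mul_sum]
  conv_rhs => rw [Finset.sum_comm]
  refine Finset.sum_congr rfl fun l _ => ?_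
  conv_rhs => rw [Finset.sum_comm]
  refine Finset.sum_congr rfl fun m _ => Finset.sum_congr rfl fun j _ => ?_
  ring

/-- Here `ι(conj v) = σ(ι(v))`, so `ι(conj K₂)` is `𝔤_{0,-}`. -/
theorem leafSymbol_eq (h : IsInvolutionConstAt H φ p) (hH : IsCRHypersurface n H)
    (hπ : IsLeafSpace F H π) (hφ : IsSectionNear H p φ) (he : IsKernelFrameNear H p e) :
    leafSymbol F H π φ p = modifiedSymbol F H π φ p := by
  have hex : ∀ v ∈ freeman H 2 p, ∃ R, IsIota F H π φ p v R := by
    intro v hv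
    obtain ⟨c, rfl⟩ := he.exists_combination hv
    choose d hd using fun α => hπ.isIota_kernel hH hφ he (he.frame.isLocalSection α)
    exact ⟨_, IsIota.sum _ fun α => (hd α).smul (c α)⟩
  have hK : ∀ v ∈ freeman H 2 p, v ∈ leafDist H p := fun v hv => Submodule.mem_sup_left hv
  have hconj : ∀ v ∈ freeman H 2 p, iotaLeaf F H π φ p (conj v) =
      sigma (leviMatrix H φ p) (iotaLeaf F H π φ p v) := by
    intro v hv
    obtain ⟨R, hR⟩ := hex v hv
    rw [hR.iotaLeaf_eq hH hπ hφ, (h.isIota_conj hH hπ hφ (hK v hv) hR).iotaLeaf_eq hH hπ hφ]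
  rw [leafSymbol, modifiedSymbol]
  congr 2
  refine le_antisymm (Submodule.span_le.2 ?_) (sup_le (Submodule.span_le.2 ?_)
    (Submodule.span_le.2 ?_))
  · rintro _ ⟨v, hv, rfl⟩
    obtain ⟨a, ha, b, hb, rfl⟩ := Submodule.mem_sup.1 hv
    have hb' : conj b ∈ freeman H 2 p := hb
    obtain ⟨R, hR⟩ := hex a ha
    obtain ⟨R', hR'⟩ := hex _ hb'
    have h1 := h.isIota_conj hH hπ hφ (hK _ hb') hR'
    rw [CRSymbol.conj_conj] at h1
    rw [(hR.add h1).iotaLeaf_eq hH hπ hφ]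
    refine add_mem (Submodule.mem_sup_left (Submodule.subset_span
      ⟨a, ha, hR.iotaLeaf_eq hH hπ hφ⟩)) (Submodule.mem_sup_right (Submodule.subset_span
      ⟨conj b, hb', ?_⟩))
    rw [hR'.iotaLeaf_eq hH hπ hφ]
  · rintro _ ⟨v, hv, rfl⟩
    exact Submodule.subset_span ⟨v, hK v hv, rfl⟩
  · rintro _ ⟨v, hv, rfl⟩
    exact Submodule.subset_span ⟨conj v, conj_mem_leafDist (hK v hv), hconj v hv⟩

end Conjugation

/-! ### Normalized sections with first-order constant involution -/

section Existence

variable {E : Type*} [NormedAddCommGroup E] [NormedSpace ℝ E] [FiniteDimensional ℝ E]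
  {M : Type*} [TopologicalSpace M] [ChartedSpace E M] [IsManifold 𝓘(ℝ, E) ∞ M]
  {F : Type*} [NormedAddCommGroup F] [NormedSpace ℝ F]
  {N : Type*} [TopologicalSpace N] [ChartedSpace F N] [IsManifold 𝓘(ℝ, F) ∞ N]
  {p x : M} {n s r : ℕ} {H : Distribution E M} {φ φ' φ'' : GradedFrame E M s}
  {e : Fin r → CField E M} {π : M → N}
  {U : M → Matrix (Fin s) (Fin s) ℂ} {u : M → ℂ} {Nm : DownMap H φ p} {Np : UpMap H φ p}

/-- The frame obtained from `φ` by the action of `(u, U)`. -/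
def gaugeFrame (φ : GradedFrame E M s) (U : M → Matrix (Fin s) (Fin s) ℂ) (u : M → ℂ) :
    GradedFrame E M s where
  g y := u y • φ.g y
  f j y := ∑ l, U y l j • φ.f l y

theorem IsGradedFrameAt.gaugeFrame (h : IsGradedFrameAt H φ x) (hu : u x ≠ 0)
    (hU : IsUnit (U x).det) : IsGradedFrameAt H (gaugeFrame φ U u) x where
  g_notMem hg := by
    have h1 := Submodule.smul_mem _ (u x)⁻¹ hg
    simp only [CRSymbol.gaugeFrame, smul_smul, inv_mul_cancel₀ hu, one_smul] at h1
    exact h.g_notMem h1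
  g_span := by
    rw [← h.g_span]
    congr 1
    exact Submodule.span_singleton_smul_eq (IsUnit.mk0 _ hu) _
  f_indep := by
    rw [Fintype.linearIndependent_iff]
    intro c hc
    have h1 : ∑ l, (U x *ᵥ c) l • (freeman H 2 x).mkQ (φ.f l x) = 0 := by
      rw [← hc]
      simp only [CRSymbol.gaugeFrame, map_sum, map_smul, Matrix.mulVec, dotProduct, Finset.sum_smul,
        Finset.smul_sum, smul_smul]
      rw [Finset.sum_comm]
      simp only [mul_comm]
    have h2 := Fintype.linearIndependent_iff.1 h.f_indep _ h1
    have h3 : c = 0 := Matrix.eq_zero_of_mulVec_eq_zero hU.ne_zero (funext h2)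
    exact fun i => congrFun h3 i
  f_span := by
    rw [← h.f_span]
    congr 1
    refine le_antisymm (Submodule.span_le.2 ?_) (Submodule.span_le.2 ?_)
    · rintro _ ⟨j, rfl⟩
      change ∑ l, U x l j • φ.f l x ∈ Submodule.span ℂ (Set.range fun j => φ.f j x)
      exact Submodule.sum_mem _ fun l _ => Submodule.smul_mem _ _
        (Submodule.subset_span (Set.mem_range_self l))
    · rintro _ ⟨l, rfl⟩
      have h1 : φ.f l x = ∑ j, (U x)⁻¹ j l • (CRSymbol.gaugeFrame φ U u).f j x := by
        simp only [CRSymbol.gaugeFrame, Finset.smul_sum, smul_smul]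
        rw [Finset.sum_comm]
        simp only [← Finset.sum_smul]
        have h2 : ∀ m, ∑ j, (U x)⁻¹ j l * U x m j = (1 : Matrix _ _ ℂ) m l := by
          intro m
          rw [← Matrix.mul_nonsing_inv _ hU, Matrix.mul_apply]
          simp only [mul_comm]
        simp only [h2, Matrix.one_apply, ite_smul, one_smul, zero_smul, Finset.sum_ite_eq',
          Finset.mem_univ, if_true]
      simp only
      rw [h1]
      exact Submodule.sum_mem _ fun j _ => Submodule.smul_mem _ _
        (Submodule.subset_span (Set.mem_range_self j))

theorem IsSectionNear.gaugeFrame (h : IsSectionNear H p φ) (hU : SmoothMatrixNear E U p)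
    (hu : SmoothNear E u p) (hU1 : U p = 1) (hu1 : u p = 1) :
    IsSectionNear H p (gaugeFrame φ U u) := by
  have hg : SmoothFieldNear (CRSymbol.gaugeFrame φ U u).g p := .smul hu h.smooth_g
  have hf : ∀ j, SmoothFieldNear ((CRSymbol.gaugeFrame φ U u).f j) p :=
    fun j => .sum (t := Finset.univ) (X := fun l y => U y l j • φ.f l y)
      fun l _ => .smul (hU l j) (h.isLocalSection l).smooth
  have hu0 : ∀ᶠ y in 𝓝 p, u y ≠ 0 :=
    hu.self_of_nhds.continuousAt.eventually_ne (by rw [hu1]; exact one_ne_zero)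
  have hU0 : ∀ᶠ y in 𝓝 p, (U y).det ≠ 0 :=
    (SmoothNear.det hU).self_of_nhds.continuousAt.eventually_ne
      (by rw [hU1, Matrix.det_one]; exact one_ne_zero)
  filter_upwards [h, hg, eventually_all.2 hf, hu0, hU0] with y h₁ h₂ h₃ h₄ h₅
  exact ⟨h₂, h₃, h₁.2.2.gaugeFrame h₄ (isUnit_iff_ne_zero.2 h₅)⟩

theorem isGauge_gaugeFrame (hU : SmoothMatrixNear E U p) (hu : SmoothNear E u p) (hU1 : U p = 1)
    (hu1 : u p = 1) : IsGauge H φ (gaugeFrame φ U u) p U u where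
  smooth_mat := hU
  smooth_fun := hu
  mat_eq := hU1
  fun_eq := hu1
  g := Eventually.of_forall fun y => by simp [gaugeFrame]
  f := Eventually.of_forall fun y j => by simp [gaugeFrame]

/-- Normalization tests derivatives along `K₂` only, and these are unchanged when `gaugeElt`
vanishes there. -/
theorem IsNormalized.of_isGauge (h : IsNormalized H φ p Nm Np φ') (hU : IsGauge H φ' φ'' p U u)
    (hφ'' : IsSectionNear H p φ'') (hH : IsCRHypersurface n H) (hπ : IsLeafSpace F H π)
    (he : IsKernelFrameNear H p e)
    (h0 : ∀ v ∈ freeman H 2 p, derivMatrix p v U = 0 ∧ deriv p v u = 0) :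
    IsNormalized H φ p Nm Np φ'' := by
  have h1 : ∀ v ∈ freeman H 2 p, gaugeElt p v U u = 0 := by
    intro v hv
    rw [gaugeElt_eq, (h0 v hv).1, (h0 v hv).2, zero_smul, Matrix.transpose_zero, sub_zero,
      Matrix.fromBlocks_zero]
  have h2 : ∀ Z : End1 s, ⁅(0 : End1 s), Z⁆ = 0 := fun Z => by simp [Ring.lie_def]
  refine ⟨hφ'', ⟨?_, fun j => ?_⟩, fun X Y hY => ?_, fun X Y hY => ?_⟩
  · have := add_mem hU.sameValue.1 h.sameValue.1
    rwa [sub_add_sub_cancel] at this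
  · have := add_mem (hU.sameValue.2 j) (h.sameValue.2 j)
    rwa [sub_add_sub_cancel] at this
  · rw [hU.deriv_down hH hπ h.isSection hφ'' he hY, h1 _ X.2, h2, sub_zero]
    exact h.down X Y hY
  · rw [hU.deriv_up hH hπ h.isSection hφ'' he hY, h1 _ X.2, h2, sub_zero]
    exact h.up X Y hY

/-- It allows derivatives along `conj K₂` to be prescribed while those along `K₂` vanish; the two
spaces are independent because `H ∩ conj H = 0`. -/
theorem IsCRHypersurface.exists_projection (hH : IsCRHypersurface n H) (p : M) :
    ∃ T : CTangent E p →ₗ[ℂ] CTangent E p, (∀ v ∈ freeman H 2 p, T v = 0) ∧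
      ∀ v ∈ conjSub (freeman H 2 p), T v = v := by
  have hd : Disjoint (freeman H 2 p) (conjSub (freeman H 2 p)) :=
    (disjoint_iff.2 (hH.disjoint p)).mono (freeman_two_le H p)
      (conjSub_mono (freeman_two_le H p))
  obtain ⟨C, hC, hc⟩ := hd.exists_isCompl
  refine ⟨(conjSub (freeman H 2 p)).projection C hc.symm, fun v hv => ?_, fun v hv => ?_⟩
  · exact (Submodule.projection_apply_eq_zero_iff hc.symm).2 (hC hv)
  · exact Submodule.projection_apply_left hc.symm ⟨v, hv⟩

/-- A gauge transformation which is constant to first order along `K₂` makes the involution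
constant to first order along the leaf. -/
theorem IsCRHypersurface.exists_gauge_involutionConst (hH : IsCRHypersurface n H)
    (hφ : IsSectionNear H p φ) :
    ∃ φ' U u, IsSectionNear H p φ' ∧ IsGauge H φ φ' p U u ∧
      (∀ v ∈ freeman H 2 p, derivMatrix p v U = 0 ∧ deriv p v u = 0) ∧
      IsInvolutionConstAt H φ' p := by
  obtain ⟨T, hT0, hT1⟩ := hH.exists_projection p
  obtain ⟨a, ha, ha0, haA⟩ := hH.exists_leviMatrix_eq_smul hφ
  have hA : SmoothMatrixNear E (leviMatrix H φ) p := hH.smooth_leviMatrix hφ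
  have hAu := hH.isUnit_leviMatrix hφ
  -- `du = a⁻¹ da` on `conj K₂` is chosen to absorb the derivative of the factor in `A = a Aᴴ`.
  obtain ⟨u, hu, hu1, hdu⟩ := exists_smoothNear_deriv_eq ((a p)⁻¹ • (derivHom p a ∘ₗ T)) 1
  -- On `conj K₂` the differential of `U` is `-conj(A)⁻¹ d(conj A)`. In the derivative of the new
  -- `A` along `v` in `K₂`, its conjugate gives `-A⁻¹ v(A)`, which cancels `v(A)`.
  have hex := fun l j => exists_smoothNear_deriv_eq
    (-∑ m, (starRingEnd ℂ) ((leviMatrix H φ p)⁻¹ l m) •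
      (derivHom p (fun y => (starRingEnd ℂ) (leviMatrix H φ y m j)) ∘ₗ T))
    ((1 : Matrix (Fin s) (Fin s) ℂ) l j)
  choose W hW hW1 hdW using hex
  let U : M → Matrix (Fin s) (Fin s) ℂ := fun y => Matrix.of fun l j => W l j y
  have hU : SmoothMatrixNear E U p := fun l j => hW l j
  have hU1 : U p = 1 := by
    ext l j
    exact hW1 l j
  have hdU : ∀ w, derivMatrix p w U =
      -((leviMatrix H φ p)⁻¹ * derivMatrix p (conj (T w)) (leviMatrix H φ)).map (starRingEnd ℂ) := by
    intro w
    ext l j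
    simp only [Matrix.neg_apply, Matrix.map_apply, Matrix.mul_apply, map_sum, map_mul]
    refine (hdW l j w).trans ?_
    simp only [LinearMap.neg_apply, LinearMap.sum_apply, LinearMap.smul_apply,
      LinearMap.comp_apply, smul_eq_mul, derivHom_apply, deriv_star _ (hA _ _)]
    rfl
  have h0 : ∀ v ∈ freeman H 2 p, derivMatrix p v U = 0 ∧ deriv p v u = 0 := by
    intro v hv
    constructor
    · rw [hdU, hT0 v hv, map_zero]
      have h1 : derivMatrix p (0 : CTangent E p) (leviMatrix H φ) = 0 := by
        ext i j
        exact deriv_zero_vec _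
      rw [h1, mul_zero]
      ext
      simp
    · rw [hdu]
      simp [hT0 v hv]
  have hφ' : IsSectionNear H p (gaugeFrame φ U u) := hφ.gaugeFrame hU hu hU1 hu1
  have hg : IsGauge H φ (gaugeFrame φ U u) p U u := isGauge_gaugeFrame hU hu hU1 hu1
  refine ⟨_, U, u, hφ', hg, h0, ?_⟩
  have hA' : SmoothMatrixNear E (leviMatrix H (gaugeFrame φ U u)) p := hH.smooth_leviMatrix hφ'
  have hK : ∀ v ∈ freeman H 2 p, derivMatrix p v (leviMatrix H (gaugeFrame φ U u)) = 0 := by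
    intro v hv
    have h1 := hg.deriv_levi hH hφ hφ' v
    have h2 : conj v ∈ conjSub (freeman H 2 p) := conj_mem_conjSub hv
    rw [(h0 v hv).1, (h0 v hv).2, hdU, hT1 _ h2, CRSymbol.conj_conj] at h1
    have h3 : (-((leviMatrix H φ p)⁻¹ * derivMatrix p v (leviMatrix H φ)).map
        (starRingEnd ℂ)).map (starRingEnd ℂ) =
        -((leviMatrix H φ p)⁻¹ * derivMatrix p v (leviMatrix H φ)) := by
      ext i j
      simp only [Matrix.map_apply, Matrix.neg_apply, map_neg, Complex.conj_conj]
    rw [h3, mul_neg, Matrix.mul_nonsing_inv_cancel_left _ _ hAu] at h1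
    simpa using h1
  -- Along `conj v` the derivative of `A'` follows from `u A' = a conj(u) A'ᴴ`: those of `A'ᴴ` and
  -- `conj(u)` vanish by the `K₂` case, and the remaining `a⁻¹ da - du` is zero by the choice of
  -- `u`.
  have hK' : ∀ v ∈ freeman H 2 p,
      derivMatrix p (conj v) (leviMatrix H (gaugeFrame φ U u)) = 0 := by
    intro v hv
    have h1 : ∀ᶠ y in 𝓝 p, u y • leviMatrix H (gaugeFrame φ U u) y =
        (a y * (starRingEnd ℂ) (u y)) •
          ((leviMatrix H (gaugeFrame φ U u) y).map (starRingEnd ℂ))ᵀ := by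
      filter_upwards [hg.levi hH hφ hφ', haA] with y h₁ h₂
      have h3 := congrArg Matrix.conjTranspose h₁
      rw [Matrix.conjTranspose_smul, Matrix.conjTranspose_mul, Matrix.conjTranspose_mul] at h3
      have h4 : ((U y).map (starRingEnd ℂ))ᴴ = (U y)ᵀ := by
        ext i j
        simp [Matrix.conjTranspose_apply]
      have h5 : ((U y)ᵀ)ᴴ = (U y).map (starRingEnd ℂ) := by
        ext i j
        simp [Matrix.conjTranspose_apply]
      rw [h4, h5, ← mul_assoc] at h3
      have h6 : ((leviMatrix H (gaugeFrame φ U u) y).map (starRingEnd ℂ))ᵀ =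
        (leviMatrix H (gaugeFrame φ U u) y)ᴴ := rfl
      rw [h₁, h6, mul_smul]
      change _ = a y • (star (u y) • _)
      rw [h3]
      nth_rewrite 1 [h₂]
      rw [Matrix.mul_smul, Matrix.smul_mul]
    have h2 := derivMatrix_congr (conj v) h1
    rw [derivMatrix_smul _ hu hA', derivMatrix_smul _ (ha.mul hu.star) hA'.map_star.transpose,
      derivMatrix_transpose, derivMatrix_map_star _ hA', CRSymbol.conj_conj, hK v hv,
      deriv_mul _ ha hu.star, deriv_star _ hu, CRSymbol.conj_conj, (h0 v hv).2, hu1] at h2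
    have h3 : deriv p (conj v) u = (a p)⁻¹ * deriv p (conj v) a := by
      rw [hdu]
      simp only [LinearMap.smul_apply, LinearMap.comp_apply, smul_eq_mul, derivHom_apply]
      rw [hT1 _ (conj_mem_conjSub hv)]
    have h4 : leviMatrix H (gaugeFrame φ U u) p = a p •
        ((leviMatrix H (gaugeFrame φ U u) p).map (starRingEnd ℂ))ᵀ := by
      have := h1.self_of_nhds
      simpa [hu1] using this
    have h5 : (0 : Matrix (Fin s) (Fin s) ℂ).map (starRingEnd ℂ) = 0 := by ext; simp
    rw [h3, h5] at h2
    nth_rewrite 1 [h4] at h2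
    rw [smul_smul, mul_right_comm, inv_mul_cancel₀ ha0] at h2
    simpa using h2
  intro v hv
  obtain ⟨b, hb, c, hc, rfl⟩ := Submodule.mem_sup.1 hv
  have hc' : conj c ∈ freeman H 2 p := hc
  have h1 := hK' _ hc'
  rw [CRSymbol.conj_conj] at h1
  rw [derivMatrix_add_vec, hK b hb, h1, add_zero]

end Existence

end CRSymbol

end

/-! ### Assembly of the theorem -/

theorem mainTheorem7
    {E : Type*} [NormedAddCommGroup E] [NormedSpace ℝ E] [FiniteDimensional ℝ E]
    {M : Type*} [TopologicalSpace M] [ChartedSpace E M] [IsManifold 𝓘(ℝ, E) ∞ M]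
    {F : Type*} [NormedAddCommGroup F] [NormedSpace ℝ F] [FiniteDimensional ℝ F]
    {N : Type*} [TopologicalSpace N] [ChartedSpace F N] [IsManifold 𝓘(ℝ, F) ∞ N]
    {n k s r : ℕ} (hk : 1 ≤ k)
    (H : CRSymbol.Distribution E M)
    (hH : CRSymbol.IsCRHypersurface n H) (hnd : CRSymbol.IsUniformlyNondegenerate H k)
    (π : M → N) (hπ : CRSymbol.IsLeafSpace F H π)
    (p : M)
    -- a local adapted frame `(g, f, conj f, e, conj e)` around `p`
    (φ : CRSymbol.GradedFrame E M s) (hφ : CRSymbol.IsSectionNear H p φ)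
    (e : Fin r → CRSymbol.CField E M) (he : CRSymbol.IsKernelFrameNear H p e)
    -- a normalization condition at `φ̃(p)`
    (Nm : CRSymbol.DownMap H φ p) (Np : CRSymbol.UpMap H φ p)
    (hN : CRSymbol.IsNormalization H φ p Nm Np) :
    -- the modified symbol along `φ̃` is given by the matrices `(e^{ih}H, Ξ_α, Ω_α)`
    (∀ α, ∃ c : ℂ, CRSymbol.iotaLeaf F H π φ p (e α p) =
      CRSymbol.modElt (CRSymbol.leviMatrix H φ p) (CRSymbol.xiMatrix H φ (e α) p)
        (CRSymbol.omegaMatrix F H π φ p (e α p)) + c • 1) ∧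
    CRSymbol.modifiedSymbol F H π φ p =
      CRSymbol.symbolOfMatrices (CRSymbol.leviMatrix H φ p)
        (fun α => CRSymbol.xiMatrix H φ (e α) p)
        (fun α => CRSymbol.omegaMatrix F H π φ p (e α p)) ∧
    -- there are unique classes `B_α`
    ∃ B : Fin r → (CRSymbol.csp00 s ⧸ (CRSymbol.g00 H φ p).submoduleOf (CRSymbol.csp00 s)),
      CRSymbol.NormalizationEquations H φ p Nm Np e B ∧
      (∀ B', CRSymbol.NormalizationEquations H φ p Nm Np e B' → B' = B) ∧
      -- for every normalized section `φ'` extending `φ̃(p)` and all representatives of the classes,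
      -- the modified symbol along `φ'` is given by `(e^{ih}H, Ξ_α, Ω_α + B_α)`
      (∀ φ' : CRSymbol.GradedFrame E M s, CRSymbol.IsNormalized H φ p Nm Np φ' →
        ∀ (c : Fin r → ℂ) (L : Fin r → Matrix (Fin s) (Fin s) ℂ),
          (∀ α, CRSymbol.IsClassOf (B α) (CRSymbol.diagElt (c α) (L α))) →
          (∀ α, CRSymbol.iotaLeaf F H π φ' p (e α p) -
            CRSymbol.modElt (CRSymbol.leviMatrix H φ p) (CRSymbol.xiMatrix H φ (e α) p)
              (CRSymbol.omegaMatrix F H π φ p (e α p) + L α) ∈ CRSymbol.g00 H φ p) ∧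
          CRSymbol.modifiedSymbol F H π φ' p =
            CRSymbol.symbolOfMatrices (CRSymbol.leviMatrix H φ p)
              (fun α => CRSymbol.xiMatrix H φ (e α) p)
              (fun α => CRSymbol.omegaMatrix F H π φ p (e α p) + L α)) ∧
      -- the modified symbol does not depend on the normalized section extending `φ̃(p)`
      (∀ φ' φ'' : CRSymbol.GradedFrame E M s,
        CRSymbol.IsNormalized H φ p Nm Np φ' → CRSymbol.IsNormalized H φ p Nm Np φ'' →
        CRSymbol.modifiedSymbol F H π φ' p = CRSymbol.modifiedSymbol F H π φ'' p) ∧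
      -- there are normalized sections whose involution is constant to first order along the leaf,
      -- and along all of them the modified symbol is `ℂ𝔤_- ⊕ (ι(K₂ ⊕ conj K₂) + 𝔤_{0,0})`
      (∃ φ' : CRSymbol.GradedFrame E M s, CRSymbol.IsNormalized H φ p Nm Np φ' ∧
        CRSymbol.IsInvolutionConstAt H φ' p) ∧
      (∀ φ' : CRSymbol.GradedFrame E M s, CRSymbol.IsNormalized H φ p Nm Np φ' →
        CRSymbol.IsInvolutionConstAt H φ' p →
        CRSymbol.leafSymbol F H π φ' p = CRSymbol.modifiedSymbol F H π φ' p) := by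
  have hR : ∀ α, ∃ c : ℂ, CRSymbol.IsIota F H π φ p (e α p)
      (CRSymbol.modElt (CRSymbol.leviMatrix H φ p) (CRSymbol.xiMatrix H φ (e α) p)
        (CRSymbol.omegaMatrix F H π φ p (e α p)) + c • 1) :=
    fun α => hπ.isIota_kernel hH hφ he (he.frame.isLocalSection α)
  choose d hd using hR
  have hd0 : ∀ α, CRSymbol.modElt (CRSymbol.leviMatrix H φ p) (CRSymbol.xiMatrix H φ (e α) p)
      (CRSymbol.omegaMatrix F H π φ p (e α p)) + d α • 1 -
      CRSymbol.modElt (CRSymbol.leviMatrix H φ p) (CRSymbol.xiMatrix H φ (e α) p)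
        (CRSymbol.omegaMatrix F H π φ p (e α p)) ∈ CRSymbol.g00 H φ p := fun α => by
    rw [add_sub_cancel_left]
    exact Submodule.smul_mem _ _ (CRSymbol.one_mem_stabilizer _ _)
  -- Any section attaining the normalization condition supplies `B`, through the gauge that leads to
  -- it.
  obtain ⟨φ₀, hφ₀⟩ := hN
  obtain ⟨U, u, hU⟩ := hH.exists_gauge hφ hφ₀.isSection he hφ₀.sameValue
  have hB := hφ₀.normalizationEquations hU hH hπ hφ he
  refine ⟨fun α => ⟨d α, (hd α).iotaLeaf_eq hH hπ hφ⟩,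
    CRSymbol.isGauge_refl.modifiedSymbol_eq_symbolOfMatrices hH hπ hφ hφ he hd hd0,
    _, hB, fun B' hB' => hB.unique hB' hH hφ he,
    fun φ' hφ' c L hL => hφ'.modifiedSymbol_eq hH hπ hφ he hB hL, fun φ' φ'' hφ' hφ'' => ?_, ?_,
    fun φ' hφ' h => CRSymbol.leafSymbol_eq h hH hπ hφ'.isSection he⟩
  · rw [(hφ'.modifiedSymbol_eq hH hπ hφ he hB fun α =>
      CRSymbol.isClassOf_mk (CRSymbol.gaugeElt_mem p (e α p) U u)).2,
      (hφ''.modifiedSymbol_eq hH hπ hφ he hB fun α =>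
      CRSymbol.isClassOf_mk (CRSymbol.gaugeElt_mem p (e α p) U u)).2]
  · obtain ⟨φ', V, v, h₁, h₂, h₃, h₄⟩ := hH.exists_gauge_involutionConst hφ₀.isSection
    exact ⟨φ', hφ₀.of_isGauge h₂ h₁ hH hπ he h₃, h₄⟩
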